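/- Let $F$ be a field of characteristic $\neq 2$, let $E/F$ be a quadratic field extension with nontrivial automorphism $\rho$, and let $\mathbf i\in E^\times$ satisfy $\mathbf i^\rho=-\mathbf i$. Let $\mathbf V$ be a 4-dimensional $E$-space with a non-degenerate hermitian form $(\cdot,\cdot)$, where $(v\alpha,w\beta)=\alpha^\rho(v,w)\beta$. Put $\tilde{\mathbf V}=\wedge^2\mathbf V$ and fix an $E$-linear isomorphism $d:\wedge^4\mathbf V\simeq E$. Let $\varphi:\mathbf V\to\mathbf V^*$ be the conjugate-linear map $\varphi(x)(y)=(x,y)$. Let $\iota:\wedge^r(\mathbf V^*)\to(\wedge^r\mathbf V)^*$ be induced by $\det(\lambda_i(v_j))$, so that $\iota\circ\wedge^r\varphi$ is a hermitian form $(\cdot,\cdot)_{\wedge^r\mathbf V}$ on $\wedge^r\mathbf V$. Let $\psi:\wedge^2\mathbf V\to(\wedge^2\mathbf V)^*$ be $\psi(x)(y)=d(x\wedge y)$. Let $J=(v,v)_{\wedge^4\mathbf V}$, where $d(v)=1$. 1. The map $\psi$ is bijective and $J\in F^\times$. The conjugate-linear map $L=\psi^{-1}\circ\iota\circ\wedge^2\varphi$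 satisfies $L^2=J$. The algebra $B=E+E\mathbf j$ with $\mathbf j^2=J$ and $\alpha\mathbf j=\mathbf j\alpha^\rho$ for $\alpha\in E$ is a quaternion algebra over $F$. The rule $x\cdot(\alpha+\mathbf j\beta)=x\alpha+L(x)\beta$ makes $\tilde{\mathbf V}$ a right $B$-module $\tilde V$, free of rank $3$. With $(x,y)=\mathbf i\,(x,y)_{\wedge^2\mathbf V}$, the formula $\langle x,y\rangle=(x,y)-J^{-1}\mathbf j\,(x\mathbf j,y)$ defines a non-degenerate $B$-skew-hermitian form on $\tilde V$ (with respect to the main involution of $B$). Let $\mathrm{GU}_E(\mathbf V)$ and $\mathrm{GU}_B(\tilde V)$ be the similitude groups, regarded as algebraic groups over $F$ with similitude factor $\nu$. Let $\mathrm{GSU}_E(\mathbf V)=\{g\in\mathrm{GU}_E(\mathbf V):\det g=\nu(g)^2\}$, and let a superscript $0$ denote the identity component. For a commutative $F$-algebra $R$ write $E_R=R\otimes_FE$ and $\rho$ for $1\otimes\rho$ on $E_R$. 2. The map $g\mapsto\wedge^2g$ defines a homomorphism of algebraic groups $\tilde\xi:\mathrm{GSU}_E(\mathbf V)\to\mathrm{GU}_B(\tilde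 V)^0$. It is an isogeny: it is surjective on points over every algebraically closed field $K\supseteq F$, and its kernel on $R$-points, for every $R$, is the set of scalars $r\in E_R$ with $r^2=1$, which for $R=F$ is $\{\pm1\}$. 3. There is an isomorphism $\xi:\mathrm{PGU}_E(\mathbf V)=\mathrm{GU}_E(\mathbf V)/E^\times\simeq\mathrm{PGU}_B(\tilde V)^0=\mathrm{GU}_B(\tilde V)^0/F^\times$ induced by $g\mapsto\beta\cdot\wedge^2g$, where $\beta/\beta^\rho=\nu(g)^2/\det g$. Precisely, for every local commutative $F$-algebra $R$ and every $g\in\mathrm{GU}_E(\mathbf V)(R)$ there is $\beta\in E_R^\times$ with $\beta\det g=\nu(g)^2\beta^\rho$; for each such $\beta$ one has $\beta\cdot\wedge^2g\in\mathrm{GU}_B(\tilde V)^0(R)$; and $g\mapsto\beta\cdot\wedge^2g$ induces a group isomorphism $\xi_R:\mathrm{GU}_E(\mathbf V)(R)/E_R^\times\simeq\mathrm{GU}_B(\tilde V)^0(R)/R^\times$, natural in $R$. 4. Let $\mathbf V=\mathbf V_1\oplus\mathbf V_2$ be an orthogonal decomposition with $\dim_E\mathbf V_1=\dim_E\mathbf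 V_2=2$. Let $V^\sharp\subset\tilde V$ be the image of $\mathbf V_1\otimes\mathbf V_2$ under $v\otimes w\mapsto v\wedge w$, and $V_0^\sharp=\wedge^2\mathbf V_1\oplus\wedge^2\mathbf V_2$. Then $\tilde V=V^\sharp\oplus V_0^\sharp$ is an orthogonal decomposition into $B$-submodules. Let $\mathrm G(\mathrm U_E(\mathbf V_1)\times\mathrm U_E(\mathbf V_2))$ and $\mathrm G(\mathrm U_B(V^\sharp)\times\mathrm U_B(V_0^\sharp))$ be the groups of pairs of similitudes with equal similitude factors. Then $\tilde\xi$ restricts to an isogeny $\mathrm{GSU}_E(\mathbf V)\cap\mathrm G(\mathrm U_E(\mathbf V_1)\times\mathrm U_E(\mathbf V_2))\to\mathrm G(\mathrm U_B(V^\sharp)\times\mathrm U_B(V_0^\sharp))^0$, again surjective on points over algebraically closed fields. Moreover $\xi$ restricts to an isomorphism $$\mathrm G(\mathrm U_E(\mathbf V_1)\times\mathrm U_E(\mathbf V_2))/E^\times\simeq\mathrm G(\mathrm U_B(V^\sharp)\times\mathrm U_B(V_0^\sharp))^0/F^\times,$$ that is, to such isomorphisms on points over every local commutative $F$-algebra.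 -/

import Mathlib

open scoped TensorProduct

universe u v w

namespace ExcIso

noncomputable section

/-! ### Exterior powers of conjugate-linear maps -/

section Semilinear

variable {E : Type*} [Field E]

/-- The module `M` with its scalar action twisted by the automorphism `ρ`. -/
def Twist (_ρ : E →+* E) (M : Type*) : Type _ := M

instance (ρ : E →+* E) (M : Type*) [AddCommGroup M] : AddCommGroup (Twist ρ M) :=
  inferInstanceAs (AddCommGroup M)

instance (ρ : E →+* E) (M : Type*) [AddCommGroup M] [Module E M] : Module E (Twist ρ M) :=
  Module.compHom M ρ

variable {ρ : E →+* E} {M N : Type*} [AddCommGroup M] [Module E M] [AddCommGroup N] [Module E N]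

/-- A conjugate-linear map, as a linear map to the twisted module. -/
def toTwist (f : M →ₛₗ[ρ] N) : M →ₗ[E] Twist ρ N where
  toFun x := f x
  map_add' := f.map_add
  map_smul' a x := f.map_smulₛₗ a x

/-- A linear map to the twisted module, as a conjugate-linear map. -/
def ofTwist (f : M →ₗ[E] Twist ρ N) : M →ₛₗ[ρ] N where
  toFun x := f x
  map_add' := f.map_add
  map_smul' a x := f.map_smul a x

/-- The alternating map `(x₁, …, xₙ) ↦ f x₁ ∧ … ∧ f xₙ` for a conjugate-linear map `f`. -/
def altSemi (n : ℕ) (f : M →ₛₗ[ρ] N) : M [⋀^Fin n]→ₗ[E] Twist ρ (⋀[E]^n N) where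
  toFun x := (exteriorPower.ιMulti E n (fun i => f (x i)) : ⋀[E]^n N)
  map_update_add' := by
    intro inst x i a b
    have h : ∀ c : M, (fun j => f (Function.update x i c j)) =
        Function.update (fun j => f (x j)) i (f c) := fun c => by
      ext j
      by_cases hj : j = i
      · subst hj; simp
      · simp [hj]
    rw [h, h, h, map_add]
    exact (exteriorPower.ιMulti E n).map_update_add _ _ _ _
  map_update_smul' := by
    intro inst x i a b
    have h : ∀ c : M, (fun j => f (Function.update x i c j)) =
        Function.update (fun j => f (x j)) i (f c) := fun c => by
      ext j
      by_cases hj : j = i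
      · subst hj; simp
      · simp [hj]
    rw [h, h, map_smulₛₗ]
    exact (exteriorPower.ιMulti E n).map_update_smul _ _ _ _
  map_eq_zero_of_eq' := by
    intro x i j hij hne
    exact (exteriorPower.ιMulti E n).map_eq_zero_of_eq _ (by simp [hij]) hne

/-- The conjugate-linear map `⋀ⁿ f : ⋀ⁿ M → ⋀ⁿ N`, `x₁ ∧ … ∧ xₙ ↦ f x₁ ∧ … ∧ f xₙ`, induced by a
conjugate-linear map `f : M → N`. -/
def mapSemi (n : ℕ) (f : M →ₛₗ[ρ] N) : (⋀[E]^n M) →ₛₗ[ρ] (⋀[E]^n N) :=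
  ofTwist (exteriorPower.alternatingMapLinearEquiv (altSemi n f))

theorem mapSemi_ιMulti (n : ℕ) (f : M →ₛₗ[ρ] N) (x : Fin n → M) :
    mapSemi n f (exteriorPower.ιMulti E n x) = exteriorPower.ιMulti E n (fun i => f (x i)) := by
  have h := exteriorPower.alternatingMapLinearEquiv_apply_ιMulti (altSemi n f) x
  exact h

end Semilinear

/-! ### Linear algebra of a hermitian space -/

section Hermitian

variable {E : Type v} [Field E] {V : Type w} [AddCommGroup V] [Module E V]

/-- `ι ∘ ⋀ʳ φ : ⋀ʳ V → (⋀ʳ V)*`, where `φ : V → V*`, `φ x y = (x, y)`, is the conjugate-linear map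
given by the sesquilinear form `H`, and `ι : ⋀ʳ (V*) → (⋀ʳ V)*` is induced by
`(λ₁, …, λᵣ, v₁, …, vᵣ) ↦ det (λᵢ (vⱼ))`. It is viewed as a sesquilinear form on `⋀ʳ V`. -/
def hermPow {ρ : E →+* E} (r : ℕ) (H : V →ₛₗ[ρ] V →ₗ[E] E) :
    (⋀[E]^r V) →ₛₗ[ρ] (⋀[E]^r V) →ₗ[E] E :=
  (exteriorPower.pairingDual E V r).comp (mapSemi (N := Module.Dual E V) r H)

theorem hermPow_ιMulti {ρ : E →+* E} (r : ℕ) (H : V →ₛₗ[ρ] V →ₗ[E] E) (x y : Fin r → V) :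
    hermPow r H (exteriorPower.ιMulti E r x) (exteriorPower.ιMulti E r y) =
      Matrix.det (Matrix.of fun i j => H (x i) (y j)) := by
  have h := mapSemi_ιMulti (N := Module.Dual E V) r H x
  rw [hermPow, LinearMap.comp_apply, h, exteriorPower.pairingDual_ιMulti_ιMulti,
    ← Matrix.det_transpose]
  rfl

/-- `vol (H, d) = h (v, v)`, where `h` is the form on `⋀⁴ V` induced by `H` and `d v = 1`. -/
def vol {ρ : E →+* E} (H : V →ₛₗ[ρ] V →ₗ[E] E) (d : (⋀[E]^4 V) ≃ₗ[E] E) : E :=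
  hermPow 4 H (d.symm 1) (d.symm 1)

/-- The product `⋀² V × ⋀² V → ⋀⁴ V`. -/
def wedgeProd : (⋀[E]^2 V) →ₗ[E] (⋀[E]^2 V) →ₗ[E] (⋀[E]^4 V) :=
  LinearMap.mk₂ E
    (fun x y => ⟨(x : ExteriorAlgebra E V) * y, by
      have h := Submodule.mul_mem_mul x.2 y.2
      rwa [← pow_add] at h⟩)
    (fun _ _ _ => Subtype.ext (add_mul _ _ _))
    (fun _ _ _ => Subtype.ext (smul_mul_assoc _ _ _))
    (fun _ _ _ => Subtype.ext (mul_add _ _ _))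
    (fun _ _ _ => Subtype.ext (mul_smul_comm _ _ _))

/-- `ψ : ⋀² V → (⋀² V)*`, `ψ x y = d (x ∧ y)`. -/
def psi (d : (⋀[E]^4 V) ≃ₗ[E] E) : (⋀[E]^2 V) →ₗ[E] Module.Dual E (⋀[E]^2 V) :=
  wedgeProd.compr₂ d.toLinearMap

/-- `L = ψ⁻¹ ∘ ι ∘ ⋀² φ`. -/
def opL {ρ : E →+* E} (H : V →ₛₗ[ρ] V →ₗ[E] E) (d : (⋀[E]^4 V) ≃ₗ[E] E)
    (hψ : Function.Bijective (psi d)) : (⋀[E]^2 V) →ₛₗ[ρ] (⋀[E]^2 V) :=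
  (LinearEquiv.ofBijective (psi d) hψ).symm.toLinearMap.comp (hermPow 2 H)

variable {F : Type u} [Field F] [Algebra F E] [Module F V] [IsScalarTower F E V]

/-- The `F`-bilinear map `V × V → ⋀²_E V`, `(v, w) ↦ v ∧ w`. -/
def wedge : V →ₗ[F] V →ₗ[F] (⋀[E]^2 V) :=
  LinearMap.mk₂ F (fun x y => exteriorPower.ιMulti E 2 ![x, y])
    (fun x x' y => by
      apply Subtype.ext
      simp [ExteriorAlgebra.ιMulti_apply, add_mul])
    (fun c x y => by
      apply Subtype.ext
      rw [← algebraMap_smul E c x, ← algebraMap_smul E c (exteriorPower.ιMulti E 2 ![x, y])]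
      simp [ExteriorAlgebra.ιMulti_apply])
    (fun x y y' => by
      apply Subtype.ext
      simp [ExteriorAlgebra.ιMulti_apply, mul_add])
    (fun c x y => by
      apply Subtype.ext
      rw [← algebraMap_smul E c y, ← algebraMap_smul E c (exteriorPower.ιMulti E 2 ![x, y])]
      simp [ExteriorAlgebra.ιMulti_apply])

end Hermitian

/-! ### The quaternion algebra -/

section Quaternion

variable {F : Type u} [Field F] {E : Type v} [Field E] [Algebra F E]

/-- The algebra `B = E + E 𝐣` with `𝐣² = J` and `α 𝐣 = 𝐣 α^ρ` for `α ∈ E`. The element with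
coordinates `fst = a`, `snd = b` is `a + 𝐣 b`. -/
@[ext]
structure QuatAlg (ρ : E ≃ₐ[F] E) (J : F) : Type v where
  fst : E
  snd : E

namespace QuatAlg

variable {ρ : E ≃ₐ[F] E} {J : F}

instance : Zero (QuatAlg ρ J) := ⟨⟨0, 0⟩⟩
instance : One (QuatAlg ρ J) := ⟨⟨1, 0⟩⟩
instance : Add (QuatAlg ρ J) := ⟨fun x y => ⟨x.fst + y.fst, x.snd + y.snd⟩⟩
instance : Neg (QuatAlg ρ J) := ⟨fun x => ⟨-x.fst, -x.snd⟩⟩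
instance : Sub (QuatAlg ρ J) := ⟨fun x y => ⟨x.fst - y.fst, x.snd - y.snd⟩⟩
instance : SMul F (QuatAlg ρ J) := ⟨fun c x => ⟨c • x.fst, c • x.snd⟩⟩
instance : SMul ℕ (QuatAlg ρ J) := ⟨fun c x => ⟨c • x.fst, c • x.snd⟩⟩
instance : SMul ℤ (QuatAlg ρ J) := ⟨fun c x => ⟨c • x.fst, c • x.snd⟩⟩

/-- `(a + 𝐣 b) (c + 𝐣 e) = (a c + J b^ρ e) + 𝐣 (a^ρ e + b c)`. -/
instance : Mul (QuatAlg ρ J) :=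
  ⟨fun x y => ⟨x.fst * y.fst + algebraMap F E J * ρ x.snd * y.snd,
    ρ x.fst * y.snd + x.snd * y.fst⟩⟩

@[simp] theorem fst_zero : (0 : QuatAlg ρ J).fst = 0 := rfl
@[simp] theorem snd_zero : (0 : QuatAlg ρ J).snd = 0 := rfl
@[simp] theorem fst_one : (1 : QuatAlg ρ J).fst = 1 := rfl
@[simp] theorem snd_one : (1 : QuatAlg ρ J).snd = 0 := rfl
@[simp] theorem fst_add (x y : QuatAlg ρ J) : (x + y).fst = x.fst + y.fst := rfl
@[simp] theorem snd_add (x y : QuatAlg ρ J) : (x + y).snd = x.snd + y.snd := rfl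
@[simp] theorem fst_neg (x : QuatAlg ρ J) : (-x).fst = -x.fst := rfl
@[simp] theorem snd_neg (x : QuatAlg ρ J) : (-x).snd = -x.snd := rfl
@[simp] theorem fst_sub (x y : QuatAlg ρ J) : (x - y).fst = x.fst - y.fst := rfl
@[simp] theorem snd_sub (x y : QuatAlg ρ J) : (x - y).snd = x.snd - y.snd := rfl
@[simp] theorem fst_smul (c : F) (x : QuatAlg ρ J) : (c • x).fst = c • x.fst := rfl
@[simp] theorem snd_smul (c : F) (x : QuatAlg ρ J) : (c • x).snd = c • x.snd := rfl
@[simp] theorem fst_mul (x y : QuatAlg ρ J) :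
    (x * y).fst = x.fst * y.fst + algebraMap F E J * ρ x.snd * y.snd := rfl
@[simp] theorem snd_mul (x y : QuatAlg ρ J) :
    (x * y).snd = ρ x.fst * y.snd + x.snd * y.fst := rfl

/-- The coordinates, as an injection used to transport the additive structure. -/
def toProd (x : QuatAlg ρ J) : E × E := (x.fst, x.snd)

theorem toProd_injective : Function.Injective (toProd : QuatAlg ρ J → E × E) := fun _ _ h =>
  QuatAlg.ext (congrArg Prod.fst h) (congrArg Prod.snd h)

instance : AddCommGroup (QuatAlg ρ J) :=
  toProd_injective.addCommGroup toProd rfl (fun _ _ => rfl) (fun _ => rfl) (fun _ _ => rfl)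
    (fun _ _ => rfl) (fun _ _ => rfl)

instance : Module F (QuatAlg ρ J) :=
  toProd_injective.module F ⟨⟨toProd, rfl⟩, fun _ _ => rfl⟩ (fun _ _ => rfl)

theorem invol [Algebra.IsQuadraticExtension F E] (ρ : E ≃ₐ[F] E) (x : E) : ρ (ρ x) = x := by
  have h1 : Fintype.card (E ≃ₐ[F] E) ≤ 2 := by
    rw [← Algebra.IsQuadraticExtension.finrank_eq_two F E]
    exact AlgEquiv.card_le
  have h2 : 0 < Fintype.card (E ≃ₐ[F] E) := Fintype.card_pos
  have h3 : ρ ^ Fintype.card (E ≃ₐ[F] E) = 1 := pow_card_eq_one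
  have h4 : ρ ^ 2 = 1 := by
    generalize Fintype.card (E ≃ₐ[F] E) = n at h1 h2 h3
    interval_cases n
    · rw [pow_one] at h3
      rw [h3, one_pow]
    · exact h3
  have h5 := congrArg (fun τ : E ≃ₐ[F] E => τ x) h4
  simpa [pow_two] using h5

instance [Algebra.IsQuadraticExtension F E] : Ring (QuatAlg ρ J) where
  __ := (inferInstance : AddCommGroup (QuatAlg ρ J))
  left_distrib x y z := by ext <;> simp <;> ring
  right_distrib x y z := by ext <;> simp <;> ring
  zero_mul x := by ext <;> simp
  mul_zero x := by ext <;> simp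
  mul_assoc x y z := by ext <;> simp [invol] <;> ring
  one_mul x := by ext <;> simp
  mul_one x := by ext <;> simp

instance [Algebra.IsQuadraticExtension F E] : Algebra F (QuatAlg ρ J) :=
  Algebra.ofModule
    (fun c x y => by ext <;> simp [Algebra.smul_def] <;> ring)
    (fun c x y => by ext <;> simp [Algebra.smul_def] <;> ring)

@[simp] theorem fst_algebraMap [Algebra.IsQuadraticExtension F E] (c : F) :
    (algebraMap F (QuatAlg ρ J) c).fst = algebraMap F E c := by
  rw [Algebra.algebraMap_eq_smul_one, Algebra.algebraMap_eq_smul_one]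
  rfl

@[simp] theorem snd_algebraMap [Algebra.IsQuadraticExtension F E] (c : F) :
    (algebraMap F (QuatAlg ρ J) c).snd = 0 := by
  rw [Algebra.algebraMap_eq_smul_one]
  exact smul_zero c

/-- The main involution `(a + 𝐣 b)* = a^ρ - 𝐣 b`. -/
def conj (x : QuatAlg ρ J) : QuatAlg ρ J := ⟨ρ x.fst, -x.snd⟩

end QuatAlg

end Quaternion

/-! ### The `B`-space `⋀² V` -/

section BSpace

variable {F : Type u} [Field F] {E : Type v} [Field E] [Algebra F E]
  [Algebra.IsQuadraticExtension F E] {V : Type w} [AddCommGroup V] [Module E V] [Module F V]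
  [IsScalarTower F E V] {ρ : E ≃ₐ[F] E}

/-- The right multiplication `x ↦ x · b` on `⋀² V`, where `x · (α + 𝐣 β) = x α + L(x) β`. -/
def bAct (H : V →ₛₗ[(ρ : E →+* E)] V →ₗ[E] E) (d : (⋀[E]^4 V) ≃ₗ[E] E)
    (hψ : Function.Bijective (psi d)) (J : F) (b : QuatAlg ρ J) : Module.End F (⋀[E]^2 V) where
  toFun x := b.fst • x + b.snd • opL H d hψ x
  map_add' x y := by rw [map_add, smul_add, smul_add]; abel
  map_smul' c x := by
    rw [← algebraMap_smul E c x, map_smulₛₗ, RingHom.id_apply,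
      ← algebraMap_smul E c (_ + _), smul_add, smul_comm, smul_comm b.snd]
    simp

/-- The skew-hermitian form `(x, y) = 𝐢 (x, y)_{⋀² V}`. -/
def skewForm (H : V →ₛₗ[(ρ : E →+* E)] V →ₗ[E] E) (i : E) (x y : ⋀[E]^2 V) : E :=
  i * hermPow 2 H x y

/-- The form `⟨x, y⟩ = (x, y) - J⁻¹ 𝐣 (x 𝐣, y)` on `⋀² V`, with values in `B = E + 𝐣 E`. -/
def bForm (H : V →ₛₗ[(ρ : E →+* E)] V →ₗ[E] E) (d : (⋀[E]^4 V) ≃ₗ[E] E)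
    (hψ : Function.Bijective (psi d)) (i : E) (J : F) :
    (⋀[E]^2 V) →ₗ[F] (⋀[E]^2 V) →ₗ[F] QuatAlg ρ J :=
  LinearMap.mk₂ F
    (fun x y => ⟨skewForm H i x y, -(algebraMap F E J⁻¹ * skewForm H i (opL H d hψ x) y)⟩)
    (fun x x' y => by ext <;> simp [skewForm] <;> ring)
    (fun c x y => by
      have h1 : ∀ z : ⋀[E]^2 V, hermPow 2 H (c • z) y = algebraMap F E c * hermPow 2 H z y := by
        intro z
        rw [← algebraMap_smul E c z, map_smulₛₗ, LinearMap.smul_apply, smul_eq_mul]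
        simp
      have h2 : opL H d hψ (c • x) = c • opL H d hψ x := by
        rw [← algebraMap_smul E c x, map_smulₛₗ, ← algebraMap_smul E c (opL H d hψ x)]
        simp
      ext <;> simp [skewForm, Algebra.smul_def, h1, h2] <;> ring)
    (fun x y y' => by ext <;> simp [skewForm] <;> ring)
    (fun c x y => by
      rw [← algebraMap_smul E c y]
      ext <;> simp [skewForm, Algebra.smul_def] <;> ring)

end BSpace

/-! ### Group functors

For a vector space `V` over `F`, a group functor is given by subgroups of `GL_R (R ⊗ V)`, for all
commutative `F`-algebras `R`. -/

section Groups

variable (F : Type u) [Field F]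

/-- `GL_F(V)(R) = GL_R (R ⊗ V)`. -/
abbrev GLp (R : Type u) [CommRing R] [Algebra F R] (V : Type w) [AddCommGroup V] [Module F V] :
    Type (max u w) :=
  (R ⊗[F] V) ≃ₗ[R] (R ⊗[F] V)

variable {F}

/-- The map `GL_F(V)(R) → GL_F(V)(S)` induced by a homomorphism `R → S` of `F`-algebras. -/
def glMap {R S : Type u} [CommRing R] [Algebra F R] [CommRing S] [Algebra F S] (f : R →ₐ[F] S)
    {V : Type w} [AddCommGroup V] [Module F V] (g : GLp F R V) : GLp F S V :=
  letI := f.toRingHom.toAlgebra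
  haveI : IsScalarTower F R S := IsScalarTower.of_algebraMap_eq fun x => (f.commutes x).symm
  (TensorProduct.AlgebraTensorModule.cancelBaseChange F R S S V).symm ≪≫ₗ
    (g.baseChange R S _ _) ≪≫ₗ TensorProduct.AlgebraTensorModule.cancelBaseChange F R S S V

theorem glMap_rTensor {R S : Type u} [CommRing R] [Algebra F R] [CommRing S] [Algebra F S]
    (f : R →ₐ[F] S) {V : Type w} [AddCommGroup V] [Module F V] (g : GLp F R V)
    (x : R ⊗[F] V) :
    glMap f g (f.toLinearMap.rTensor V x) = f.toLinearMap.rTensor V (g x) := by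
  let _ := f.toRingHom.toAlgebra
  have _ : IsScalarTower F R S := IsScalarTower.of_algebraMap_eq fun x => (f.commutes x).symm
  have key : ∀ y : R ⊗[F] V, TensorProduct.AlgebraTensorModule.cancelBaseChange F R S S V
      ((1 : S) ⊗ₜ[R] y) = f.toLinearMap.rTensor V y := by
    intro y
    induction y with
    | zero => simp
    | add y z hy hz => rw [TensorProduct.tmul_add, map_add, map_add, hy, hz]
    | tmul r v =>
      rw [TensorProduct.AlgebraTensorModule.cancelBaseChange_tmul, LinearMap.rTensor_tmul,
        Algebra.smul_def, mul_one]
      rfl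
  rw [← key, ← key]
  change TensorProduct.AlgebraTensorModule.cancelBaseChange F R S S V
    ((g.baseChange R S _ _) ((TensorProduct.AlgebraTensorModule.cancelBaseChange F R S S V).symm
      _)) = _
  rw [LinearEquiv.symm_apply_apply]
  rfl

theorem glMap_mul {R S : Type u} [CommRing R] [Algebra F R] [CommRing S] [Algebra F S]
    (f : R →ₐ[F] S) {V : Type w} [AddCommGroup V] [Module F V] (g g' : GLp F R V) :
    glMap f (g * g') = glMap f g * glMap f g' := by
  let _ := f.toRingHom.toAlgebra
  have _ : IsScalarTower F R S := IsScalarTower.of_algebraMap_eq fun x => (f.commutes x).symm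
  have h : ∀ y : S ⊗[R] (R ⊗[F] V), (LinearEquiv.baseChange R S _ _ (g * g')) y =
      (LinearEquiv.baseChange R S _ _ g) ((LinearEquiv.baseChange R S _ _ g') y) := by
    intro y
    exact LinearMap.congr_fun (LinearMap.baseChange_comp (A := S)
      (f := (g' : R ⊗[F] V →ₗ[R] R ⊗[F] V)) (g : R ⊗[F] V →ₗ[R] R ⊗[F] V)) y
  ext x
  change TensorProduct.AlgebraTensorModule.cancelBaseChange F R S S V
    ((LinearEquiv.baseChange R S _ _ (g * g'))
      ((TensorProduct.AlgebraTensorModule.cancelBaseChange F R S S V).symm x)) =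
    TensorProduct.AlgebraTensorModule.cancelBaseChange F R S S V
    ((LinearEquiv.baseChange R S _ _ g)
      ((TensorProduct.AlgebraTensorModule.cancelBaseChange F R S S V).symm
        (TensorProduct.AlgebraTensorModule.cancelBaseChange F R S S V
    ((LinearEquiv.baseChange R S _ _ g')
      ((TensorProduct.AlgebraTensorModule.cancelBaseChange F R S S V).symm x)))))
  rw [LinearEquiv.symm_apply_apply, h]

theorem glMap_one {R S : Type u} [CommRing R] [Algebra F R] [CommRing S] [Algebra F S]
    (f : R →ₐ[F] S) {V : Type w} [AddCommGroup V] [Module F V] :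
    glMap f (1 : GLp F R V) = 1 := by
  have h := glMap_mul f (1 : GLp F R V) 1
  rw [mul_one] at h
  exact left_eq_mul.mp h

theorem glMap_inv {R S : Type u} [CommRing R] [Algebra F R] [CommRing S] [Algebra F S]
    (f : R →ₐ[F] S) {V : Type w} [AddCommGroup V] [Module F V] (g : GLp F R V) :
    glMap f g⁻¹ = (glMap f g)⁻¹ := by
  rw [eq_inv_iff_mul_eq_one, ← glMap_mul, inv_mul_cancel, glMap_one]

section Similitudes

variable {D : Type*} [AddCommGroup D] [Module F D] {V : Type w} [AddCommGroup V] [Module F V]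

/-- `g` is a similitude of the `D`-valued form `h`, with similitude factor `ν`. -/
def IsSim (h : V →ₗ[F] V →ₗ[F] D) {R : Type u} [CommRing R] [Algebra F R]
    (g : GLp F R V) (ν : Rˣ) : Prop :=
  ∀ x y : R ⊗[F] V, LinearMap.BilinMap.baseChange R h (g x) (g y) =
    (ν : R) • LinearMap.BilinMap.baseChange R h x y

/-- The `R`-points of the similitude group `GU_D(V)` of a `D`-valued form `h` on `V`: the
automorphisms of `R ⊗ V` that commute with the action of `D` and are similitudes of `h`. -/
def GU (act : D → Module.End F V) (h : V →ₗ[F] V →ₗ[F] D) (R : Type u) [CommRing R]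
    [Algebra F R] : Subgroup (GLp F R V) where
  carrier := {g | (∀ b x, g ((act b).baseChange R x) = (act b).baseChange R (g x)) ∧
    ∃ ν : Rˣ, IsSim h g ν}
  one_mem' := ⟨fun _ _ => rfl, 1, fun _ _ => by simp⟩
  mul_mem' := by
    rintro g g' ⟨h1, ν, h2⟩ ⟨h1', ν', h2'⟩
    refine ⟨fun b x => ?_, ν * ν', fun x y => ?_⟩
    · rw [LinearEquiv.mul_apply, LinearEquiv.mul_apply, h1', h1]
    · rw [LinearEquiv.mul_apply, LinearEquiv.mul_apply, h2, h2', smul_smul, Units.val_mul]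
  inv_mem' := by
    rintro g ⟨h1, ν, h2⟩
    have hg : ∀ x, g (g⁻¹ x) = x := fun x => g.apply_symm_apply x
    refine ⟨fun b x => g.injective ?_, ν⁻¹, fun x y => ?_⟩
    · rw [h1, hg, hg]
    · have h3 := h2 (g⁻¹ x) (g⁻¹ y)
      rw [hg, hg] at h3
      rw [h3, smul_smul, Units.inv_mul, one_smul]

/-- The `R`-points of the stabilizer in `GL_F(V)` of a subspace `W` of `V`. -/
def stab (W : Submodule F V) (R : Type u) [CommRing R] [Algebra F R] : Subgroup (GLp F R V) where
  carrier := {g | (W.baseChange R).map (g : R ⊗[F] V →ₗ[R] R ⊗[F] V) = W.baseChange R}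
  one_mem' := Submodule.map_id _
  mul_mem' := by
    intro g g' h h'
    change Submodule.map ((g : R ⊗[F] V →ₗ[R] R ⊗[F] V) ∘ₗ (g' : R ⊗[F] V →ₗ[R] R ⊗[F] V)) _ = _
    rw [Submodule.map_comp, h', h]
  inv_mem' := by
    intro g h
    change Submodule.map _ _ = _
    conv_lhs => rw [← h, ← Submodule.map_comp]
    convert Submodule.map_id _
    ext x
    exact g.symm_apply_apply _

end Similitudes

/-! ### Scalars from `E` and the `E`-linear determinant -/

section Scalars

variable {E : Type v} [Field E] [Algebra F E] {V : Type w} [AddCommGroup V] [Module E V]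
  [Module F V] [IsScalarTower F E V]

/-- The action of `E` on `V` by `F`-linear maps. -/
def actE (e : E) : Module.End F V := Algebra.lsmul F F V e

/-- The action of `R ⊗ E` on `R ⊗ V`, `(r ⊗ e) (s ⊗ v) = r s ⊗ e v`. -/
def scal (R : Type u) [CommRing R] [Algebra F R] :
    R ⊗[F] E →ₐ[R] Module.End R (R ⊗[F] V) :=
  Algebra.TensorProduct.lift (Algebra.ofId R _)
    ((Module.End.baseChangeHom F R V).comp (Algebra.lsmul F F V : E →ₐ[F] Module.End F V))
    (fun r _ => Algebra.commutes r _)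

theorem scal_tmul (R : Type u) [CommRing R] [Algebra F R] (r : R) (e : E) (x : R ⊗[F] V) :
    scal R (r ⊗ₜ[F] e) x = r • (actE e).baseChange R x := by
  rfl

/-- The involution `1 ⊗ ρ` of `R ⊗ E`. -/
def conjR (ρ : E ≃ₐ[F] E) (R : Type u) [CommRing R] [Algebra F R] :
    R ⊗[F] E ≃ₐ[R] R ⊗[F] E :=
  Algebra.TensorProduct.congr AlgEquiv.refl ρ

/-- An automorphism of `R ⊗ V` that commutes with `E` commutes with `R ⊗ E`. -/
theorem scal_comm {R : Type u} [CommRing R] [Algebra F R] (g : GLp F R V)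
    (hg : ∀ (e : E) x, g ((actE e).baseChange R x) = (actE e).baseChange R (g x))
    (a : R ⊗[F] E) (x : R ⊗[F] V) : g (scal R a x) = scal R a (g x) := by
  induction a with
  | zero => simp
  | add a b ha hb => simp only [map_add, LinearMap.add_apply, ha, hb]
  | tmul r e => rw [scal_tmul, scal_tmul, map_smul, hg]

/-- The determinant, in `R ⊗ E`, of an `R ⊗ E`-linear automorphism of `R ⊗ V`. -/
def detE {R : Type u} [CommRing R] [Algebra F R] (g : GLp F R V)
    (hg : ∀ (e : E) x, g ((actE e).baseChange R x) = (actE e).baseChange R (g x)) : R ⊗[F] E :=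
  letI : Module (R ⊗[F] E) (R ⊗[F] V) := Module.compHom _ (scal (E := E) (V := V) R).toRingHom
  LinearMap.det (A := R ⊗[F] E) (M := R ⊗[F] V)
    { toFun := g, map_add' := g.map_add, map_smul' := fun a x => scal_comm g hg a x }

theorem detE_one {R : Type u} [CommRing R] [Algebra F R]
    (hg : ∀ (e : E) x, (1 : GLp F R V) ((actE e).baseChange R x) =
      (actE e).baseChange R ((1 : GLp F R V) x)) : detE (1 : GLp F R V) hg = 1 := by
  let _ : Module (R ⊗[F] E) (R ⊗[F] V) := Module.compHom _ (scal (E := E) (V := V) R).toRingHom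
  exact LinearMap.det_id (A := R ⊗[F] E) (M := R ⊗[F] V)

theorem detE_mul {R : Type u} [CommRing R] [Algebra F R] (g g' : GLp F R V)
    (hg : ∀ (e : E) x, g ((actE e).baseChange R x) = (actE e).baseChange R (g x))
    (hg' : ∀ (e : E) x, g' ((actE e).baseChange R x) = (actE e).baseChange R (g' x))
    (hgg : ∀ (e : E) x, (g * g') ((actE e).baseChange R x) =
      (actE e).baseChange R ((g * g') x)) :
    detE (g * g') hgg = detE g hg * detE g' hg' := by
  let _ : Module (R ⊗[F] E) (R ⊗[F] V) := Module.compHom _ (scal (E := E) (V := V) R).toRingHom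
  exact LinearMap.det_comp (A := R ⊗[F] E) (M := R ⊗[F] V)
    { toFun := g, map_add' := g.map_add, map_smul' := fun a x => scal_comm g hg a x }
    { toFun := g', map_add' := g'.map_add, map_smul' := fun a x => scal_comm g' hg' a x }

/-- The scalars from `(R ⊗ E)ˣ`, as automorphisms of `R ⊗ V`. -/
def scalars (E : Type v) [Field E] [Algebra F E] (V : Type w) [AddCommGroup V] [Module E V]
    [Module F V] [IsScalarTower F E V] (R : Type u) [CommRing R] [Algebra F R] :
    Subgroup (GLp F R V) :=
  ((LinearMap.GeneralLinearGroup.generalLinearEquiv R (R ⊗[F] V)).toMonoidHom.comp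
    (Units.map (scal (F := F) (E := E) (V := V) R : R ⊗[F] E →* Module.End R (R ⊗[F] V)))).range

/-- The homotheties of ratio in `Rˣ`, as automorphisms of `R ⊗ V`. -/
def homotheties (V : Type w) [AddCommGroup V] [Module F V] (R : Type u) [CommRing R]
    [Algebra F R] : Subgroup (GLp F R V) :=
  (DistribMulAction.toModuleAut R (R ⊗[F] V) (S := Rˣ)).range

instance (V : Type w) [AddCommGroup V] [Module F V] (R : Type u) [CommRing R] [Algebra F R] :
    (homotheties V R : Subgroup (GLp F R V)).Normal where
  conj_mem := by
    rintro _ ⟨c, rfl⟩ g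
    refine ⟨c, LinearEquiv.ext fun x => ?_⟩
    have h : g ((c : R) • g⁻¹ x) = (c : R) • x := by
      rw [map_smul]
      exact congrArg _ (g.apply_symm_apply x)
    exact h.symm

theorem scalars_normal {R : Type u} [CommRing R] [Algebra F R] (G : Subgroup (GLp F R V))
    (hG : ∀ g ∈ G, ∀ (e : E) x, g ((actE e).baseChange R x) = (actE e).baseChange R (g x)) :
    ((scalars E V R).subgroupOf G).Normal where
  conj_mem := by
    rintro ⟨_, h⟩ hc ⟨g, hg⟩
    obtain ⟨c, rfl⟩ := Subgroup.mem_subgroupOf.mp hc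
    refine ⟨c, LinearEquiv.ext fun x => ?_⟩
    have h : g (scal R (c : R ⊗[F] E) (g⁻¹ x)) = scal R (c : R ⊗[F] E) x := by
      rw [scal_comm g (hG g hg)]
      exact congrArg _ (g.apply_symm_apply x)
    exact h.symm

instance (h : V →ₗ[F] V →ₗ[F] E) (R : Type u) [CommRing R] [Algebra F R] :
    ((scalars E V R).subgroupOf (GU (actE (E := E)) h R)).Normal :=
  scalars_normal _ fun _ hg => hg.1

instance (h : V →ₗ[F] V →ₗ[F] E) (R : Type u) [CommRing R] [Algebra F R]
    (K : Subgroup (GLp F R V)) :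
    ((scalars E V R).subgroupOf (GU (actE (E := E)) h R ⊓ K)).Normal :=
  scalars_normal _ fun _ hg => hg.1.1

/-- The `R`-points of `GSU_E(V)`: the elements `g` of `GU_E(V)` with `det g = ν(g)²`. -/
def GSU (h : V →ₗ[F] V →ₗ[F] E) (R : Type u) [CommRing R] [Algebra F R] :
    Subgroup (GLp F R V) where
  carrier := {g | ∃ hg : g ∈ GU (actE (E := E)) h R, ∃ ν : Rˣ, IsSim h g ν ∧
    detE g hg.1 = algebraMap R (R ⊗[F] E) ((ν : R) ^ 2)}
  one_mem' := ⟨one_mem _, 1, fun _ _ => by simp, by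
    rw [detE_one, Units.val_one, one_pow, map_one]⟩
  mul_mem' := by
    rintro g g' ⟨hg, ν, h1, h2⟩ ⟨hg', ν', h1', h2'⟩
    refine ⟨mul_mem hg hg', ν * ν', fun x y => ?_, ?_⟩
    · rw [LinearEquiv.mul_apply, LinearEquiv.mul_apply, h1, h1', smul_smul, Units.val_mul]
    · rw [detE_mul g g' hg.1 hg'.1, h2, h2', ← map_mul, Units.val_mul, mul_pow]
  inv_mem' := by
    rintro g ⟨hg, ν, h1, h2⟩
    have hgx : ∀ x, g (g⁻¹ x) = x := fun x => g.apply_symm_apply x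
    refine ⟨inv_mem hg, ν⁻¹, fun x y => ?_, ?_⟩
    · have h3 := h1 (g⁻¹ x) (g⁻¹ y)
      rw [hgx, hgx] at h3
      rw [h3, smul_smul, Units.inv_mul, one_smul]
    · have h3 := detE_mul g⁻¹ g (inv_mem hg).1 hg.1 (mul_mem (inv_mem hg) hg).1
      have h4 : detE (g⁻¹ * g) (mul_mem (inv_mem hg) hg).1 = 1 := by
        simp only [inv_mul_cancel, detE_one]
      rw [h4, h2] at h3
      calc detE g⁻¹ (inv_mem hg).1 = detE g⁻¹ (inv_mem hg).1 *
            algebraMap R (R ⊗[F] E) ((ν : R) ^ 2) *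
            algebraMap R (R ⊗[F] E) (((ν⁻¹ : Rˣ) : R) ^ 2) := by
              rw [mul_assoc, ← map_mul, ← mul_pow, Units.mul_inv, one_pow, map_one, mul_one]
        _ = _ := by rw [← h3, one_mul]

/-- The form `H` of a hermitian space as an `F`-bilinear map. -/
def hermF [Algebra.IsQuadraticExtension F E] {ρ : E ≃ₐ[F] E}
    (H : V →ₛₗ[(ρ : E →+* E)] V →ₗ[E] E) : V →ₗ[F] V →ₗ[F] E :=
  LinearMap.mk₂ F (fun x y => H x y) (fun x x' y => by simp)
    (fun c x y => by
      rw [← algebraMap_smul E c x, map_smulₛₗ, LinearMap.smul_apply, ← algebraMap_smul E c (H x y)]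
      simp)
    (fun x y y' => by simp)
    (fun c x y => by
      rw [← algebraMap_smul E c y, map_smul, algebraMap_smul])

end Scalars

/-! ### Identity components -/

section IdentityComponent

/-- The polynomial functions on a vector space. -/
def polyFun (K : Type*) [Field K] (M : Type*) [AddCommGroup M] [Module K M] :
    Subalgebra K (M → K) :=
  Algebra.adjoin K (Set.range fun f : Module.Dual K M => (f : M → K))

/-- The Zariski topology on a vector space: the sets `{x | p x ≠ 0}`, for polynomial functions
`p`, are a basis of open sets. -/
@[reducible]
def zariski (K : Type*) [Field K] (M : Type*) [AddCommGroup M] [Module K M] :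
    TopologicalSpace M :=
  TopologicalSpace.generateFrom {U | ∃ p ∈ polyFun K M, U = {x | p x ≠ 0}}

theorem polyFun_comp {K : Type*} [Field K] {M N : Type*} [AddCommGroup M] [Module K M]
    [AddCommGroup N] [Module K N] (f : M →ₗ[K] N) (p : N → K) (hp : p ∈ polyFun K N) :
    p ∘ f ∈ polyFun K M := by
  induction hp using Algebra.adjoin_induction with
  | mem p hp =>
    obtain ⟨l, rfl⟩ := hp
    exact Algebra.subset_adjoin ⟨l ∘ₗ f, rfl⟩
  | algebraMap r => exact (polyFun K M).algebraMap_mem r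
  | add p q _ _ hp hq => exact add_mem hp hq
  | mul p q _ _ hp hq => exact mul_mem hp hq

theorem zariski_continuous {K : Type*} [Field K] {M N : Type*} [AddCommGroup M] [Module K M]
    [AddCommGroup N] [Module K N] (f : M →ₗ[K] N) :
    @Continuous M N (zariski K M) (zariski K N) f := by
  let _ := zariski K M
  refine continuous_generateFrom_iff.mpr ?_
  rintro _ ⟨p, hp, rfl⟩
  exact TopologicalSpace.isOpen_generateFrom_of_mem ⟨p ∘ f, polyFun_comp f p hp, rfl⟩

variable {V : Type w} [AddCommGroup V] [Module F V]

/-- The Zariski topology on `GL_K (K ⊗ V)`. -/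
@[reducible]
def zariskiGL (K : Type u) [Field K] [Algebra F K] : TopologicalSpace (GLp F K V) :=
  (zariski K (Module.End K (K ⊗[F] V))).induced fun g => (g : K ⊗[F] V →ₗ[K] K ⊗[F] V)

theorem zariskiGL_continuous_mul (K : Type u) [Field K] [Algebra F K] (g : GLp F K V) :
    @Continuous _ _ (zariskiGL K) (zariskiGL K) fun x : GLp F K V => g * x := by
  let _ := zariski K (Module.End K (K ⊗[F] V))
  let _ : TopologicalSpace (GLp F K V) := zariskiGL K
  refine continuous_induced_rng.mpr ?_
  have hc : Continuous fun x : Module.End K (K ⊗[F] V) =>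
      (g : K ⊗[F] V →ₗ[K] K ⊗[F] V) * x :=
    zariski_continuous (M := Module.End K (K ⊗[F] V)) (N := Module.End K (K ⊗[F] V))
      (LinearMap.mulLeft K (g : K ⊗[F] V →ₗ[K] K ⊗[F] V) :
        Module.End K (Module.End K (K ⊗[F] V)))
  exact hc.comp continuous_induced_dom

/-- The identity component, for the Zariski topology, of a subgroup `G` of `GL_K (K ⊗ V)`. -/
def idCompField (K : Type u) [Field K] [Algebra F K] (G : Subgroup (GLp F K V)) :
    Set (GLp F K V) :=
  @connectedComponentIn _ (zariskiGL K) (G : Set (GLp F K V)) 1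

theorem one_mem_idCompField (K : Type u) [Field K] [Algebra F K] (G : Subgroup (GLp F K V)) :
    1 ∈ idCompField K G := by
  let _ : TopologicalSpace (GLp F K V) := zariskiGL K
  exact mem_connectedComponentIn (one_mem G)

theorem inv_mul_mem_idCompField (K : Type u) [Field K] [Algebra F K] (G : Subgroup (GLp F K V))
    {a b : GLp F K V} (ha : a ∈ idCompField K G) (hb : b ∈ idCompField K G) :
    a⁻¹ * b ∈ idCompField K G := by
  let _ : TopologicalSpace (GLp F K V) := zariskiGL K
  have hsub : idCompField K G ⊆ G := connectedComponentIn_subset _ _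
  have hc : IsPreconnected (idCompField K G) := isPreconnected_connectedComponentIn
  have h1 : IsPreconnected ((fun x => a⁻¹ * x) '' idCompField K G) :=
    hc.image _ (zariskiGL_continuous_mul K a⁻¹).continuousOn
  refine h1.subset_connectedComponentIn (F := (G : Set (GLp F K V)))
    ⟨a, ha, inv_mul_cancel a⟩ ?_ ⟨b, hb, rfl⟩
  rintro _ ⟨x, hx, rfl⟩
  exact mul_mem (inv_mem (hsub ha)) (hsub hx)

/-- The `R`-points of the identity component `G⁰` of a group functor `G ⊆ GL_F(V)` given by
polynomial equations: the elements of `G(R)` all of whose specializations at geometric points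
`R → K`, `K` algebraically closed, lie in the identity component of `G(K)`. (`G⁰` is an open
subscheme of `G`, so `Spec R → G` factors through `G⁰` as soon as its geometric points do.) -/
def idComp (G : ∀ (R : Type u) [CommRing R] [Algebra F R], Subgroup (GLp F R V))
    (R : Type u) [CommRing R] [Algebra F R] : Subgroup (GLp F R V) where
  carrier := {g | g ∈ G R ∧ ∀ (K : Type u) [Field K] [IsAlgClosed K] [Algebra F K]
    (f : R →ₐ[F] K), glMap f g ∈ idCompField K (G K)}
  one_mem' := ⟨one_mem _, fun K _ _ _ f => by
    rw [glMap_one]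
    exact one_mem_idCompField K _⟩
  mul_mem' := by
    rintro g g' ⟨h1, h2⟩ ⟨h1', h2'⟩
    refine ⟨mul_mem h1 h1', fun K _ _ _ f => ?_⟩
    have h3 := inv_mul_mem_idCompField K _ (h2 K f) (one_mem_idCompField K _)
    have h4 := inv_mul_mem_idCompField K _ h3 (h2' K f)
    rwa [mul_one, inv_inv, ← glMap_mul] at h4
  inv_mem' := by
    rintro g ⟨h1, h2⟩
    refine ⟨inv_mem h1, fun K _ _ _ f => ?_⟩
    have h3 := inv_mul_mem_idCompField K _ (h2 K f) (one_mem_idCompField K _)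
    rwa [mul_one, ← glMap_inv] at h3

theorem idComp_mono {G G' : ∀ (R : Type u) [CommRing R] [Algebra F R], Subgroup (GLp F R V)}
    (h : ∀ (R : Type u) [CommRing R] [Algebra F R], G R ≤ G' R)
    (R : Type u) [CommRing R] [Algebra F R] : idComp G R ≤ idComp G' R := by
  rintro g ⟨h1, h2⟩
  refine ⟨h R h1, fun K _ _ _ f => ?_⟩
  let _ : TopologicalSpace (GLp F K V) := zariskiGL K
  exact connectedComponentIn_mono _ (show (G K : Set (GLp F K V)) ⊆ G' K from h K) (h2 K f)

end IdentityComponent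

end Groups

/-! ### The groups attached to a hermitian space -/

section Main

variable {F : Type u} [Field F] {E : Type v} [Field E] [Algebra F E]
  [Algebra.IsQuadraticExtension F E] {V : Type w} [AddCommGroup V] [Module E V] [Module F V]
  [IsScalarTower F E V] {ρ : E ≃ₐ[F] E}

/-- The `R`-bilinear map `(R ⊗ V) × (R ⊗ V) → R ⊗ ⋀²_E V`, `(x, y) ↦ x ∧ y`. -/
def wedgeR (E : Type v) [Field E] [Algebra F E] [Module E V] [IsScalarTower F E V]
    (R : Type u) [CommRing R] [Algebra F R] (x y : R ⊗[F] V) : R ⊗[F] (⋀[E]^2 V) :=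
  LinearMap.BilinMap.baseChange R (wedge (F := F) (E := E) (V := V)) x y

/-- The `R`-points of `GU_E(V)`. -/
abbrev GUE (H : V →ₛₗ[(ρ : E →+* E)] V →ₗ[E] E) (R : Type u) [CommRing R] [Algebra F R] :
    Subgroup (GLp F R V) :=
  GU (actE (E := E)) (hermF H) R

/-- The `R`-points of `GSU_E(V)`. -/
abbrev GSUE (H : V →ₛₗ[(ρ : E →+* E)] V →ₗ[E] E) (R : Type u) [CommRing R] [Algebra F R] :
    Subgroup (GLp F R V) :=
  GSU (hermF H) R

/-- The `R`-points of `G(U_E(V₁) × U_E(V₂))`, as a subgroup of `GU_E(V₁ ⊕ V₂)`. -/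
abbrev GUE₂ (H : V →ₛₗ[(ρ : E →+* E)] V →ₗ[E] E) (V₁ V₂ : Submodule E V)
    (R : Type u) [CommRing R] [Algebra F R] : Subgroup (GLp F R V) :=
  GUE H R ⊓ (stab (V₁.restrictScalars F) R ⊓ stab (V₂.restrictScalars F) R)

/-- `V♯`, the image of `V₁ ⊗ V₂` in `⋀² V`. -/
def sharp (V₁ V₂ : Submodule E V) : Submodule E (⋀[E]^2 V) :=
  Submodule.span E {z | ∃ x ∈ V₁, ∃ y ∈ V₂, z = exteriorPower.ιMulti E 2 ![x, y]}

/-- `V₀♯`, the sum of the images of `⋀² V₁` and `⋀² V₂` in `⋀² V`. -/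
def sharp₀ (V₁ V₂ : Submodule E V) : Submodule E (⋀[E]^2 V) :=
  LinearMap.range (exteriorPower.map 2 V₁.subtype) ⊔
    LinearMap.range (exteriorPower.map 2 V₂.subtype)

/-- The `R`-points of `GU_B(⋀² V)`. -/
abbrev GUB (H : V →ₛₗ[(ρ : E →+* E)] V →ₗ[E] E) (d : (⋀[E]^4 V) ≃ₗ[E] E)
    (hψ : Function.Bijective (psi d)) (i : E) (J : F) (R : Type u) [CommRing R] [Algebra F R] :
    Subgroup (GLp F R (⋀[E]^2 V)) :=
  GU (bAct H d hψ J) (bForm H d hψ i J) R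

/-- The `R`-points of `GU_B(⋀² V)⁰`. -/
abbrev GUB0 (H : V →ₛₗ[(ρ : E →+* E)] V →ₗ[E] E) (d : (⋀[E]^4 V) ≃ₗ[E] E)
    (hψ : Function.Bijective (psi d)) (i : E) (J : F) (R : Type u) [CommRing R] [Algebra F R] :
    Subgroup (GLp F R (⋀[E]^2 V)) :=
  idComp (GUB H d hψ i J) R

/-- The `R`-points of `G(U_B(V♯) × U_B(V₀♯))`, as a subgroup of `GU_B(⋀² V)`. -/
abbrev GUB₂ (H : V →ₛₗ[(ρ : E →+* E)] V →ₗ[E] E) (d : (⋀[E]^4 V) ≃ₗ[E] E)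
    (hψ : Function.Bijective (psi d)) (i : E) (J : F) (V₁ V₂ : Submodule E V)
    (R : Type u) [CommRing R] [Algebra F R] : Subgroup (GLp F R (⋀[E]^2 V)) :=
  GUB H d hψ i J R ⊓
    (stab ((sharp V₁ V₂).restrictScalars F) R ⊓ stab ((sharp₀ V₁ V₂).restrictScalars F) R)

/-- The `R`-points of `G(U_B(V♯) × U_B(V₀♯))⁰`. -/
abbrev GUB₂0 (H : V →ₛₗ[(ρ : E →+* E)] V →ₗ[E] E) (d : (⋀[E]^4 V) ≃ₗ[E] E)
    (hψ : Function.Bijective (psi d)) (i : E) (J : F) (V₁ V₂ : Submodule E V)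
    (R : Type u) [CommRing R] [Algebra F R] : Subgroup (GLp F R (⋀[E]^2 V)) :=
  idComp (GUB₂ H d hψ i J V₁ V₂) R

theorem GUB₂0_le (H : V →ₛₗ[(ρ : E →+* E)] V →ₗ[E] E) (d : (⋀[E]^4 V) ≃ₗ[E] E)
    (hψ : Function.Bijective (psi d)) (i : E) (J : F) (V₁ V₂ : Submodule E V)
    (R : Type u) [CommRing R] [Algebra F R] :
    GUB₂0 H d hψ i J V₁ V₂ R ≤ GUB0 H d hψ i J R :=
  idComp_mono (fun _ _ _ => inf_le_left) R

/-- `GU_E(V)(R) / (R ⊗ E)ˣ`: the `R`-points of `PGU_E(V)`, for local `R`. -/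
abbrev PGUE (H : V →ₛₗ[(ρ : E →+* E)] V →ₗ[E] E) (R : Type u) [CommRing R] [Algebra F R] :
    Type (max u w) :=
  GUE H R ⧸ (scalars E V R).subgroupOf (GUE H R)

/-- `GU_B(⋀² V)⁰(R) / Rˣ`: the `R`-points of `PGU_B(⋀² V)⁰`, for local `R`. -/
abbrev PGUB0 (H : V →ₛₗ[(ρ : E →+* E)] V →ₗ[E] E) (d : (⋀[E]^4 V) ≃ₗ[E] E)
    (hψ : Function.Bijective (psi d)) (i : E) (J : F) (R : Type u) [CommRing R] [Algebra F R] :=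
  GUB0 H d hψ i J R ⧸ (homotheties (⋀[E]^2 V) R).subgroupOf (GUB0 H d hψ i J R)

/-- `G(U_E(V₁) × U_E(V₂))(R) / (R ⊗ E)ˣ`. -/
abbrev PGUE₂ (H : V →ₛₗ[(ρ : E →+* E)] V →ₗ[E] E) (V₁ V₂ : Submodule E V)
    (R : Type u) [CommRing R] [Algebra F R] : Type (max u w) :=
  GUE₂ H V₁ V₂ R ⧸ (scalars E V R).subgroupOf (GUE₂ H V₁ V₂ R)

/-- `G(U_B(V♯) × U_B(V₀♯))⁰(R) / Rˣ`. -/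
abbrev PGUB₂0 (H : V →ₛₗ[(ρ : E →+* E)] V →ₗ[E] E) (d : (⋀[E]^4 V) ≃ₗ[E] E)
    (hψ : Function.Bijective (psi d)) (i : E) (J : F) (V₁ V₂ : Submodule E V)
    (R : Type u) [CommRing R] [Algebra F R] :=
  GUB₂0 H d hψ i J V₁ V₂ R ⧸
    (homotheties (⋀[E]^2 V) R).subgroupOf (GUB₂0 H d hψ i J V₁ V₂ R)

end Main

end

end ExcIso

open ExcIso

/-! After the choice of an orthogonal basis of `V`, everything becomes a statement about matrices
over `A = R ⊗ E`. In the induced basis of `⋀² V` the wedge product is, up to a unit, the split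
symmetric form with Gram matrix `G = wedgeGram`, and `L` is conjugation of coordinates followed by
`δ G ⋀²D`, where `D` is the diagonal Gram matrix of the hermitian form. One identity does most of
the work: `(⋀²M)ᵀ G ⋀²M = det M • G` (`compound_gram`). For `M = D` it gives `L² = J`. Since `ψ (L
x) y = (x, y)`, the `B`-valued form has coordinates `𝐢 (x, y)` and `-𝐢 ψ(x, y)`, so a `B`-similitude
is the same as a similitude of `ψ` that commutes with `L`. If `M` is a unitary similitude of factor
`ν`, the identity shows that `c ⋀²M` commutes with `L` exactly when `c det M = ν² σ(c)`. Over a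
local ring such a `c` exists by Hilbert 90, because `det M / ν²` has norm one.

The substantial direction is surjectivity, that is, the coincidence `A₃ = D₃`: a similitude `X` of
`G` of factor `μ` with `det X = μ³` is a unit multiple of some `⋀²M`
(`IsProperSim.isScaledCompound`). The proof is Gaussian elimination by compound matrices. The ring
`A` is only semilocal, so pivots are made invertible by the Chinese remainder theorem; unipotent
compounds clear the columns, isotropy of the columns supplying exactly the relations needed; a
diagonal matrix remains. If moreover `X` commutes with `L`, then `⋀²(D⁻¹ M* D M)` is scalar, which
forces `D⁻¹ M* D M` to be scalar, so that `M` is a unitary similitude.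

The identity component is bounded from both sides. Always `det X = ±μ³`, and the sign is locally
constant, so it is `+` on the identity component; for the decomposed group the analogous invariant
is whether `X` is diagonal or antidiagonal on `⟨e₀ ∧ e₁, e₂ ∧ e₃⟩`. Conversely, over an
algebraically closed field every `c ⋀²M` is joined to `1` by a rational curve of Cayley type inside
the group (`IsUnitarySim.exists_curve`). A geometric point over the residue field transfers the sign
condition to a local ring.

Finally, the relation "`h = β ⋀²g` for an admissible `β`" (`IsLift`) is a multiplicative
correspondence between the two similitude groups under which scalars match homotheties. It therefore
induces the isomorphisms of quotients, and their naturality and restriction are properties of the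
relation itself. When `det g = ν²` one may take `β = 1`; over an algebraically closed field the
factor `c` has a square root, which is absorbed into `M`, whence the surjectivity of the isogeny. -/

namespace ExcIso

/-! ### The second compound of a `4 × 4` matrix -/

section Compound

open Matrix

variable {A : Type*} [CommRing A]

/-- The smaller index of a pair of indices `k < l` in `Fin 4`, the pairs being ordered
lexicographically. -/
def pairFst : Fin 6 → Fin 4 := ![0, 0, 0, 1, 1, 2]

/-- The larger index of a pair of indices `k < l` in `Fin 4`. -/
def pairSnd : Fin 6 → Fin 4 := ![1, 2, 3, 2, 3, 3]

/-- The Plücker coordinates of `x ∧ y`. -/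
def plucker (x y : Fin 4 → A) : Fin 6 → A := fun I =>
  x (pairFst I) * y (pairSnd I) - x (pairSnd I) * y (pairFst I)

/-- The matrix of `⋀² M`. -/
def compound (M : Matrix (Fin 4) (Fin 4) A) : Matrix (Fin 6) (Fin 6) A := fun I J =>
  M (pairFst I) (pairFst J) * M (pairSnd I) (pairSnd J) -
    M (pairFst I) (pairSnd J) * M (pairSnd I) (pairFst J)

/-- The Gram matrix of the wedge product on `⋀²`. -/
def wedgeGram (A : Type*) [CommRing A] : Matrix (Fin 6) (Fin 6) A :=
  !![0, 0, 0, 0, 0, 1;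
     0, 0, 0, 0, -1, 0;
     0, 0, 0, 1, 0, 0;
     0, 0, 1, 0, 0, 0;
     0, -1, 0, 0, 0, 0;
     1, 0, 0, 0, 0, 0]

theorem compound_mulVec_plucker (M : Matrix (Fin 4) (Fin 4) A) (x y : Fin 4 → A) :
    compound M *ᵥ plucker x y = plucker (M *ᵥ x) (M *ᵥ y) := by
  ext I
  simp only [mulVec, dotProduct, plucker, compound, Fin.sum_univ_succ, Fin.sum_univ_zero]
  -- The identity holds for an arbitrary pair of rows, so only the column indices need to be
  -- expanded.
  generalize pairFst I = k
  generalize pairSnd I = l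
  simp [pairFst, pairSnd]
  ring

/-- Cauchy–Binet: the columns of `compound N` are the Plücker vectors of pairs of columns of `N`, to
which `compound_mulVec_plucker` applies. -/
theorem compound_mul (M N : Matrix (Fin 4) (Fin 4) A) :
    compound (M * N) = compound M * compound N := by
  ext I J
  have h := congrFun (compound_mulVec_plucker M (N.col (pairFst J)) (N.col (pairSnd J))) I
  have h1 : plucker (N.col (pairFst J)) (N.col (pairSnd J)) = (compound N).col J := by
    ext K
    simp only [plucker, compound, Matrix.col_apply]
    ring
  rw [h1] at h
  rw [Matrix.mul_apply_eq_vecMul, ← Matrix.mul_apply_eq_vecMul]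
  change _ = (compound M *ᵥ (compound N).col J) I
  rw [h]
  simp only [compound, plucker, Matrix.mul_apply, mulVec, dotProduct, Matrix.col_apply]
  ring

theorem compound_transpose (M : Matrix (Fin 4) (Fin 4) A) : compound Mᵀ = (compound M)ᵀ := by
  ext I J
  simp only [compound, transpose_apply]
  ring

theorem compound_map {B : Type*} [CommRing B] (f : A →+* B) (M : Matrix (Fin 4) (Fin 4) A) :
    compound (M.map f) = (compound M).map f := by
  ext I J
  simp [compound]

theorem compound_smul (c : A) (M : Matrix (Fin 4) (Fin 4) A) :
    compound (c • M) = c ^ 2 • compound M := by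
  ext I J
  simp only [compound, Matrix.smul_apply, smul_eq_mul]
  ring

theorem compound_diagonal (t : Fin 4 → A) :
    compound (diagonal t) = diagonal fun I => t (pairFst I) * t (pairSnd I) := by
  ext I J
  fin_cases I <;> fin_cases J <;> simp [compound, pairFst, pairSnd]

theorem compound_one : compound (1 : Matrix (Fin 4) (Fin 4) A) = 1 := by
  rw [← diagonal_one, compound_diagonal]
  simp

theorem wedgeGram_mul_self : wedgeGram A * wedgeGram A = 1 := by
  ext I J
  fin_cases I <;> fin_cases J <;>
    simp [wedgeGram, Matrix.mul_apply, Fin.sum_univ_succ]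

theorem wedgeGram_transpose : (wedgeGram A)ᵀ = wedgeGram A := by
  ext I J
  fin_cases I <;> fin_cases J <;> simp [wedgeGram]

theorem wedgeGram_map {B : Type*} [CommRing B] (f : A →+* B) :
    (wedgeGram A).map f = wedgeGram B := by
  ext I J
  fin_cases I <;> fin_cases J <;> simp [wedgeGram]

theorem det_fin_four (M : Matrix (Fin 4) (Fin 4) A) : det M =
    M 0 0 * (M 1 1 * (M 2 2 * M 3 3 - M 2 3 * M 3 2) - M 1 2 * (M 2 1 * M 3 3 - M 2 3 * M 3 1) +
      M 1 3 * (M 2 1 * M 3 2 - M 2 2 * M 3 1)) -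
    M 0 1 * (M 1 0 * (M 2 2 * M 3 3 - M 2 3 * M 3 2) - M 1 2 * (M 2 0 * M 3 3 - M 2 3 * M 3 0) +
      M 1 3 * (M 2 0 * M 3 2 - M 2 2 * M 3 0)) +
    M 0 2 * (M 1 0 * (M 2 1 * M 3 3 - M 2 3 * M 3 1) - M 1 1 * (M 2 0 * M 3 3 - M 2 3 * M 3 0) +
      M 1 3 * (M 2 0 * M 3 1 - M 2 1 * M 3 0)) -
    M 0 3 * (M 1 0 * (M 2 1 * M 3 2 - M 2 2 * M 3 1) - M 1 1 * (M 2 0 * M 3 2 - M 2 2 * M 3 0) +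
      M 1 2 * (M 2 0 * M 3 1 - M 2 1 * M 3 0)) := by
  rw [det_succ_row_zero]
  simp [Fin.sum_univ_succ, det_fin_three, Fin.succAbove, submatrix_apply]
  ring

theorem dotProduct_wedgeGram (u v : Fin 6 → A) : u ⬝ᵥ wedgeGram A *ᵥ v =
    u 0 * v 5 - u 1 * v 4 + u 2 * v 3 + u 3 * v 2 - u 4 * v 1 + u 5 * v 0 := by
  simp [wedgeGram, dotProduct, mulVec, Fin.sum_univ_succ]
  ring

/-- This is the Laplace expansion of a `4 × 4` determinant along its first two rows; it identifies
`wedgeGram` with the wedge product. -/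
theorem wedgeGram_plucker (x y z t : Fin 4 → A) :
    plucker x y ⬝ᵥ wedgeGram A *ᵥ plucker z t = det (of ![x, y, z, t]) := by
  rw [det_fin_four, dotProduct_wedgeGram]
  simp [plucker, pairFst, pairSnd]
  ring

/-- Each entry on the left is the determinant of four columns of `M`. It vanishes when a column is
repeated and is `± det M` for complementary pairs. -/
theorem compound_gram (M : Matrix (Fin 4) (Fin 4) A) :
    (compound M)ᵀ * wedgeGram A * compound M = det M • wedgeGram A := by
  have key : ∀ I J, ((compound M)ᵀ * wedgeGram A * compound M) I J =
      det (of ![M.col (pairFst I), M.col (pairSnd I), M.col (pairFst J), M.col (pairSnd J)]) := by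
    intro I J
    rw [← wedgeGram_plucker]
    have h1 : ∀ J, plucker (M.col (pairFst J)) (M.col (pairSnd J)) = (compound M).col J := by
      intro J
      ext K
      simp only [plucker, compound, Matrix.col_apply]
      ring
    rw [h1, h1, Matrix.mul_assoc]
    rfl
  ext I J
  rw [key, det_fin_four, Matrix.smul_apply, det_fin_four M]
  fin_cases I <;> fin_cases J <;> simp [wedgeGram, pairFst, pairSnd] <;> ring

end Compound

/-! ### Proper similitudes of the wedge product: determinants, units and diagonal matrices -/

section Classification

open Matrix

variable {A : Type*} [CommRing A]

theorem isUnit_det_wedgeGram : IsUnit (det (wedgeGram A)) :=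
  IsUnit.of_mul_eq_one _ (by rw [← det_mul, wedgeGram_mul_self, det_one])

/-- Only `det X = ± μ³` can be expected over a domain; the sign separates proper from improper
similitudes. -/
theorem det_sq_of_gram {X : Matrix (Fin 6) (Fin 6) A} {μ : A}
    (hX : Xᵀ * wedgeGram A * X = μ • wedgeGram A) : det X ^ 2 = μ ^ 6 := by
  have h := congrArg det hX
  rw [det_mul, det_mul, det_transpose, det_smul, Fintype.card_fin] at h
  refine isUnit_det_wedgeGram.mul_right_cancel ?_
  rw [← h]
  ring

/-- For the generic matrix over `ℤ` both sides have the same square in a domain, hence agree up to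
sign. Specialization to the identity matrix excludes the minus sign, and the general case follows by
specialization. -/
theorem det_compound (M : Matrix (Fin 4) (Fin 4) A) : det (compound M) = det M ^ 3 := by
  have key : det (compound (mvPolynomialX (Fin 4) (Fin 4) ℤ)) =
      det (mvPolynomialX (Fin 4) (Fin 4) ℤ) ^ 3 := by
    have h1 := det_sq_of_gram (compound_gram (mvPolynomialX (Fin 4) (Fin 4) ℤ))
    have h2 : (det (compound (mvPolynomialX (Fin 4) (Fin 4) ℤ)) -
        det (mvPolynomialX (Fin 4) (Fin 4) ℤ) ^ 3) *
        (det (compound (mvPolynomialX (Fin 4) (Fin 4) ℤ)) +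
        det (mvPolynomialX (Fin 4) (Fin 4) ℤ) ^ 3) = 0 := by
      linear_combination h1
    refine sub_eq_zero.mp ((mul_eq_zero.mp h2).resolve_right fun h3 => ?_)
    have h4 := congrArg (MvPolynomial.eval fun p : Fin 4 × Fin 4 =>
      (1 : Matrix (Fin 4) (Fin 4) ℤ) p.1 p.2) h3
    have h5 := mvPolynomialX_mapMatrix_eval (1 : Matrix (Fin 4) (Fin 4) ℤ)
    rw [RingHom.mapMatrix_apply] at h5
    rw [map_add, map_pow, RingHom.map_det, RingHom.map_det, RingHom.mapMatrix_apply,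
      RingHom.mapMatrix_apply, ← compound_map, h5, compound_one] at h4
    simp at h4
  have h5 := mvPolynomialX_map_eval₂ (Int.castRingHom A) M
  have h6 := congrArg (MvPolynomial.eval₂Hom (Int.castRingHom A)
    fun p : Fin 4 × Fin 4 => M p.1 p.2) key
  rw [map_pow, RingHom.map_det, RingHom.map_det, RingHom.mapMatrix_apply,
    RingHom.mapMatrix_apply, ← compound_map] at h6
  have h7 : (mvPolynomialX (Fin 4) (Fin 4) ℤ).map (MvPolynomial.eval₂Hom (Int.castRingHom A)
    fun p : Fin 4 × Fin 4 => M p.1 p.2) = M := h5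
  rwa [h7] at h6

/-- Over a ring with finitely many maximal ideals, a function that is compatible with congruences
takes a unit as value as soon as it takes values outside of each maximal ideal. -/
theorem exists_isUnit_of_forall_maximal [Finite (MaximalSpectrum A)] {m n : Type*}
    (f : Matrix m n A → A)
    (hf : ∀ (I : Ideal A) (x y : Matrix m n A),
      x.map (Ideal.Quotient.mk I) = y.map (Ideal.Quotient.mk I) →
        Ideal.Quotient.mk I (f x) = Ideal.Quotient.mk I (f y))
    (h : ∀ I : Ideal A, I.IsMaximal → ∃ x, f x ∉ I) : ∃ x, IsUnit (f x) := by
  choose x hx using fun I : MaximalSpectrum A => h I.asIdeal I.isMaximal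
  have hcop : Pairwise fun I J : MaximalSpectrum A => IsCoprime I.asIdeal J.asIdeal :=
    fun I J hIJ => Ideal.isCoprime_iff_sup_eq.mpr
      (I.isMaximal.coprime_of_ne J.isMaximal fun h => hIJ (MaximalSpectrum.ext h))
  -- Chinese remainder theorem, entry by entry: one matrix is congruent to the chosen `x I` modulo
  -- each maximal ideal `I`.
  choose y hy using fun i j => Ideal.exists_forall_sub_mem_ideal hcop fun I => x I i j
  refine ⟨Matrix.of y, by_contra fun hu => ?_⟩
  obtain ⟨I, hI, hfI⟩ := exists_max_ideal_of_mem_nonunits hu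
  refine hx ⟨I, hI⟩ ?_
  have h1 := hf I (Matrix.of y) (x ⟨I, hI⟩) (by
    ext i j
    exact Ideal.Quotient.eq.mpr (hy i j ⟨I, hI⟩))
  rw [← Ideal.Quotient.eq_zero_iff_mem] at hfI ⊢
  rw [← h1, hfI]

/-- `X` is a unit multiple of a compound matrix. -/
def IsScaledCompound (X : Matrix (Fin 6) (Fin 6) A) : Prop :=
  ∃ (c : A) (M : Matrix (Fin 4) (Fin 4) A), IsUnit c ∧ IsUnit (det M) ∧ X = c • compound M

/-- This licenses the elimination: left multiplication by an invertible compound changes neither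
hypothesis nor goal. -/
theorem IsScaledCompound.of_compound_mul {g : Matrix (Fin 4) (Fin 4) A} (hg : IsUnit (det g))
    {X : Matrix (Fin 6) (Fin 6) A} (h : IsScaledCompound (compound g * X)) :
    IsScaledCompound X := by
  obtain ⟨c, M, hc, hM, h⟩ := h
  refine ⟨c, g⁻¹ * M, hc, ?_, ?_⟩
  · rw [det_mul]
    exact (isUnit_nonsing_inv_det g hg).mul hM
  · rw [compound_mul, ← Matrix.mul_smul, ← h, ← Matrix.mul_assoc, ← compound_mul,
      nonsing_inv_mul g hg, compound_one, Matrix.one_mul]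

/-- `X` is a proper similitude, of factor `μ`, of the wedge product on `⋀²`. -/
structure IsProperSim (X : Matrix (Fin 6) (Fin 6) A) (μ : A) : Prop where
  isUnit : IsUnit μ
  gram : Xᵀ * wedgeGram A * X = μ • wedgeGram A
  det_eq : det X = μ ^ 3

theorem IsProperSim.compound_mul {X : Matrix (Fin 6) (Fin 6) A} {μ : A} (h : IsProperSim X μ)
    {g : Matrix (Fin 4) (Fin 4) A} (hg : IsUnit (det g)) :
    IsProperSim (compound g * X) (det g * μ) where
  isUnit := hg.mul h.isUnit
  gram := by
    rw [transpose_mul, show Xᵀ * (compound g)ᵀ * wedgeGram A * (compound g * X) =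
      Xᵀ * ((compound g)ᵀ * wedgeGram A * compound g) * X by simp only [Matrix.mul_assoc],
      compound_gram, Matrix.mul_smul, Matrix.smul_mul, h.gram, smul_smul]
  det_eq := by
    rw [det_mul, h.det_eq, det_compound]
    ring

theorem gram_apply {X : Matrix (Fin 6) (Fin 6) A} {μ : A}
    (h : Xᵀ * wedgeGram A * X = μ • wedgeGram A) (I J : Fin 6) :
    X 0 I * X 5 J - X 1 I * X 4 J + X 2 I * X 3 J + X 3 I * X 2 J - X 4 I * X 1 J +
      X 5 I * X 0 J = μ * wedgeGram A I J := by
  have h1 := congrFun (congrFun h I) J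
  rw [Matrix.smul_apply, smul_eq_mul, Matrix.mul_assoc] at h1
  rw [← h1]
  exact (dotProduct_wedgeGram (fun K => X K I) fun K => X K J).symm

/-- The diagonal entries of the Gram relation are twice these expressions, and `2` is invertible. -/
theorem gram_isotropic {X : Matrix (Fin 6) (Fin 6) A} {μ : A}
    (h : Xᵀ * wedgeGram A * X = μ • wedgeGram A) (h2 : IsUnit (2 : A)) (I : Fin 6) :
    X 0 I * X 5 I - X 1 I * X 4 I + X 2 I * X 3 I = 0 := by
  have h1 := gram_apply h I I
  have h3 : wedgeGram A I I = 0 := by fin_cases I <;> simp [wedgeGram]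
  refine h2.mul_left_cancel ?_
  rw [h3] at h1
  linear_combination h1

/-- The torus of `GL₄` together with homotheties fills the diagonal similitudes: of the six entries
`t₀, t₁, t₂, μ` are free, and they determine a diagonal `M` normalized by first entry `1` and a
scalar `c`. -/
theorem isScaledCompound_diagonal {t : Fin 6 → A} {μ : A} (hμ : IsUnit μ) (h0 : t 0 * t 5 = μ)
    (h1 : t 1 * t 4 = μ) (h2 : t 2 * t 3 = μ) : IsScaledCompound (diagonal t) := by
  obtain ⟨t0, e0⟩ := isUnit_of_mul_isUnit_left (h0 ▸ hμ : IsUnit (t 0 * t 5))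
  obtain ⟨t1, e1⟩ := isUnit_of_mul_isUnit_left (h1 ▸ hμ : IsUnit (t 1 * t 4))
  obtain ⟨t2, e2⟩ := isUnit_of_mul_isUnit_left (h2 ▸ hμ : IsUnit (t 2 * t 3))
  obtain ⟨m, rfl⟩ := hμ
  have f5 : t 5 = ((t0⁻¹ * m : Aˣ) : A) := by
    rw [Units.val_mul, ← h0, ← e0, Units.inv_mul_cancel_left]
  have f4 : t 4 = ((t1⁻¹ * m : Aˣ) : A) := by
    rw [Units.val_mul, ← h1, ← e1, Units.inv_mul_cancel_left]
  have f3 : t 3 = ((t2⁻¹ * m : Aˣ) : A) := by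
    rw [Units.val_mul, ← h2, ← e2, Units.inv_mul_cancel_left]
  -- With `s₀ = 1`, the entries at `0, 1, 2` force `sₖ = c⁻¹ tₖ₋₁`. The entry at `3` then reads `c⁻¹
  -- t₀ t₁ = t₃`, which determines `c`; those at `4` and `5` follow from the relations with `μ`.
  let c : Aˣ := t0 * t1 * (t2⁻¹ * m)⁻¹
  let s : Fin 4 → Aˣ := ![1, c⁻¹ * t0, c⁻¹ * t1, c⁻¹ * t2]
  refine ⟨c, diagonal fun k => (s k : A), c.isUnit, ?_, ?_⟩
  · rw [det_diagonal]
    exact ⟨∏ k, s k, by simp⟩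
  · rw [compound_diagonal, ← diagonal_smul]
    congr 1
    funext I
    have key : ∀ u : Aˣ, t I = (u : A) → u = c * (s (pairFst I) * s (pairSnd I)) →
        t I = ((c : A) • fun I => (s (pairFst I) : A) * s (pairSnd I)) I := by
      rintro u h rfl
      simp only [h, Units.val_mul, Pi.smul_apply, smul_eq_mul]
    fin_cases I
    · exact key t0 e0.symm (by simp [s, pairFst, pairSnd])
    · exact key t1 e1.symm (by simp [s, pairFst, pairSnd])
    · exact key t2 e2.symm (by simp [s, pairFst, pairSnd])
    -- Written additively, the identity between units is linear and falls to `abel`.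
    · refine key _ f3 (Additive.ofMul.injective ?_)
      simp [s, c, pairFst, pairSnd]
      abel
    · refine key _ f4 (Additive.ofMul.injective ?_)
      simp [s, c, pairFst, pairSnd]
      abel
    · refine key _ f5 (Additive.ofMul.injective ?_)
      simp [s, c, pairFst, pairSnd]
      abel

end Classification

/-! ### Elimination of columns by compound matrices -/

section ClassificationSteps

open Matrix

variable {A : Type*} [CommRing A]

/-- The columns of `X` with indices in `s` are multiples of the basis vectors. -/
def DiagOn (X : Matrix (Fin 6) (Fin 6) A) (s : List (Fin 6)) : Prop :=
  ∀ J ∈ s, ∀ I, I ≠ J → X I J = 0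

theorem DiagOn.compound_mul {X : Matrix (Fin 6) (Fin 6) A} {s : List (Fin 6)} (h : DiagOn X s)
    {g : Matrix (Fin 4) (Fin 4) A} (hg : DiagOn (compound g) s) : DiagOn (compound g * X) s := by
  intro J hJ I hI
  rw [Matrix.mul_apply]
  refine Finset.sum_eq_zero fun K _ => ?_
  by_cases hK : K = J
  · rw [hK, hg J hJ I hI, zero_mul]
  · rw [h J hJ K hK, mul_zero]

/-- Orthogonality to the four cleared columns leaves a `2 × 2` block on the hyperbolic plane with
indices `2, 3`, whose columns are isotropic. Here the sign of the determinant is decisive: it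
excludes the antidiagonal block. -/
theorem isScaledCompound_of_diagOn₄ {X : Matrix (Fin 6) (Fin 6) A} {μ : A} (h2 : IsUnit (2 : A))
    (h : IsProperSim X μ) (hX : DiagOn X [0, 5, 1, 4]) : IsScaledCompound X := by
  have hμ := h.isUnit
  have g := gram_apply h.gram
  have z : ∀ I J : Fin 6, J ∈ [0, 5, 1, 4] → I ≠ J → X I J = 0 := fun I J hJ hI => hX J hJ I hI
  have e05 : X 0 0 * X 5 5 = μ := by
    have := g 0 5
    simp [z, wedgeGram] at this
    exact this
  have e14 : X 1 1 * X 4 4 = μ := by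
    have := g 1 4
    simp [z, wedgeGram] at this
    exact this
  have u0 : IsUnit (X 0 0) := isUnit_of_mul_isUnit_left (e05 ▸ hμ)
  have u5 : IsUnit (X 5 5) := isUnit_of_mul_isUnit_right (e05 ▸ hμ)
  have u1 : IsUnit (X 1 1) := isUnit_of_mul_isUnit_left (e14 ▸ hμ)
  have u4 : IsUnit (X 4 4) := isUnit_of_mul_isUnit_right (e14 ▸ hμ)
  have w : ∀ J : Fin 6, J = 2 ∨ J = 3 → X 0 J = 0 ∧ X 5 J = 0 ∧ X 1 J = 0 ∧ X 4 J = 0 := by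
    intro J hJ
    have g0 := g 0 J
    have g5 := g 5 J
    have g1 := g 1 J
    have g4 := g 4 J
    rcases hJ with rfl | rfl <;> simp [z, wedgeGram, u0.mul_right_eq_zero,
      u5.mul_right_eq_zero, u1.mul_right_eq_zero, u4.mul_right_eq_zero] at g0 g1 g4 g5 <;>
      exact ⟨g5, g0, g4, g1⟩
  obtain ⟨w02, w52, w12, w42⟩ := w 2 (Or.inl rfl)
  obtain ⟨w03, w53, w13, w43⟩ := w 3 (Or.inr rfl)
  have e23 : X 2 2 * X 3 3 + X 3 2 * X 2 3 = μ := by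
    have := g 2 3
    simp [w02, w12, w42, w52, w03, w13, w43, w53, wedgeGram] at this
    exact this
  have e22 : X 2 2 * X 3 2 = 0 := by
    have := gram_isotropic h.gram h2 2
    simpa [w02, w12, w42, w52] using this
  have e33 : X 2 3 * X 3 3 = 0 := by
    have := gram_isotropic h.gram h2 3
    simpa [w03, w13, w43, w53] using this
  have hdet : X 0 0 * X 5 5 * (X 1 1 * X 4 4) * (X 2 2 * X 3 3 - X 2 3 * X 3 2) = μ ^ 3 := by
    rw [← h.det_eq]
    rw [det_succ_row_zero]
    simp [Fin.sum_univ_succ, w02, w03, z]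
    rw [det_succ_row_zero]
    simp [Fin.sum_univ_succ, z, w12, w13]
    rw [det_succ_column _ 3]
    simp [Fin.sum_univ_succ, z]
    rw [det_fin_three]
    simp [Fin.succAbove, z, w42, w43]
    ring
  have e23' : X 2 2 * X 3 3 - X 2 3 * X 3 2 = μ := by
    rw [e05, e14] at hdet
    refine (hμ.mul hμ).mul_left_cancel ?_
    rw [hdet]
    ring
  -- The Gram relation gives the permanent of the block and the determinant condition its
  -- determinant; both equal `μ`, and their difference is twice this product.
  have e0 : X 2 3 * X 3 2 = 0 := by
    refine h2.mul_left_cancel ?_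
    linear_combination e23 - e23'
  have e1 : X 2 2 * X 3 3 = μ := by rw [← e23', e0, sub_zero]
  have u2 : IsUnit (X 2 2) := isUnit_of_mul_isUnit_left (e1 ▸ hμ)
  have u3 : IsUnit (X 3 3) := isUnit_of_mul_isUnit_right (e1 ▸ hμ)
  have w32 : X 3 2 = 0 := u2.mul_right_eq_zero.mp e22
  have w23 : X 2 3 = 0 := u3.mul_left_eq_zero.mp e33
  have hd : X = diagonal fun I => X I I := by
    ext I J
    by_cases hIJ : I = J
    · rw [hIJ, diagonal_apply_eq]
    · rw [diagonal_apply_ne _ hIJ]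
      fin_cases J
      · exact z _ _ (by simp) hIJ
      · exact z _ _ (by simp) hIJ
      · fin_cases I <;> first | assumption | exact absurd rfl hIJ
      · fin_cases I <;> first | assumption | exact absurd rfl hIJ
      · exact z _ _ (by simp) hIJ
      · exact z _ _ (by simp) hIJ
  rw [hd]
  exact isScaledCompound_diagonal hμ e05 e14 e1

/-- Column `4` is orthogonal to columns `0` and `5`, so its entries there vanish; isotropy expresses
its entry at `1` through those at `2` and `3`. The two parameters `s, t` of a unipotent `G`
therefore suffice to clear it. The pivot at `4` is a unit because its product with the one at `1` is
`μ`. -/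
theorem isScaledCompound_of_diagOn₃ {X : Matrix (Fin 6) (Fin 6) A} {μ : A} (h2 : IsUnit (2 : A))
    (h : IsProperSim X μ) (hX : DiagOn X [0, 5, 1]) : IsScaledCompound X := by
  have hμ := h.isUnit
  have g := gram_apply h.gram
  have z : ∀ I J : Fin 6, J ∈ [0, 5, 1] → I ≠ J → X I J = 0 := fun I J hJ hI => hX J hJ I hI
  have e05 : X 0 0 * X 5 5 = μ := by
    have := g 0 5
    simp [z, wedgeGram] at this
    exact this
  have e14 : X 1 1 * X 4 4 = μ := by
    have := g 1 4
    simp [z, wedgeGram] at this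
    exact this
  have u0 : IsUnit (X 0 0) := isUnit_of_mul_isUnit_left (e05 ▸ hμ)
  have u5 : IsUnit (X 5 5) := isUnit_of_mul_isUnit_right (e05 ▸ hμ)
  have u4 : IsUnit (X 4 4) := isUnit_of_mul_isUnit_right (e14 ▸ hμ)
  have w54 : X 5 4 = 0 := by
    have := g 0 4
    simpa [z, wedgeGram, u0.mul_right_eq_zero] using this
  have w04 : X 0 4 = 0 := by
    have := g 5 4
    simpa [z, wedgeGram, u5.mul_right_eq_zero] using this
  have iso : - (X 1 4 * X 4 4) + X 2 4 * X 3 4 = 0 := by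
    have := gram_isotropic h.gram h2 4
    simpa [w54, w04] using this
  obtain ⟨y, hy⟩ := u4
  let s : A := X 2 4 * (y⁻¹ : Aˣ)
  let t : A := X 3 4 * (y⁻¹ : Aˣ)
  have hs : s * X 4 4 = X 2 4 := by rw [← hy, Units.inv_mul_cancel_right]
  have ht : t * X 4 4 = X 3 4 := by rw [← hy, Units.inv_mul_cancel_right]
  have hst : s * t * X 4 4 = X 1 4 := by
    refine y.isUnit.mul_left_cancel ?_
    rw [hy]
    linear_combination iso + t * X 4 4 * hs + X 2 4 * ht
  let G : Matrix (Fin 4) (Fin 4) A := !![1, -s, 0, 0; 0, 1, 0, 0; 0, 0, 1, -t; 0, 0, 0, 1]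
  have hG : det G = 1 := by
    rw [det_fin_four]
    simp [G]
  refine IsScaledCompound.of_compound_mul (g := G) (by rw [hG]; exact isUnit_one) ?_
  refine isScaledCompound_of_diagOn₄ h2 (h.compound_mul (g := G) (by rw [hG]; exact isUnit_one)) ?_
  have h3 : DiagOn (compound G * X) [0, 5, 1] := hX.compound_mul (by
    intro J hJ I hI
    simp at hJ
    rcases hJ with rfl | rfl | rfl <;> fin_cases I <;>
      first | exact absurd rfl hI | simp [compound, G, pairFst, pairSnd])
  intro J hJ I hI
  by_cases hJ4 : J = 4
  · subst hJ4
    fin_cases I <;>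
    first
    | exact absurd rfl hI
    | (simp [Matrix.mul_apply, Fin.sum_univ_succ, compound, G, pairFst, pairSnd, w54, w04]
       try first
         | linear_combination - hst + t * hs + s * ht
         | linear_combination - hs
         | linear_combination - ht)
  · refine h3 J ?_ I hI
    simp at hJ ⊢
    tauto

/-- The same argument for column `1`, with the opposite unipotent matrices; here invertibility of
the pivot must be assumed. -/
theorem isScaledCompound_of_diagOn₂_pivot {X : Matrix (Fin 6) (Fin 6) A} {μ : A}
    (h2 : IsUnit (2 : A)) (h : IsProperSim X μ) (hX : DiagOn X [0, 5]) (u1 : IsUnit (X 1 1)) :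
    IsScaledCompound X := by
  have hμ := h.isUnit
  have g := gram_apply h.gram
  have z : ∀ I J : Fin 6, J ∈ [0, 5] → I ≠ J → X I J = 0 := fun I J hJ hI => hX J hJ I hI
  have e05 : X 0 0 * X 5 5 = μ := by
    have := g 0 5
    simp [z, wedgeGram] at this
    exact this
  have u0 : IsUnit (X 0 0) := isUnit_of_mul_isUnit_left (e05 ▸ hμ)
  have u5 : IsUnit (X 5 5) := isUnit_of_mul_isUnit_right (e05 ▸ hμ)
  have w51 : X 5 1 = 0 := by
    have := g 0 1
    simpa [z, wedgeGram, u0.mul_right_eq_zero] using this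
  have w01 : X 0 1 = 0 := by
    have := g 5 1
    simpa [z, wedgeGram, u5.mul_right_eq_zero] using this
  have iso : - (X 1 1 * X 4 1) + X 2 1 * X 3 1 = 0 := by
    have := gram_isotropic h.gram h2 1
    simpa [w51, w01] using this
  obtain ⟨y, hy⟩ := u1
  let s : A := X 3 1 * (y⁻¹ : Aˣ)
  let t : A := X 2 1 * (y⁻¹ : Aˣ)
  have hs : s * X 1 1 = X 3 1 := by rw [← hy, Units.inv_mul_cancel_right]
  have ht : t * X 1 1 = X 2 1 := by rw [← hy, Units.inv_mul_cancel_right]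
  have hst : s * t * X 1 1 = X 4 1 := by
    refine y.isUnit.mul_left_cancel ?_
    rw [hy]
    linear_combination iso + t * X 1 1 * hs + X 3 1 * ht
  let G : Matrix (Fin 4) (Fin 4) A := !![1, 0, 0, 0; -s, 1, 0, 0; 0, 0, 1, 0; 0, 0, -t, 1]
  have hG : det G = 1 := by
    rw [det_fin_four]
    simp [G]
  refine IsScaledCompound.of_compound_mul (g := G) (by rw [hG]; exact isUnit_one) ?_
  refine isScaledCompound_of_diagOn₃ h2 (h.compound_mul (g := G) (by rw [hG]; exact isUnit_one)) ?_
  have h3 : DiagOn (compound G * X) [0, 5] := hX.compound_mul (by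
    intro J hJ I hI
    simp at hJ
    rcases hJ with rfl | rfl <;> fin_cases I <;>
      first | exact absurd rfl hI | simp [compound, G, pairFst, pairSnd])
  intro J hJ I hI
  by_cases hJ4 : J = 1
  · subst hJ4
    fin_cases I <;>
    first
    | exact absurd rfl hI
    | (simp [Matrix.mul_apply, Fin.sum_univ_succ, compound, G, pairFst, pairSnd, w51, w01]
       try first
         | linear_combination - hst + t * hs + s * ht
         | linear_combination - hs
         | linear_combination - ht)
  · refine h3 J ?_ I hI
    simp at hJ ⊢
    tauto

/-- A block diagonal matrix, given by a `2 × 4` matrix. -/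
def blockMat (p : Matrix (Fin 2) (Fin 4) A) : Matrix (Fin 4) (Fin 4) A :=
  !![p 0 0, p 0 1, 0, 0; p 1 0, p 1 1, 0, 0; 0, 0, p 0 2, p 0 3; 0, 0, p 1 2, p 1 3]

theorem blockMat_map {B : Type*} [CommRing B] (f : A →+* B) (p : Matrix (Fin 2) (Fin 4) A) :
    blockMat (p.map f) = (blockMat p).map f := by
  ext I J
  fin_cases I <;> fin_cases J <;> simp [blockMat]

/-- A column of an invertible matrix cannot vanish modulo a maximal ideal. -/
theorem exists_notMem_col {X : Matrix (Fin 6) (Fin 6) A} (hX : IsUnit (det X)) (J : Fin 6)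
    {P : Ideal A} (hP : P.IsMaximal) : ∃ I, X I J ∉ P := by
  by_contra! hc
  refine hP.ne_top ((Ideal.eq_top_iff_one P).mpr ?_)
  have h1 := congrFun (congrFun (nonsing_inv_mul X hX) J) J
  rw [one_apply_eq, Matrix.mul_apply] at h1
  rw [← h1]
  exact P.sum_mem fun K _ => P.mul_mem_left _ (hc K)

/-- Block diagonal `M` fix the lines `e₀ ∧ e₁` and `e₂ ∧ e₃`, and act on the middle four coordinates
as the tensor product of the two blocks. That is enough to bring a unit into position `(1, 1)`,
simultaneously at all maximal ideals. -/
theorem isScaledCompound_of_diagOn₂ [Finite (MaximalSpectrum A)] {X : Matrix (Fin 6) (Fin 6) A}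
    {μ : A} (h2 : IsUnit (2 : A)) (h : IsProperSim X μ) (hX : DiagOn X [0, 5]) :
    IsScaledCompound X := by
  have hμ := h.isUnit
  have g := gram_apply h.gram
  have z : ∀ I J : Fin 6, J ∈ [0, 5] → I ≠ J → X I J = 0 := fun I J hJ hI => hX J hJ I hI
  have e05 : X 0 0 * X 5 5 = μ := by
    have := g 0 5
    simp [z, wedgeGram] at this
    exact this
  have u0 : IsUnit (X 0 0) := isUnit_of_mul_isUnit_left (e05 ▸ hμ)
  have u5 : IsUnit (X 5 5) := isUnit_of_mul_isUnit_right (e05 ▸ hμ)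
  have w51 : X 5 1 = 0 := by
    have := g 0 1
    simpa [z, wedgeGram, u0.mul_right_eq_zero] using this
  have w01 : X 0 1 = 0 := by
    have := g 5 1
    simpa [z, wedgeGram, u5.mul_right_eq_zero] using this
  obtain ⟨p, hp⟩ := exists_isUnit_of_forall_maximal
    (fun p : Matrix (Fin 2) (Fin 4) A => det (blockMat p) * (compound (blockMat p) * X) 1 1)
    (by
      intro P x y hxy
      have key : ∀ x : Matrix (Fin 2) (Fin 4) A, Ideal.Quotient.mk P
          (det (blockMat x) * (compound (blockMat x) * X) 1 1) =
          det (blockMat (x.map (Ideal.Quotient.mk P))) *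
            (compound (blockMat (x.map (Ideal.Quotient.mk P))) *
              X.map (Ideal.Quotient.mk P)) 1 1 := by
        intro x
        rw [map_mul, RingHom.map_det, blockMat_map, compound_map, ← Matrix.map_mul]
        rfl
      rw [key, key, hxy])
    (by
      intro P hP
      obtain ⟨I, hI⟩ := exists_notMem_col (h.det_eq ▸ hμ.pow 3) 1 hP
      have hb : ∀ p : Matrix (Fin 2) (Fin 4) A, det (blockMat p) * (compound (blockMat p) * X) 1 1 =
          (p 0 0 * p 1 1 - p 0 1 * p 1 0) * (p 0 2 * p 1 3 - p 0 3 * p 1 2) *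
          (p 0 0 * p 0 2 * X 1 1 + p 0 0 * p 0 3 * X 2 1 + p 0 1 * p 0 2 * X 3 1 +
            p 0 1 * p 0 3 * X 4 1) := by
        intro p
        rw [det_fin_four]
        simp [Matrix.mul_apply, Fin.sum_univ_succ, compound, blockMat, pairFst, pairSnd, w01]
        ring
      fin_cases I
      · exact absurd (by simp [w01]) hI
      -- Each block is the identity or the swap; the four combinations carry the four middle
      -- coordinates to position `1`.
      · refine ⟨!![1, 0, 1, 0; 0, 1, 0, 1], ?_⟩
        rw [hb]
        simpa using hI
      · refine ⟨!![1, 0, 0, 1; 0, 1, 1, 0], ?_⟩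
        rw [hb]
        simpa using hI
      · refine ⟨!![0, 1, 1, 0; 1, 0, 0, 1], ?_⟩
        rw [hb]
        simpa using hI
      · refine ⟨!![0, 1, 0, 1; 1, 0, 1, 0], ?_⟩
        rw [hb]
        simpa using hI
      · exact absurd (by simp [w51]) hI)
  have hG : IsUnit (det (blockMat p)) := isUnit_of_mul_isUnit_left hp
  refine IsScaledCompound.of_compound_mul hG ?_
  refine isScaledCompound_of_diagOn₂_pivot h2 (h.compound_mul hG) (hX.compound_mul ?_)
    (isUnit_of_mul_isUnit_right hp)
  intro J hJ I hI
  simp at hJ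
  rcases hJ with rfl | rfl <;> fin_cases I <;>
    first | exact absurd rfl hI | simp [compound, blockMat, pairFst, pairSnd]

/-- The pivot at `5` is a unit since `X 0 0 * X 5 5 = μ`. An upper unipotent matrix with
off-diagonal block of entries `a, c, b, e` clears the middle of column `5`, and isotropy says that
its remaining entry is the determinant of that block times the pivot. -/
theorem isScaledCompound_of_diagOn₁ [Finite (MaximalSpectrum A)] {X : Matrix (Fin 6) (Fin 6) A}
    {μ : A} (h2 : IsUnit (2 : A)) (h : IsProperSim X μ) (hX : DiagOn X [0]) :
    IsScaledCompound X := by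
  have hμ := h.isUnit
  have g := gram_apply h.gram
  have z : ∀ I J : Fin 6, J ∈ [0] → I ≠ J → X I J = 0 := fun I J hJ hI => hX J hJ I hI
  have e05 : X 0 0 * X 5 5 = μ := by
    have := g 0 5
    simp [z, wedgeGram] at this
    exact this
  have u5 : IsUnit (X 5 5) := isUnit_of_mul_isUnit_right (e05 ▸ hμ)
  have iso := gram_isotropic h.gram h2 5
  obtain ⟨y, hy⟩ := u5
  let a : A := X 2 5 * (y⁻¹ : Aˣ)
  let b : A := X 4 5 * (y⁻¹ : Aˣ)
  let c : A := - X 1 5 * (y⁻¹ : Aˣ)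
  let e : A := - X 3 5 * (y⁻¹ : Aˣ)
  have ha : a * X 5 5 = X 2 5 := by rw [← hy, Units.inv_mul_cancel_right]
  have hb : b * X 5 5 = X 4 5 := by rw [← hy, Units.inv_mul_cancel_right]
  have hc : c * X 5 5 = - X 1 5 := by rw [← hy, Units.inv_mul_cancel_right]
  have he : e * X 5 5 = - X 3 5 := by rw [← hy, Units.inv_mul_cancel_right]
  have hab : (a * e - b * c) * X 5 5 = X 0 5 := by
    refine y.isUnit.mul_left_cancel ?_
    rw [hy]
    linear_combination - iso + e * X 5 5 * ha + X 2 5 * he - c * X 5 5 * hb - X 4 5 * hc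
  let G : Matrix (Fin 4) (Fin 4) A := !![1, 0, -a, -c; 0, 1, -b, -e; 0, 0, 1, 0; 0, 0, 0, 1]
  have hG : det G = 1 := by
    rw [det_fin_four]
    simp [G]
  refine IsScaledCompound.of_compound_mul (g := G) (by rw [hG]; exact isUnit_one) ?_
  refine isScaledCompound_of_diagOn₂ h2 (h.compound_mul (g := G) (by rw [hG]; exact isUnit_one)) ?_
  have h3 : DiagOn (compound G * X) [0] := hX.compound_mul (by
    intro J hJ I hI
    simp at hJ
    subst hJ
    fin_cases I <;>
      first | exact absurd rfl hI | simp [compound, G, pairFst, pairSnd])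
  intro J hJ I hI
  by_cases hJ4 : J = 5
  · subst hJ4
    fin_cases I <;>
    first
    | exact absurd rfl hI
    | (simp [Matrix.mul_apply, Fin.sum_univ_succ, compound, G, pairFst, pairSnd]
       first
         | linear_combination - hab - b * hc + a * he + e * ha - c * hb
         | linear_combination - ha
         | linear_combination - hb
         | linear_combination hc
         | linear_combination he)
  · refine h3 J ?_ I hI
    simp at hJ ⊢
    tauto

/-- The lower unipotent version of the same computation clears column `0`. -/
theorem isScaledCompound_of_pivot [Finite (MaximalSpectrum A)] {X : Matrix (Fin 6) (Fin 6) A}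
    {μ : A} (h2 : IsUnit (2 : A)) (h : IsProperSim X μ) (u0 : IsUnit (X 0 0)) :
    IsScaledCompound X := by
  have iso := gram_isotropic h.gram h2 0
  obtain ⟨y, hy⟩ := u0
  let a : A := - X 3 0 * (y⁻¹ : Aˣ)
  let b : A := X 1 0 * (y⁻¹ : Aˣ)
  let c : A := - X 4 0 * (y⁻¹ : Aˣ)
  let e : A := X 2 0 * (y⁻¹ : Aˣ)
  have ha : a * X 0 0 = - X 3 0 := by rw [← hy, Units.inv_mul_cancel_right]
  have hb : b * X 0 0 = X 1 0 := by rw [← hy, Units.inv_mul_cancel_right]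
  have hc : c * X 0 0 = - X 4 0 := by rw [← hy, Units.inv_mul_cancel_right]
  have he : e * X 0 0 = X 2 0 := by rw [← hy, Units.inv_mul_cancel_right]
  have hab : (a * e - b * c) * X 0 0 = X 5 0 := by
    refine y.isUnit.mul_left_cancel ?_
    rw [hy]
    linear_combination - iso + e * X 0 0 * ha - X 3 0 * he - c * X 0 0 * hb - X 1 0 * hc
  let G : Matrix (Fin 4) (Fin 4) A := !![1, 0, 0, 0; 0, 1, 0, 0; -a, -b, 1, 0; -c, -e, 0, 1]
  have hG : det G = 1 := by
    rw [det_fin_four]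
    simp [G]
  refine IsScaledCompound.of_compound_mul (g := G) (by rw [hG]; exact isUnit_one) ?_
  refine isScaledCompound_of_diagOn₁ h2 (h.compound_mul (g := G) (by rw [hG]; exact isUnit_one)) ?_
  intro J hJ I hI
  simp at hJ
  subst hJ
  fin_cases I <;>
  first
  | exact absurd rfl hI
  | (simp [Matrix.mul_apply, Fin.sum_univ_succ, compound, G, pairFst, pairSnd]
     first
       | linear_combination - hab - b * hc + a * he + e * ha - c * hb
       | linear_combination ha
       | linear_combination - hb
       | linear_combination hc
       | linear_combination - he)

/-- Proper similitudes of the wedge product on `⋀²` are multiples of compound matrices. -/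
theorem IsProperSim.isScaledCompound [Finite (MaximalSpectrum A)]
    {X : Matrix (Fin 6) (Fin 6) A} {μ : A} (h2 : IsUnit (2 : A)) (h : IsProperSim X μ) :
    IsScaledCompound X := by
  have hμ := h.isUnit
  -- The factor `det p` is included so that the matrix producing a unit pivot is itself invertible.
  obtain ⟨p, hp⟩ := exists_isUnit_of_forall_maximal
    (fun p : Matrix (Fin 4) (Fin 4) A => det p * (compound p * X) 0 0)
    (by
      intro P x y hxy
      have key : ∀ x : Matrix (Fin 4) (Fin 4) A, Ideal.Quotient.mk P
          (det x * (compound x * X) 0 0) =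
          det (x.map (Ideal.Quotient.mk P)) *
            (compound (x.map (Ideal.Quotient.mk P)) *
              X.map (Ideal.Quotient.mk P)) 0 0 := by
        intro x
        rw [map_mul, RingHom.map_det, compound_map, ← Matrix.map_mul]
        rfl
      rw [key, key, hxy])
    (by
      intro P hP
      obtain ⟨I, hI⟩ := exists_notMem_col (h.det_eq ▸ hμ.pow 3) 0 hP
      have hb : ∀ p : Matrix (Fin 4) (Fin 4) A, (compound p * X) 0 0 =
          (p 0 0 * p 1 1 - p 0 1 * p 1 0) * X 0 0 + (p 0 0 * p 1 2 - p 0 2 * p 1 0) * X 1 0 +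
          (p 0 0 * p 1 3 - p 0 3 * p 1 0) * X 2 0 + (p 0 1 * p 1 2 - p 0 2 * p 1 1) * X 3 0 +
          (p 0 1 * p 1 3 - p 0 3 * p 1 1) * X 4 0 + (p 0 2 * p 1 3 - p 0 3 * p 1 2) * X 5 0 := by
        intro p
        simp [Matrix.mul_apply, Fin.sum_univ_succ, compound, pairFst, pairSnd]
        ring
      fin_cases I
      -- Permutation matrices whose first two rows select the pair `I` move the entry `X I 0` to the
      -- corner.
      · refine ⟨!![1, 0, 0, 0; 0, 1, 0, 0; 0, 0, 1, 0; 0, 0, 0, 1], ?_⟩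
        rw [hb, det_fin_four]
        simpa using hI
      · refine ⟨!![1, 0, 0, 0; 0, 0, 1, 0; 0, 1, 0, 0; 0, 0, 0, 1], ?_⟩
        rw [hb, det_fin_four]
        simpa using hI
      · refine ⟨!![1, 0, 0, 0; 0, 0, 0, 1; 0, 0, 1, 0; 0, 1, 0, 0], ?_⟩
        rw [hb, det_fin_four]
        simpa using hI
      · refine ⟨!![0, 1, 0, 0; 0, 0, 1, 0; 1, 0, 0, 0; 0, 0, 0, 1], ?_⟩
        rw [hb, det_fin_four]
        simpa using hI
      · refine ⟨!![0, 1, 0, 0; 0, 0, 0, 1; 0, 0, 1, 0; 1, 0, 0, 0], ?_⟩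
        rw [hb, det_fin_four]
        simpa using hI
      · refine ⟨!![0, 0, 1, 0; 0, 0, 0, 1; 1, 0, 0, 0; 0, 1, 0, 0], ?_⟩
        rw [hb, det_fin_four]
        simpa using hI)
  have hG : IsUnit (det p) := isUnit_of_mul_isUnit_left hp
  exact (isScaledCompound_of_pivot h2 (h.compound_mul hG)
    (isUnit_of_mul_isUnit_right hp)).of_compound_mul hG

end ClassificationSteps

/-! ### Quadratic algebras with involution -/

section QuadInvol

variable {R A : Type*} [CommRing R] [CommRing A] [Algebra R A]

/-- `A = R ⊕ R θ`, where `θ` is a unit with `σ θ = -θ`, and `2` is a unit. -/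
structure IsQuadInvol (σ : A ≃ₐ[R] A) (θ : A) : Prop where
  two : IsUnit (2 : R)
  map_gen : σ θ = -θ
  isUnit_gen : IsUnit θ
  decomp : ∀ a : A, ∃ r s : R, a = algebraMap R A r + algebraMap R A s * θ
  inj : Function.Injective (algebraMap R A)

namespace IsQuadInvol

variable {σ : A ≃ₐ[R] A} {θ : A} (h : IsQuadInvol σ θ)

include h

theorem two' : IsUnit (2 : A) := by
  have h1 := h.two.map (algebraMap R A)
  rwa [map_ofNat] at h1

theorem invol (a : A) : σ (σ a) = a := by
  obtain ⟨r, s, rfl⟩ := h.decomp a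
  simp [h.map_gen]

theorem exists_of_fixed {a : A} (ha : σ a = a) : ∃ r : R, algebraMap R A r = a := by
  obtain ⟨r, s, rfl⟩ := h.decomp a
  refine ⟨r, ?_⟩
  simp only [map_add, map_mul, AlgEquiv.commutes, h.map_gen] at ha
  have h1 : algebraMap R A s * θ = 0 := by
    refine h.two'.mul_left_cancel ?_
    linear_combination -ha
  rw [h1, add_zero]

theorem exists_norm (a : A) : ∃ r : R, algebraMap R A r = a * σ a :=
  h.exists_of_fixed (by rw [map_mul, h.invol, mul_comm])

theorem exists_gen_sq : ∃ r : R, algebraMap R A r = θ ^ 2 :=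
  h.exists_of_fixed (by rw [map_pow, h.map_gen, neg_sq])

/-- The inverse of a fixed element is fixed, hence comes from `R`. -/
theorem isUnit_of_algebraMap {r : R} (hr : IsUnit (algebraMap R A r)) : IsUnit r := by
  obtain ⟨b, hb⟩ := hr.exists_right_inv
  have h1 : σ b = b := by
    refine hr.mul_left_cancel ?_
    rw [hb]
    have := congrArg σ hb
    rwa [map_mul, AlgEquiv.commutes, map_one] at this
  obtain ⟨s, rfl⟩ := h.exists_of_fixed h1
  refine IsUnit.of_mul_eq_one s (h.inj ?_)
  rw [map_mul, hb, map_one]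

omit h in
theorem isUnit_of_norm {a : A} {r : R} (hr : algebraMap R A r = a * σ a) (hu : IsUnit r) :
    IsUnit a :=
  isUnit_of_mul_isUnit_left (hr ▸ hu.map (algebraMap R A) : IsUnit (a * σ a))

/-- Hilbert's Theorem 90 over a local ring. -/
theorem exists_eq_mul_conj [IsLocalRing R] {z : A} (hz : z * σ z = 1) :
    ∃ b : A, IsUnit b ∧ b = z * σ b := by
  obtain ⟨r, hr⟩ := h.exists_norm (1 + z)
  obtain ⟨s, hs⟩ := h.exists_norm (1 - z)
  -- The norms of `1 + z` and `1 - z` add up to the unit `4`, so over a local ring one of them is a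
  -- unit. In the second case `z σ(1 - z) = -(1 - z)`, and the factor `θ` corrects the sign.
  have h4 : r + s = 2 * 2 := by
    refine h.inj ?_
    simp only [map_add, map_mul, hr, hs, map_sub, map_one, map_ofNat]
    linear_combination 2 * hz
  rcases IsLocalRing.isUnit_or_isUnit_of_isUnit_add (h4 ▸ h.two.mul h.two) with hu | hu
  · refine ⟨1 + z, isUnit_of_norm hr hu, ?_⟩
    rw [map_add, map_one, mul_add, hz]
    ring
  · refine ⟨θ * (1 - z), h.isUnit_gen.mul (isUnit_of_norm hs hu), ?_⟩
    simp only [map_mul, map_sub, map_one, h.map_gen]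
    linear_combination (-θ) * hz

end IsQuadInvol

end QuadInvol

/-! ### Unitary similitudes in coordinates -/

section UnitaryMatrix

open Matrix

variable {R A : Type*} [CommRing R] [CommRing A] [Algebra R A]

/-- The conjugate transpose. -/
def conjT {m n : Type*} (σ : A ≃ₐ[R] A) (M : Matrix m n A) : Matrix n m A := (M.map σ)ᵀ

theorem conjT_mul {l m n : Type*} [Fintype m] (σ : A ≃ₐ[R] A) (M : Matrix l m A)
    (N : Matrix m n A) : conjT σ (M * N) = conjT σ N * conjT σ M := by
  rw [conjT, conjT, conjT, Matrix.map_mul, transpose_mul]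

theorem conjT_smul {m n : Type*} (σ : A ≃ₐ[R] A) (c : A) (M : Matrix m n A) :
    conjT σ (c • M) = σ c • conjT σ M := by
  ext i j
  simp [conjT]

theorem conjT_conjT {m n : Type*} {σ : A ≃ₐ[R] A} (hσ : ∀ a, σ (σ a) = a) (M : Matrix m n A) :
    conjT σ (conjT σ M) = M := by
  ext i j
  simp [conjT, hσ]

theorem conjT_compound (σ : A ≃ₐ[R] A) (M : Matrix (Fin 4) (Fin 4) A) :
    conjT σ (compound M) = compound (conjT σ M) := by
  rw [conjT, conjT, compound_transpose]
  exact congrArg _ (compound_map (σ : A →+* A) M).symm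

theorem det_conjT {n : Type*} [Fintype n] [DecidableEq n] (σ : A ≃ₐ[R] A) (M : Matrix n n A) :
    det (conjT σ M) = σ (det M) := by
  rw [conjT, det_transpose]
  exact ((σ : A →+* A).map_det M).symm

theorem det_map_algEquiv {n : Type*} [Fintype n] [DecidableEq n] (σ : A ≃ₐ[R] A)
    (M : Matrix n n A) : det (M.map σ) = σ (det M) :=
  ((σ : A →+* A).map_det M).symm

/-- The diagonal matrix over `A` with entries in `R`. -/
def diagR (A : Type*) [CommRing A] [Algebra R A] {n : Type*} [DecidableEq n] (α : n → R) :
    Matrix n n A :=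
  diagonal fun k => algebraMap R A (α k)

theorem diagR_map {n : Type*} [DecidableEq n] (σ : A ≃ₐ[R] A) (α : n → R) :
    (diagR A α).map σ = diagR A α := by
  rw [diagR, diagonal_map (map_zero σ)]
  simp

theorem diagR_transpose {n : Type*} [DecidableEq n] (α : n → R) :
    (diagR A α)ᵀ = diagR A α := diagonal_transpose _

theorem conjT_diagR {n : Type*} [DecidableEq n] (σ : A ≃ₐ[R] A) (α : n → R) :
    conjT σ (diagR A α) = diagR A α := by
  rw [conjT, diagR_map, diagR_transpose]

theorem isUnit_det_diagR {n : Type*} [Fintype n] [DecidableEq n] {α : n → R}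
    (hα : ∀ k, IsUnit (α k)) : IsUnit (det (diagR A α)) := by
  rw [diagR, det_diagonal]
  exact (IsUnit.prod_univ_iff.mpr fun k => (hα k).map (algebraMap R A))

theorem compound_diagR (α : Fin 4 → R) : compound (diagR A α) =
    diagR A fun I => α (pairFst I) * α (pairSnd I) := by
  rw [diagR, diagR, compound_diagonal]
  simp

/-- `M` is a similitude, of factor `ν`, of the hermitian form with diagonal Gram matrix. -/
def IsUnitarySim (σ : A ≃ₐ[R] A) (α : Fin 4 → R) (M : Matrix (Fin 4) (Fin 4) A) (ν : R) : Prop :=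
  conjT σ M * diagR A α * M = ν • diagR A α

/-- The matrix of the conjugate-linear map `L` on `⋀²`. -/
def opMat (α : Fin 4 → R) (δ : A) : Matrix (Fin 6) (Fin 6) A :=
  δ • (wedgeGram A * compound (diagR A α))

/-- `X` commutes with `L` and is a similitude, of factor `ν`, of the wedge product. -/
def IsQuatSim (σ : A ≃ₐ[R] A) (α : Fin 4 → R) (δ : A) (X : Matrix (Fin 6) (Fin 6) A) (ν : R) :
    Prop :=
  X * opMat α δ = opMat α δ * X.map σ ∧ Xᵀ * wedgeGram A * X = ν • wedgeGram A

variable {σ : A ≃ₐ[R] A} {θ : A} {α : Fin 4 → R} {δ : A}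

theorem wedgeGram_mul_opMat (α : Fin 4 → R) (δ : A) :
    wedgeGram A * opMat α δ = δ • compound (diagR A α) := by
  rw [opMat, Matrix.mul_smul, ← Matrix.mul_assoc, wedgeGram_mul_self, Matrix.one_mul]

theorem compound_diagR_transpose (α : Fin 4 → R) :
    (compound (diagR A α))ᵀ = compound (diagR A α) := by
  rw [← compound_transpose, diagR_transpose]

theorem isUnit_det_compound_diagR (hα : ∀ k, IsUnit (α k)) :
    IsUnit (det (compound (diagR A α))) := by
  rw [det_compound]
  exact (isUnit_det_diagR hα).pow 3

theorem isUnit_det_opMat (hα : ∀ k, IsUnit (α k)) (hδ : IsUnit δ) :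
    IsUnit (det (opMat α δ)) := by
  rw [opMat, det_smul, det_mul]
  exact (hδ.pow _).mul (isUnit_det_wedgeGram.mul (isUnit_det_compound_diagR hα))

theorem smul_cancel_of_isUnit_det {n : Type*} [Fintype n] [DecidableEq n] [Nonempty n]
    {D : Matrix n n A} (hD : IsUnit (det D)) {a b : A} (hab : a • D = b • D) : a = b := by
  have h1 := congrArg (· * D⁻¹) hab
  simp only [Matrix.smul_mul, mul_nonsing_inv D hD] at h1
  have i : n := Classical.arbitrary n
  simpa using congrFun (congrFun h1 i) i

theorem mul_left_cancel_of_isUnit_det {m n : Type*} [Fintype n] [DecidableEq n]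
    {D : Matrix n n A} (hD : IsUnit (det D)) {X Y : Matrix n m A} (hXY : D * X = D * Y) :
    X = Y := by
  rw [← nonsing_inv_mul_cancel_left D X hD, hXY, nonsing_inv_mul_cancel_left D Y hD]

theorem IsUnitarySim.det {M : Matrix (Fin 4) (Fin 4) A} {ν : R} (hα : ∀ k, IsUnit (α k))
    (hM : IsUnitarySim σ α M ν) : σ (det M) * det M = algebraMap R A (ν ^ 4) := by
  have h1 := congrArg Matrix.det hM
  rw [det_mul, det_mul, det_conjT, ← algebraMap_smul A ν, det_smul, Fintype.card_fin] at h1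
  refine (isUnit_det_diagR (A := A) hα).mul_right_cancel ?_
  rw [map_pow, ← h1]
  ring

theorem IsUnitarySim.isUnit_det {M : Matrix (Fin 4) (Fin 4) A} {ν : R} (hα : ∀ k, IsUnit (α k))
    (hν : IsUnit ν) (hM : IsUnitarySim σ α M ν) : IsUnit (Matrix.det M) := by
  refine isUnit_of_mul_isUnit_right (x := σ (Matrix.det M)) ?_
  rw [hM.det hα]
  exact (hν.pow 4).map _

theorem IsUnitarySim.compound {M : Matrix (Fin 4) (Fin 4) A} {ν : R}
    (hM : IsUnitarySim σ α M ν) : conjT σ (compound M) * compound (diagR A α) * compound M =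
      (ν ^ 2) • compound (diagR A α) := by
  rw [conjT_compound, ← compound_mul, ← compound_mul, hM, ← algebraMap_smul A ν, compound_smul,
    ← algebraMap_smul A (ν ^ 2), map_pow]

theorem transpose_conjT_mul {X : Matrix (Fin 6) (Fin 6) A} :
    (conjT σ X * ExcIso.compound (diagR A α) * X)ᵀ =
      Xᵀ * ExcIso.compound (diagR A α) * X.map σ := by
  rw [transpose_mul, transpose_mul, compound_diagR_transpose, conjT,
    transpose_transpose, Matrix.mul_assoc]

/-- After multiplication by the invertible `(⋀²M)ᵀ G`, both sides of the commutation of `c ⋀²M` with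
`L` become scalar multiples of one diagonal matrix. Commutation thus reduces to an equation between
scalars. -/
theorem IsUnitarySim.mul_opMat {M : Matrix (Fin 4) (Fin 4) A} {ν : R}
    (hM : IsUnitarySim σ α M ν) (c : A) :
    ((ExcIso.compound M)ᵀ * wedgeGram A) * (c • ExcIso.compound M * opMat α δ) =
        (c * Matrix.det M * δ) • ExcIso.compound (diagR A α) ∧
    ((ExcIso.compound M)ᵀ * wedgeGram A) * (opMat α δ * (c • ExcIso.compound M).map σ) =
        (algebraMap R A (ν ^ 2) * σ c * δ) • ExcIso.compound (diagR A α) := by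
  constructor
  · rw [← Matrix.mul_assoc, Matrix.mul_smul, compound_gram, smul_smul, Matrix.smul_mul,
      wedgeGram_mul_opMat, smul_smul]
  · have h1 : (c • ExcIso.compound M).map σ = σ c • (ExcIso.compound M).map σ := by
      ext i j
      simp
    have h2 := congrArg transpose hM.compound
    rw [transpose_conjT_mul, transpose_smul, compound_diagR_transpose] at h2
    rw [h1, ← Matrix.mul_assoc, Matrix.mul_assoc _ (wedgeGram A), wedgeGram_mul_opMat,
      Matrix.mul_smul, Matrix.mul_smul, Matrix.smul_mul, h2, ← algebraMap_smul A (ν ^ 2),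
      smul_smul, smul_smul]
    congr 1
    ring

theorem gram_smul_compound (c : A) (M : Matrix (Fin 4) (Fin 4) A) :
    (c • compound M)ᵀ * wedgeGram A * (c • compound M) = (c ^ 2 * det M) • wedgeGram A := by
  rw [transpose_smul, Matrix.smul_mul, Matrix.smul_mul, Matrix.mul_smul, compound_gram,
    smul_smul, smul_smul]
  congr 1
  ring

/-- `c ⋀² M` is a quaternionic similitude if `c / σ c = ν² / det M`. -/
theorem IsUnitarySim.isQuatSim (h : IsQuadInvol σ θ) (hα : ∀ k, IsUnit (α k))
    {M : Matrix (Fin 4) (Fin 4) A} {ν : R} (hν : IsUnit ν)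
    (hM : IsUnitarySim σ α M ν) {c : A} (hc : IsUnit c)
    (hcM : c * Matrix.det M = algebraMap R A (ν ^ 2) * σ c) :
    ∃ μ : R, IsUnit μ ∧ algebraMap R A μ = c ^ 2 * Matrix.det M ∧
      IsQuatSim σ α δ (c • ExcIso.compound M) μ := by
  obtain ⟨n, hn⟩ := h.exists_norm c
  have hnu : IsUnit n := h.isUnit_of_algebraMap (hn ▸ hc.mul (hc.map σ))
  have hd := hM.isUnit_det hα hν
  -- The similitude factor `c² det M` lies in `R`: by `hcM` it equals `ν²` times the norm of `c`.
  have e : algebraMap R A (ν ^ 2 * n) = c ^ 2 * Matrix.det M := by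
    rw [map_mul, hn]
    linear_combination (-c) * hcM
  refine ⟨ν ^ 2 * n, (hν.pow 2).mul hnu, e, ?_, ?_⟩
  · obtain ⟨h1, h2⟩ := hM.mul_opMat (δ := δ) c
    refine mul_left_cancel_of_isUnit_det (D := (ExcIso.compound M)ᵀ * wedgeGram A) ?_ ?_
    · rw [det_mul, det_transpose, det_compound]
      exact (hd.pow 3).mul isUnit_det_wedgeGram
    · rw [h1, h2, hcM]
  · rw [gram_smul_compound, ← e, algebraMap_smul]

theorem IsUnitarySim.eq_of_isQuatSim (hα : ∀ k, IsUnit (α k)) (hδ : IsUnit δ)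
    {M : Matrix (Fin 4) (Fin 4) A} {ν μ : R} (hM : IsUnitarySim σ α M ν) {c : A}
    (hX : IsQuatSim σ α δ (c • ExcIso.compound M) μ) :
    c * Matrix.det M = algebraMap R A (ν ^ 2) * σ c := by
  obtain ⟨h1, h2⟩ := hM.mul_opMat (δ := δ) c
  rw [hX.1, h2] at h1
  exact hδ.mul_right_cancel (smul_cancel_of_isUnit_det (isUnit_det_compound_diagR hα) h1.symm)

/-- The hermitian form on `⋀²` is the wedge form composed with `L` in one variable, so commuting
with `L` and scaling the wedge form implies scaling the hermitian form by the same factor. -/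
theorem IsQuatSim.conjT_mul {X : Matrix (Fin 6) (Fin 6) A} {ν : R} (hδ : IsUnit δ)
    (hX : IsQuatSim σ α δ X ν) :
    conjT σ X * compound (diagR A α) * X = ν • compound (diagR A α) := by
  apply Matrix.transpose_injective
  rw [transpose_conjT_mul, transpose_smul, compound_diagR_transpose]
  obtain ⟨d, rfl⟩ := hδ
  have h1 : compound (diagR A α) = ((d⁻¹ : Aˣ) : A) • (wedgeGram A * opMat α (d : A)) := by
    rw [wedgeGram_mul_opMat, smul_smul, Units.inv_mul, one_smul]
  rw [h1, Matrix.mul_smul, Matrix.smul_mul, ← smul_comm ((d⁻¹ : Aˣ) : A) ν]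
  congr 1
  rw [Matrix.mul_assoc, Matrix.mul_assoc, ← hX.1, ← Matrix.mul_assoc, ← Matrix.mul_assoc, hX.2,
    Matrix.smul_mul]

/-- Any commutative ring is allowed. An off-diagonal entry `K k i`, multiplied by the unit `t`
written as the principal minor on `i, j`, is a combination of two vanishing minors. The diagonal
entries then have all pairwise products equal to `t`, and since there are at least three of them
they coincide. -/
theorem eq_scalar_of_compound_eq_scalar {K : Matrix (Fin 4) (Fin 4) A} {t : A} (ht : IsUnit t)
    (hK : compound K = t • (1 : Matrix (Fin 6) (Fin 6) A)) :
    ∃ s : A, s ^ 2 = t ∧ K = s • (1 : Matrix (Fin 4) (Fin 4) A) := by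
  have hpair : ∀ k l : Fin 4, k ≠ l → ∃ I, (pairFst I = k ∧ pairSnd I = l) ∨
      (pairFst I = l ∧ pairSnd I = k) := by decide
  have hoff : ∀ k l i j : Fin 4, k ≠ l → i ≠ j → ¬ (k = i ∧ l = j) → ¬ (k = j ∧ l = i) →
      K k i * K l j - K k j * K l i = 0 := by
    intro k l i j hkl hij h1 h2
    obtain ⟨I, hI⟩ := hpair k l hkl
    obtain ⟨J, hJ⟩ := hpair i j hij
    have hIJ : I ≠ J := by
      rintro rfl
      rcases hI with ⟨rfl, rfl⟩ | ⟨rfl, rfl⟩ <;> rcases hJ with ⟨rfl, rfl⟩ | ⟨rfl, rfl⟩ <;>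
        simp_all
    have h3 := congrFun (congrFun hK I) J
    rw [Matrix.smul_apply, one_apply_ne hIJ, smul_zero, compound] at h3
    rcases hI with ⟨rfl, rfl⟩ | ⟨rfl, rfl⟩ <;> rcases hJ with ⟨rfl, rfl⟩ | ⟨rfl, rfl⟩ <;>
      first | linear_combination h3 | linear_combination -h3
  have hon : ∀ i j : Fin 4, i ≠ j → K i i * K j j - K i j * K j i = t := by
    intro i j hij
    obtain ⟨I, hI⟩ := hpair i j hij
    have h3 := congrFun (congrFun hK I) I
    rw [Matrix.smul_apply, one_apply_eq, smul_eq_mul, mul_one, compound] at h3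
    rcases hI with ⟨rfl, rfl⟩ | ⟨rfl, rfl⟩ <;> linear_combination h3
  have hthird : ∀ k l : Fin 4, ∃ j, k ≠ j ∧ l ≠ j := by decide
  have hzero : ∀ k i : Fin 4, k ≠ i → K k i = 0 := by
    intro k i hki
    obtain ⟨j, hkj, hij⟩ := hthird k i
    refine ht.mul_right_cancel ?_
    have h1 := hoff k j i j hkj hij (fun h => hki h.1) (fun h => hkj h.1)
    have h2 := hoff k i i j hki hij (fun h => hki h.1) (fun h => hkj h.1)
    rw [zero_mul, ← hon i j hij]
    linear_combination K i i * h1 - K j i * h2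
  have hdiag : ∀ i j : Fin 4, i ≠ j → K i i * K j j = t := by
    intro i j hij
    rw [← hon i j hij, hzero i j hij, zero_mul, sub_zero]
  have heq : ∀ i j : Fin 4, K i i = K j j := by
    intro i j
    obtain ⟨k, hik, hjk⟩ := hthird i j
    have hu : IsUnit (K k k) := isUnit_of_mul_isUnit_right (hdiag i k hik ▸ ht)
    exact hu.mul_right_cancel ((hdiag i k hik).trans (hdiag j k hjk).symm)
  refine ⟨K 0 0, ?_, ?_⟩
  · rw [← hdiag 0 1 (by decide), heq 1 0, sq]
  · ext i j
    by_cases hij : i = j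
    · subst hij
      rw [Matrix.smul_apply, one_apply_eq, smul_eq_mul, mul_one, heq]
    · rw [hzero i j hij, Matrix.smul_apply, one_apply_ne hij, smul_zero]

/-- If `c ⋀² M` is a quaternionic similitude, then `M` is a unitary similitude. -/
theorem IsQuatSim.exists_isUnitarySim (h : IsQuadInvol σ θ) (hα : ∀ k, IsUnit (α k))
    (hδ : IsUnit δ) {M : Matrix (Fin 4) (Fin 4) A} {μ : R} (hμ : IsUnit μ) {c : A} (hc : IsUnit c)
    (hX : IsQuatSim σ α δ (c • compound M) μ) : ∃ ν : R, IsUnit ν ∧ IsUnitarySim σ α M ν := by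
  have hD := isUnit_det_diagR (A := A) hα
  have h1 := hX.conjT_mul hδ
  have hcc : IsUnit (c * σ c) := hc.mul (hc.map σ)
  obtain ⟨e, he⟩ := hcc
  have h2 : conjT σ (compound M) * compound (diagR A α) * compound M =
      (((e⁻¹ : Aˣ) : A) * algebraMap R A μ) • compound (diagR A α) := by
    rw [conjT_smul, Matrix.smul_mul, Matrix.smul_mul, Matrix.mul_smul, smul_smul,
      ← algebraMap_smul A μ, mul_comm, ← he] at h1
    rw [mul_smul, ← h1, smul_smul, Units.inv_mul, one_smul]
  -- `K` compares `M` with its adjoint, and `M` is a similitude once `K` is scalar. The hermitian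
  -- relation on `⋀²` says exactly that the compound of `K` is scalar.
  let K := (diagR A α)⁻¹ * (conjT σ M * diagR A α * M)
  have hK : compound K = (((e⁻¹ : Aˣ) : A) * algebraMap R A μ) •
      (1 : Matrix (Fin 6) (Fin 6) A) := by
    rw [compound_mul, compound_mul, compound_mul, ← conjT_compound, h2, Matrix.mul_smul,
      ← compound_mul, nonsing_inv_mul _ hD, compound_one]
  have htu : IsUnit (((e⁻¹ : Aˣ) : A) * algebraMap R A μ) := (e⁻¹).isUnit.mul (hμ.map _)
  obtain ⟨s, hs, hKs⟩ := eq_scalar_of_compound_eq_scalar htu hK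
  have h3 : conjT σ M * diagR A α * M = s • diagR A α := by
    have := congrArg (diagR A α * ·) hKs
    simpa [K, mul_nonsing_inv_cancel_left _ _ hD] using this
  have hsu : IsUnit s := (isUnit_pow_iff two_ne_zero).mp (hs ▸ htu)
  -- The form `M* D M` is again hermitian, so its factor is fixed by `σ` and lies in `R`.
  have hsf : σ s = s := by
    have h4 := congrArg (conjT σ) h3
    rw [conjT_smul, ExcIso.conjT_mul, ExcIso.conjT_mul, conjT_conjT h.invol, conjT_diagR,
      ← Matrix.mul_assoc, h3] at h4
    exact (smul_cancel_of_isUnit_det hD h4).symm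
  obtain ⟨r, rfl⟩ := h.exists_of_fixed hsf
  exact ⟨r, h.isUnit_of_algebraMap hsu, by rw [IsUnitarySim, h3, algebraMap_smul]⟩

/-- Commutation with the invertible conjugate-linear `L` makes `X` similar to its conjugate. Hence
the determinant comes from `R`, where it can be compared with `μ³` although `A` need not be a
domain. -/
theorem IsQuatSim.det_fixed {X : Matrix (Fin 6) (Fin 6) A} {ν : R} (hα : ∀ k, IsUnit (α k))
    (hδ : IsUnit δ) (hX : IsQuatSim σ α δ X ν) : σ (det X) = det X := by
  have h1 := congrArg det hX.1
  rw [det_mul, det_mul, mul_comm, det_map_algEquiv] at h1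
  exact ((isUnit_det_opMat hα hδ).mul_left_cancel h1).symm

/-- The scalar `c` with `c / σ c = ν² / det M` is unique up to `Rˣ`. -/
theorem exists_eq_mul_of_eq (h : IsQuadInvol σ θ) {D b c c' : A} (hb : IsUnit b)
    (hc : IsUnit c) (hc' : IsUnit c') (h1 : c * D = b * σ c) (h2 : c' * D = b * σ c') :
    ∃ r : R, IsUnit r ∧ c' = algebraMap R A r * c := by
  obtain ⟨e, rfl⟩ := hc
  -- The quotient of two solutions is fixed by `σ`.
  have h3 : c' * σ e = e * σ c' := hb.mul_left_cancel (by linear_combination e * h2 - c' * h1)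
  have h4 : σ (c' * (e⁻¹ : Aˣ)) = c' * (e⁻¹ : Aˣ) := by
    refine (e.isUnit.mul (e.isUnit.map σ)).mul_left_cancel ?_
    have h5 : σ (e : A) * σ ((e⁻¹ : Aˣ) : A) = 1 := by rw [← map_mul, Units.mul_inv, map_one]
    rw [map_mul]
    linear_combination (e : A) * σ c' * h5 - c' * σ (e : A) * e.mul_inv - h3
  obtain ⟨r, hr⟩ := h.exists_of_fixed h4
  refine ⟨r, h.isUnit_of_algebraMap (hr ▸ hc'.mul (e⁻¹).isUnit), ?_⟩
  rw [hr, Units.inv_mul_cancel_right]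

end UnitaryMatrix

/-- By integrality every maximal ideal of `A` lies over the maximal ideal of `R`, and a finite
algebra has finitely many primes over a given one. -/
theorem finite_maximalSpectrum_of_isLocalRing (R A : Type*) [CommRing R] [CommRing A] [Algebra R A]
    [IsLocalRing R] [Module.Finite R A] : Finite (MaximalSpectrum A) := by
  have h : ((IsLocalRing.maximalIdeal R).primesOver A).Finite :=
    Algebra.QuasiFinite.finite_primesOver _
  have := h.to_subtype
  refine Finite.of_injective (fun I : MaximalSpectrum A =>
    (⟨I.asIdeal, I.isMaximal.isPrime, ⟨?_⟩⟩ : (IsLocalRing.maximalIdeal R).primesOver A)) ?_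
  · have := I.isMaximal
    have h1 : (I.asIdeal.comap (algebraMap R A)).IsMaximal :=
      Ideal.isMaximal_comap_of_isIntegral_of_isMaximal I.asIdeal
    exact (IsLocalRing.eq_maximalIdeal h1).symm
  · intro I J hIJ
    exact MaximalSpectrum.ext (congrArg Subtype.val hIJ)

/-! ### Quaternionic similitudes over a local ring, and those preserving a decomposition -/

section UnitaryClassification

open Matrix

variable {R A : Type*} [CommRing R] [CommRing A] [Algebra R A]
  {σ : A ≃ₐ[R] A} {θ : A} {α : Fin 4 → R} {δ : A}

/-- Over a local ring, the proper quaternionic similitudes are the multiples of `⋀² M`, for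
unitary similitudes `M`. -/
theorem IsQuatSim.exists_eq_smul_compound [IsLocalRing R] [Module.Finite R A]
    (h : IsQuadInvol σ θ) (hα : ∀ k, IsUnit (α k)) (hδ : IsUnit δ)
    {X : Matrix (Fin 6) (Fin 6) A} {μ : R} (hμ : IsUnit μ) (hX : IsQuatSim σ α δ X μ)
    (hdet : det X = algebraMap R A (μ ^ 3)) :
    ∃ (M : Matrix (Fin 4) (Fin 4) A) (c : A) (ν : R), IsUnit ν ∧ IsUnit c ∧
      IsUnitarySim σ α M ν ∧ X = c • compound M := by
  have := finite_maximalSpectrum_of_isLocalRing R A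
  have h1 : IsProperSim X (algebraMap R A μ) :=
    ⟨hμ.map _, by rw [hX.2, algebraMap_smul], by rw [hdet, map_pow]⟩
  obtain ⟨c, M, hc, -, rfl⟩ := h1.isScaledCompound h.two'
  obtain ⟨ν, hν, hM⟩ := hX.exists_isUnitarySim h hα hδ hμ hc
  exact ⟨M, c, ν, hν, hc, hM, rfl⟩

/-- The involution of `4`-space which is `1` on the span of the first two basis vectors and `-1`
on the span of the other two. -/
def splitMat (A : Type*) [CommRing A] : Matrix (Fin 4) (Fin 4) A := diagonal ![1, 1, -1, -1]

theorem compound_splitMat :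
    compound (splitMat A) = diagonal ![1, -1, -1, -1, -1, 1] := by
  rw [splitMat, compound_diagonal]
  congr 1
  funext I
  fin_cases I <;> simp [pairFst, pairSnd]

theorem Commute.compound {M N : Matrix (Fin 4) (Fin 4) A} (h : Commute M N) :
    Commute (compound M) (compound N) := by
  rw [Commute, SemiconjBy, ← compound_mul, ← compound_mul, h.eq]

theorem commute_diagonal_iff {n : Type*} [Fintype n] [DecidableEq n] (M : Matrix n n A)
    (t : n → A) : Commute M (diagonal t) ↔ ∀ i j, M i j * t j = t i * M i j := by
  rw [Commute, SemiconjBy, ← Matrix.ext_iff]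
  simp only [mul_diagonal, diagonal_mul]

/-- If `c ⋀² M` stabilizes each of the lines `e₀ ∧ e₁` and `e₂ ∧ e₃`, then `M` stabilizes the
corresponding planes. -/
theorem commute_splitMat {M : Matrix (Fin 4) (Fin 4) A} (h0 : ∀ I, I ≠ 0 → compound M I 0 = 0)
    (h5 : ∀ I, I ≠ 5 → compound M I 5 = 0) (u0 : IsUnit (compound M 0 0))
    (u5 : IsUnit (compound M 5 5)) : Commute M (splitMat A) := by
  -- Two minors on the column pair `J`, formed with an outside row `k`, vanish. Together they say
  -- that row `k`, restricted to these columns, is annihilated by an invertible `2 × 2` block;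
  -- Cramer's rule gives zero.
  have key : ∀ J, ∀ k i j : Fin 4, (∃ a, a ≠ J ∧ ((pairFst a = k ∧ pairSnd a = i) ∨
      (pairFst a = i ∧ pairSnd a = k))) → (∃ b, b ≠ J ∧ ((pairFst b = k ∧ pairSnd b = j) ∨
      (pairFst b = j ∧ pairSnd b = k))) → i = pairFst J → j = pairSnd J →
      (∀ I, I ≠ J → compound M I J = 0) → IsUnit (compound M J J) →
      M k i = 0 ∧ M k j = 0 := by
    rintro J k i j ⟨a, ha, ha'⟩ ⟨b, hb, hb'⟩ rfl rfl hJ hu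
    have e1 : M k (pairFst J) * M (pairFst J) (pairSnd J) -
        M k (pairSnd J) * M (pairFst J) (pairFst J) = 0 := by
      have := hJ a ha
      rw [compound] at this
      rcases ha' with ⟨h1, h2⟩ | ⟨h1, h2⟩ <;> rw [h1, h2] at this
      · linear_combination this
      · linear_combination -this
    have e2 : M k (pairFst J) * M (pairSnd J) (pairSnd J) -
        M k (pairSnd J) * M (pairSnd J) (pairFst J) = 0 := by
      have := hJ b hb
      rw [compound] at this
      rcases hb' with ⟨h1, h2⟩ | ⟨h1, h2⟩ <;> rw [h1, h2] at this
      · linear_combination this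
      · linear_combination -this
    constructor <;> refine hu.mul_right_cancel ?_ <;> rw [compound]
    · linear_combination M (pairFst J) (pairFst J) * e2 - M (pairSnd J) (pairFst J) * e1
    · linear_combination M (pairFst J) (pairSnd J) * e2 - M (pairSnd J) (pairSnd J) * e1
  obtain ⟨a20, a21⟩ := key 0 2 0 1 (by decide) (by decide) rfl rfl h0 u0
  obtain ⟨a30, a31⟩ := key 0 3 0 1 (by decide) (by decide) rfl rfl h0 u0
  obtain ⟨a02, a03⟩ := key 5 0 2 3 (by decide) (by decide) rfl rfl h5 u5
  obtain ⟨a12, a13⟩ := key 5 1 2 3 (by decide) (by decide) rfl rfl h5 u5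
  rw [splitMat, commute_diagonal_iff]
  intro i j
  fin_cases i <;> fin_cases j <;> simp [*]

theorem opMat_apply (α : Fin 4 → R) (δ : A) (I J : Fin 6) : opMat α δ I J =
    δ * (wedgeGram A I J *
      (algebraMap R A (α (pairFst J)) * algebraMap R A (α (pairSnd J)))) := by
  rw [opMat, compound_diagR, diagR, Matrix.smul_apply, mul_diagonal, map_mul, smul_eq_mul]

/-- The entries of a quaternionic similitude that stabilizes `⟨e₀ ∧ e₁, e₂ ∧ e₃⟩`. -/
theorem IsQuatSim.entries (h2 : IsUnit (2 : A)) (hα : ∀ k, IsUnit (α k)) (hδ : IsUnit δ)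
    {X : Matrix (Fin 6) (Fin 6) A} {μ : R} (hX : IsQuatSim σ α δ X μ)
    (hc : Commute X (compound (splitMat A))) :
    (∀ I, I ≠ 0 → I ≠ 5 → X I 0 = 0) ∧ (∀ I, I ≠ 0 → I ≠ 5 → X I 5 = 0) ∧
      X 0 0 * X 5 0 = 0 ∧ X 0 5 * X 5 5 = 0 ∧
      X 0 0 * X 5 5 + X 5 0 * X 0 5 = algebraMap R A μ ∧ X 0 0 = σ (X 5 5) := by
  have hg : Xᵀ * wedgeGram A * X = algebraMap R A μ • wedgeGram A := by
    rw [hX.2, algebraMap_smul]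
  rw [compound_splitMat, commute_diagonal_iff] at hc
  have hz : ∀ x : A, x = -x → x = 0 := fun x hx =>
    h2.mul_left_cancel (by linear_combination hx)
  have c0 : ∀ I, I ≠ 0 → I ≠ 5 → X I 0 = 0 := by
    intro I h0 h5
    have := hc I 0
    fin_cases I <;> first | exact absurd rfl h0 | exact absurd rfl h5 | (apply hz; simpa using this)
  have c5 : ∀ I, I ≠ 0 → I ≠ 5 → X I 5 = 0 := by
    intro I h0 h5
    have := hc I 5
    fin_cases I <;> first | exact absurd rfl h0 | exact absurd rfl h5 | (apply hz; simpa using this)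
  refine ⟨c0, c5, ?_, ?_, ?_, ?_⟩
  · have := gram_isotropic hg h2 0
    simpa [c0] using this
  · have := gram_isotropic hg h2 5
    simpa [c5] using this
  · have := gram_apply hg 0 5
    simpa [c0, c5, wedgeGram] using this
  -- `L` exchanges the lines of indices `0` and `5`; the `(0, 5)` entry of the commutation relation
  -- yields the claim.
  · have h1 := congrFun (congrFun hX.1 0) 5
    have hu : IsUnit (δ * (algebraMap R A (α 2) * algebraMap R A (α 3))) :=
      hδ.mul (((hα 2).map _).mul ((hα 3).map _))
    refine hu.mul_right_cancel ?_
    simp [wedgeGram, Matrix.mul_apply, Fin.sum_univ_succ, pairFst, pairSnd, opMat_apply] at h1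
    linear_combination h1

end UnitaryClassification

/-! ### Curves of quaternionic similitudes over an algebraically closed field -/

section Curves

open Matrix Polynomial

variable {K A : Type*} [Field K] [CommRing A] [Algebra K A]
  {σ : A ≃ₐ[K] A} {θ : A} {α : Fin 4 → K} {δ : A}

/-- With trace `T` and norm `N` of `c`, and `m² = N`, one has `(c + m)² = (T + 2m) c`. As `N ≠ 0`
and `2 ≠ 0`, at least one of the two signs of `m` makes `T + 2m` nonzero, and this scalar has a
square root in `K`. -/
theorem IsQuadInvol.exists_sq_eq [IsAlgClosed K] (h : IsQuadInvol σ θ) {c : A} (hc : IsUnit c) :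
    ∃ r : A, r ^ 2 = c := by
  obtain ⟨N, hN⟩ := h.exists_norm c
  obtain ⟨T, hT⟩ := h.exists_of_fixed (a := c + σ c) (by rw [map_add, h.invol, add_comm])
  have hNu : N ≠ 0 := (h.isUnit_of_algebraMap (hN ▸ hc.mul (hc.map σ))).ne_zero
  obtain ⟨n, hn⟩ := IsAlgClosed.exists_pow_nat_eq N two_pos
  have key : ∀ m : K, m ^ 2 = N → T + 2 * m ≠ 0 → ∃ r : A, r ^ 2 = c := by
    intro m hm hne
    obtain ⟨τ, hτ⟩ := IsAlgClosed.exists_pow_nat_eq (T + 2 * m) two_pos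
    have hτ0 : τ ≠ 0 := by
      rintro rfl
      exact hne (by rw [← hτ]; simp)
    refine ⟨τ⁻¹ • (c + algebraMap K A m), ?_⟩
    have h1 : (c + algebraMap K A m) ^ 2 = (T + 2 * m) • c := by
      have hm' : algebraMap K A m ^ 2 = c * σ c := by rw [← map_pow, hm, hN]
      rw [Algebra.smul_def, map_add, hT, map_mul, map_ofNat]
      linear_combination hm'
    rw [_root_.smul_pow, h1, ← hτ, smul_smul, inv_pow, inv_mul_cancel₀ (pow_ne_zero 2 hτ0), one_smul]
  by_cases h1 : T + 2 * n = 0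
  · refine key (-n) (by rw [neg_sq, hn]) fun h2 => hNu ?_
    have h3 : (2 * 2) * n = 0 := by linear_combination h1 - h2
    rw [← hn, (h.two.mul h.two).mul_right_eq_zero.mp h3]
    simp
  · exact key n hn h1

theorem conjT_adjugate {n : Type*} [Fintype n] [DecidableEq n] (σ : A ≃ₐ[K] A)
    (M : Matrix n n A) : conjT σ (adjugate M) = adjugate (conjT σ M) := by
  rw [conjT, conjT, ← adjugate_transpose]
  exact congrArg _ ((σ : A →+* A).map_adjugate M)

/-- If `W` is adjoint to `Y` and commutes with it, then `adj W * Y` is a unitary similitude. -/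
theorem isUnitarySim_adjugate_mul (h : IsQuadInvol σ θ) (hα : ∀ k, IsUnit (α k))
    {Y W : Matrix (Fin 4) (Fin 4) A} (hYW : conjT σ Y * diagR A α = diagR A α * W)
    (hc : Commute Y W) {n : K} (hn : algebraMap K A n = det Y * σ (det Y)) :
    det W = σ (det Y) ∧ IsUnitarySim σ α (adjugate W * Y) n := by
  have hD := isUnit_det_diagR (A := A) hα
  have hdet : det W = σ (det Y) := by
    have h1 := congrArg det hYW
    rw [det_mul, det_mul, det_conjT, mul_comm] at h1
    exact (hD.mul_left_cancel h1).symm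
  refine ⟨hdet, ?_⟩
  have hWY : conjT σ W * diagR A α = diagR A α * Y := by
    have h1 := congrArg (conjT σ) hYW
    rw [conjT_mul, conjT_mul, conjT_conjT h.invol, conjT_diagR] at h1
    exact h1.symm
  -- Adjugates are used instead of inverses so that the formula is polynomial in `Y` and `W`. Only
  -- `det D` has to be cancelled; `Y` need not be invertible.
  have hadj : adjugate (conjT σ W) * diagR A α = diagR A α * adjugate Y := by
    have h1 := congrArg adjugate hWY
    rw [adjugate_mul_distrib, adjugate_mul_distrib] at h1
    have h2 := congrArg (fun Z => diagR A α * Z * diagR A α) h1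
    simp only [← Matrix.mul_assoc, mul_adjugate, Matrix.smul_mul, Matrix.one_mul] at h2
    rw [Matrix.mul_assoc (diagR A α * adjugate Y), adjugate_mul, Matrix.mul_smul,
      Matrix.mul_one] at h2
    obtain ⟨u, hu⟩ := hD
    have h3 := congrArg (fun Z => ((u⁻¹ : Aˣ) : A) • Z) h2
    simpa only [smul_smul, ← hu, Units.inv_mul, one_smul] using h3
  have hcomm : adjugate Y * adjugate W = adjugate W * adjugate Y := by
    rw [← adjugate_mul_distrib, ← adjugate_mul_distrib, hc.eq]
  rw [IsUnitarySim, conjT_mul, conjT_adjugate]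
  calc conjT σ Y * adjugate (conjT σ W) * diagR A α * (adjugate W * Y)
      = conjT σ Y * (adjugate (conjT σ W) * diagR A α) * (adjugate W * Y) := by
        simp only [Matrix.mul_assoc]
    _ = (conjT σ Y * diagR A α) * (adjugate Y * adjugate W) * Y := by
        rw [hadj]
        simp only [Matrix.mul_assoc]
    _ = diagR A α * (W * adjugate W) * (adjugate Y * Y) := by
        rw [hYW, hcomm]
        simp only [Matrix.mul_assoc]
    _ = n • diagR A α := by
        rw [mul_adjugate, adjugate_mul, Matrix.mul_smul, Matrix.mul_one, Matrix.mul_smul,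
          Matrix.mul_one, smul_smul, ← algebraMap_smul A n, hn, hdet]

/-- The evaluation of polynomials with coefficients in `A` at an element of `K`. -/
noncomputable def evalAt (A : Type*) [CommRing A] [Algebra K A] (t : K) : A[X] →+* A :=
  evalRingHom (algebraMap K A t)

theorem evalAt_C (t : K) (a : A) : evalAt A t (C a) = a := eval_C

theorem evalAt_X (t : K) : evalAt A t X = algebraMap K A t := eval_X

theorem evalAt_map (t : K) (q : K[X]) :
    evalAt A t (q.map (algebraMap K A)) = algebraMap K A (q.eval t) := by
  rw [evalAt, coe_evalRingHom, eval_map, eval₂_at_apply]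

theorem eval_map_algHom (χ : A →ₐ[K] K) (t : K) (q : A[X]) :
    (q.map (χ : A →+* K)).eval t = χ (evalAt A t q) := by
  have h1 : t = (χ : A →+* K) (algebraMap K A t) := (χ.commutes t).symm
  rw [eval_map]
  conv_lhs => rw [h1]
  rw [eval₂_at_apply]
  rfl

theorem commute_adjugate {n : Type*} [Fintype n] [DecidableEq n] {W E : Matrix n n A}
    (hW : IsUnit (det W)) (h : Commute W E) : Commute (adjugate W) E := by
  have h1 : (adjugate W * E) * W = (E * adjugate W) * W := by
    rw [Matrix.mul_assoc, ← h.eq, ← Matrix.mul_assoc, adjugate_mul, Matrix.mul_assoc,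
      adjugate_mul, Matrix.smul_mul, Matrix.mul_smul, Matrix.mul_one, Matrix.one_mul]
  have h2 := congrArg (· * W⁻¹) h1
  simp only [mul_nonsing_inv_cancel_right _ _ hW] at h2
  exact h2

theorem conjT_add {m n : Type*} (σ : A ≃ₐ[K] A) (M N : Matrix m n A) :
    conjT σ (M + N) = conjT σ M + conjT σ N := by
  ext i j
  simp [conjT]

theorem conjT_one {n : Type*} [DecidableEq n] (σ : A ≃ₐ[K] A) :
    conjT σ (1 : Matrix n n A) = 1 := by
  rw [conjT, Matrix.map_one _ (map_zero σ) (map_one σ), transpose_one]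

/-- The segment from `1` to `Y`, as a matrix of polynomials. -/
noncomputable def segment {n : Type*} [DecidableEq n] (Y : Matrix n n A) : Matrix n n A[X] :=
  (1 - X : A[X]) • (1 : Matrix n n A[X]) + (X : A[X]) • Y.map C

theorem segment_map {n : Type*} [DecidableEq n] (Y : Matrix n n A) (t : K) :
    (segment Y).map (evalAt A t) =
      (1 - algebraMap K A t) • (1 : Matrix n n A) + algebraMap K A t • Y := by
  ext i j
  simp only [segment, Matrix.map_apply, Matrix.add_apply, Matrix.smul_apply, smul_eq_mul, map_add,
    map_mul, map_sub, map_one, evalAt_X, evalAt_C]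
  congr 2
  by_cases hij : i = j
  · rw [hij, one_apply_eq, one_apply_eq, map_one]
  · rw [one_apply_ne hij, one_apply_ne hij, map_zero]

/-- Parameters in `K` are fixed by `σ`, so adjointness of the end points persists along the segments
from `1`. -/
theorem conjT_segment (hσ : ∀ t : K, σ (algebraMap K A t) = algebraMap K A t)
    {Y W : Matrix (Fin 4) (Fin 4) A} (hYW : conjT σ Y * diagR A α = diagR A α * W) (t : K) :
    conjT σ ((segment Y).map (evalAt A t)) * diagR A α =
      diagR A α * (segment W).map (evalAt A t) := by
  rw [segment_map, segment_map, conjT_add, conjT_smul, conjT_smul, conjT_one, map_sub, map_one,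
    hσ, Matrix.add_mul, Matrix.smul_mul, Matrix.smul_mul, hYW, Matrix.mul_add, Matrix.mul_smul,
    Matrix.mul_smul, Matrix.one_mul, Matrix.mul_one]

theorem commute_smul_one_add {n : Type*} [Fintype n] [DecidableEq n] {Y Z : Matrix n n A}
    (h : Commute Y Z) (a b : A) : Commute (a • (1 : Matrix n n A) + b • Y) Z :=
  ((Commute.one_left Z).smul_left a).add_left (h.smul_left b)

/-- A unitary matrix `M` is of the form `W⁻¹ Y`, with `W` adjoint to `Y`. -/
theorem IsUnitarySim.exists_cayley [IsAlgClosed K] (h : IsQuadInvol σ θ)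
    (hα : ∀ k, IsUnit (α k)) {M : Matrix (Fin 4) (Fin 4) A} (hM : IsUnitarySim σ α M 1) :
    ∃ Y W : Matrix (Fin 4) (Fin 4) A, IsUnit (Matrix.det Y) ∧
      conjT σ Y * diagR A α = diagR A α * W ∧
      Commute Y W ∧ W * M = Y ∧
      ∀ E, Commute M E → Commute Y E ∧ Commute W E := by
  have hD := isUnit_det_diagR (A := A) hα
  obtain ⟨m, hm⟩ := h.exists_gen_sq
  have hm0 : IsUnit m := h.isUnit_of_algebraMap (hm ▸ h.isUnit_gen.pow 2)
  obtain ⟨k, hk⟩ := IsAlgClosed.exists_pow_nat_eq m two_pos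
  have hk0 : k ≠ 0 := by
    rintro rfl
    exact hm0.ne_zero (by rw [← hk]; simp)
  -- Over an algebraically closed field `A` splits; `(1 ± ε) / 2` are the two idempotents, exchanged
  -- by `σ`.
  obtain ⟨ε, hε, hσε⟩ : ∃ ε : A, ε ^ 2 = 1 ∧ σ ε = -ε := by
    refine ⟨algebraMap K A k⁻¹ * θ, ?_, ?_⟩
    · rw [mul_pow, ← hm, ← hk, ← map_pow, ← map_mul, ← mul_pow, inv_mul_cancel₀ hk0, one_pow,
        map_one]
    · rw [map_mul, AlgEquiv.commutes, h.map_gen, mul_neg]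
  let N := (diagR A α)⁻¹ * conjT σ M * diagR A α
  have hMN : conjT σ M * diagR A α = diagR A α * N := by
    simp only [N, ← Matrix.mul_assoc, mul_nonsing_inv _ hD, Matrix.one_mul]
  have hNM' : N * M = 1 := by
    rw [IsUnitarySim, one_smul] at hM
    simp only [N, Matrix.mul_assoc] at hM ⊢
    rw [hM, nonsing_inv_mul _ hD]
  have hMN' : M * N = 1 := mul_eq_one_comm.mp hNM'
  have hcomm : Commute M N := hMN'.trans hNM'.symm
  -- `Y` is `2` on one factor of `A` and `2 M` on the other, so it is invertible for every `M`,
  -- without the eigenvalue condition of the classical Cayley transform. `W` is its adjoint, and `N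
  -- = M⁻¹` gives `W M = Y`.
  let Y := (1 + ε) • (1 : Matrix (Fin 4) (Fin 4) A) + (1 - ε) • M
  let W := (1 - ε) • (1 : Matrix (Fin 4) (Fin 4) A) + (1 + ε) • N
  refine ⟨Y, W, ?_, ?_, ?_, ?_, ?_⟩
  · have h1 : Y * ((1 + ε) • (1 : Matrix (Fin 4) (Fin 4) A) + (1 - ε) • N) =
        (4 : A) • (1 : Matrix (Fin 4) (Fin 4) A) := by
      simp only [Y, Matrix.add_mul, Matrix.mul_add, Matrix.smul_mul, Matrix.mul_smul,
        Matrix.one_mul, Matrix.mul_one, hMN', smul_add, smul_smul]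
      have e1 : (1 + ε) * (1 - ε) = 0 := by linear_combination -hε
      have e2 : (1 - ε) * (1 + ε) = 0 := by linear_combination -hε
      have e3 : (4 : A) = (1 + ε) * (1 + ε) + (1 - ε) * (1 - ε) := by linear_combination -2 * hε
      rw [e1, e2, e3, zero_smul, zero_smul, add_smul]
      abel
    have h2 := congrArg Matrix.det h1
    rw [det_mul, det_smul, det_one, mul_one] at h2
    refine isUnit_of_mul_isUnit_left (h2 ▸ IsUnit.pow _ ?_)
    have h4 : (4 : A) = 2 * 2 := by norm_num
    exact h4 ▸ h.two'.mul h.two'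
  · simp only [Y, W, conjT_add, conjT_smul, conjT_one, map_add, map_sub, map_one, hσε,
      Matrix.add_mul, Matrix.mul_add, Matrix.smul_mul, Matrix.mul_smul, hMN, Matrix.one_mul,
      Matrix.mul_one, sub_neg_eq_add, ← sub_eq_add_neg]
  · exact commute_smul_one_add (commute_smul_one_add hcomm.symm _ _).symm _ _
  · simp only [Y, W, Matrix.add_mul, Matrix.smul_mul, Matrix.one_mul, hNM']
    abel
  · intro E hE
    refine ⟨commute_smul_one_add hE _ _, commute_smul_one_add ?_ _ _⟩
    calc N * E = N * E * (M * N) := by rw [hMN', Matrix.mul_one]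
      _ = N * (E * M) * N := by simp only [Matrix.mul_assoc]
      _ = (N * M) * E * N := by rw [← hE.eq]; simp only [Matrix.mul_assoc]
      _ = E * N := by rw [hNM', Matrix.one_mul]

/-- `c ⋀² M` is connected to `1` by a rational curve of quaternionic similitudes. -/
theorem IsUnitarySim.exists_curve [IsAlgClosed K] (h : IsQuadInvol σ θ) (χ : A →ₐ[K] K)
    (hα : ∀ k, IsUnit (α k)) {M : Matrix (Fin 4) (Fin 4) A} {ν : K}
    (hν : IsUnit ν) (hM : IsUnitarySim σ α M ν) {c : A} (hc : IsUnit c)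
    (hcM : c * Matrix.det M = algebraMap K A (ν ^ 2) * σ c) :
    ∃ (P : Matrix (Fin 6) (Fin 6) A[X]) (p : K[X]), p.eval 0 ≠ 0 ∧ p.eval 1 ≠ 0 ∧
      P.map (evalAt A (0 : K)) = 1 ∧ P.map (evalAt A (1 : K)) = c • ExcIso.compound M ∧
      ∀ t, p.eval t ≠ 0 →
        (∃ μ : K, IsUnit μ ∧ IsQuatSim σ α δ (P.map (evalAt A t)) μ) ∧
        (Commute M (splitMat A) →
          Commute (P.map (evalAt A t)) (ExcIso.compound (splitMat A))) := by
  have hσK : ∀ t : K, σ (algebraMap K A t) = algebraMap K A t := σ.commutes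
  -- Rescaling by a square root of `ν⁻¹` turns `M` into a unitary matrix of factor `1`.
  obtain ⟨s, hs⟩ := IsAlgClosed.exists_pow_nat_eq ν⁻¹ two_pos
  have hsν : s ^ 2 * ν = 1 := by rw [hs, inv_mul_cancel₀ hν.ne_zero]
  have hsν' : algebraMap K A s ^ 2 * algebraMap K A ν = 1 := by
    rw [← map_pow, ← map_mul, hsν, map_one]
  have hM1 : IsUnitarySim σ α (algebraMap K A s • M) 1 := by
    rw [IsUnitarySim, conjT_smul, hσK, Matrix.smul_mul, Matrix.smul_mul, Matrix.mul_smul, hM,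
      smul_smul, ← algebraMap_smul A ν, smul_smul, ← sq, hsν', one_smul, one_smul]
  obtain ⟨Y, W, hYu, hYW, hcomm, hWM, hE⟩ := hM1.exists_cayley h hα
  obtain ⟨n1, hn1⟩ := h.exists_norm (Matrix.det Y)
  have hdW := (isUnitarySim_adjugate_mul h hα hYW hcomm hn1).1
  have hdet : Matrix.det Y = σ (Matrix.det Y) * (algebraMap K A s ^ 4 * Matrix.det M) := by
    have h1 := congrArg Matrix.det hWM
    rw [det_mul, det_smul, Fintype.card_fin, hdW] at h1
    exact h1.symm
  -- At the end point, `adj W * Y = σ(det Y) s M`. The scalar thereby attached to `⋀²M` satisfies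
  -- the same equation as `c`, so they differ by `r ∈ Kˣ`, which the polynomial `f` interpolates
  -- from `1`.
  have hc0 : Matrix.det Y * (σ (Matrix.det Y) * algebraMap K A s) ^ 2 * Matrix.det M =
      algebraMap K A (ν ^ 2) * σ (Matrix.det Y * (σ (Matrix.det Y) * algebraMap K A s) ^ 2) := by
    simp only [map_mul, map_pow, h.invol, hσK]
    linear_combination (-(algebraMap K A ν ^ 2) * σ (Matrix.det Y) * Matrix.det Y *
      algebraMap K A s ^ 2) * hdet - (algebraMap K A s ^ 2 * algebraMap K A ν + 1) *
      Matrix.det Y * (σ (Matrix.det Y) * algebraMap K A s) ^ 2 * Matrix.det M * hsν'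
  have hsu : IsUnit (algebraMap K A s) := by
    refine (isUnit_iff_ne_zero.mpr ?_).map _
    rintro rfl
    simp at hsν
  obtain ⟨r, hr, hcr⟩ := exists_eq_mul_of_eq h ((hν.pow 2).map (algebraMap K A))
    (hYu.mul (((hYu.map σ).mul hsu).pow 2)) hc hc0 hcM
  let f : K[X] := 1 + X * (C r - 1)
  have hf0 : f.eval 0 = 1 := by simp [f]
  have hf1 : f.eval 1 = r := by simp [f]
  -- For `M_t = adj W_t * Y_t` of factor `N(det Y_t)`, the scalar `det Y_t` solves `c / σ(c) = ν² /
  -- det M_t`, because `det W_t = σ(det Y_t)`. No denominators occur, so the curve is polynomial.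
  let P : Matrix (Fin 6) (Fin 6) A[X] := (f.map (algebraMap K A) * Matrix.det (segment Y)) •
    ExcIso.compound (adjugate (segment W) * segment Y)
  let χ' : A →ₐ[K] K := χ.comp (σ : A →ₐ[K] A)
  -- `p` is `f` times the norm of `det Y_t`, evaluated through `χ`; where it does not vanish,
  -- everything is invertible.
  let p : K[X] := f * ((Matrix.det (segment Y)).map (χ : A →+* K) *
    (Matrix.det (segment Y)).map (χ' : A →+* K))
  have hP : ∀ t, P.map (evalAt A t) =
      (algebraMap K A (f.eval t) * Matrix.det ((segment Y).map (evalAt A t))) •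
      ExcIso.compound (adjugate ((segment W).map (evalAt A t)) *
        (segment Y).map (evalAt A t)) := by
    intro t
    have h1 : adjugate ((segment W).map (evalAt A t)) = (adjugate (segment W)).map (evalAt A t) :=
      ((evalAt A t).map_adjugate (segment W)).symm
    have h2 : Matrix.det ((segment Y).map (evalAt A t)) = evalAt A t (Matrix.det (segment Y)) :=
      ((evalAt A t).map_det (segment Y)).symm
    rw [h1, h2, ← Matrix.map_mul, compound_map, ← evalAt_map, ← map_mul]
    ext i j
    simp [P]
  have hp : ∀ t, p.eval t = f.eval t *
      χ (Matrix.det ((segment Y).map (evalAt A t)) *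
        σ (Matrix.det ((segment Y).map (evalAt A t)))) := by
    intro t
    have h2 : Matrix.det ((segment Y).map (evalAt A t)) = evalAt A t (Matrix.det (segment Y)) :=
      ((evalAt A t).map_det (segment Y)).symm
    rw [eval_mul, eval_mul, eval_map_algHom, eval_map_algHom, h2, map_mul]
    rfl
  have hY0 : ∀ Y : Matrix (Fin 4) (Fin 4) A, (segment Y).map (evalAt A (0 : K)) = 1 := by
    intro Y
    rw [segment_map]
    simp
  have hY1 : ∀ Y : Matrix (Fin 4) (Fin 4) A, (segment Y).map (evalAt A (1 : K)) = Y := by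
    intro Y
    rw [segment_map]
    simp
  refine ⟨P, p, ?_, ?_, ?_, ?_, ?_⟩
  · rw [hp, hY0, hf0]
    simp
  · rw [hp, hY1, hf1]
    exact mul_ne_zero hr.ne_zero ((hYu.mul (hYu.map σ)).map χ).ne_zero
  · rw [hP, hY0, hY0, hf0]
    simp [compound_one]
  · rw [hP, hY1, hY1, hf1, ← hWM, ← Matrix.mul_assoc, adjugate_mul, Matrix.smul_mul,
      Matrix.one_mul, hWM, smul_smul, compound_smul, smul_smul, hcr, hdW]
    congr 1
    ring
  · intro t ht
    rw [hp] at ht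
    rw [hP]
    have hft : f.eval t ≠ 0 := left_ne_zero_of_mul ht
    have hYW' := conjT_segment hσK hYW t
    have hcm : Commute ((segment Y).map (evalAt A t)) ((segment W).map (evalAt A t)) := by
      rw [segment_map, segment_map]
      exact commute_smul_one_add (commute_smul_one_add hcomm.symm _ _).symm _ _
    obtain ⟨n, hn⟩ := h.exists_norm (Matrix.det ((segment Y).map (evalAt A t)))
    have hnu : IsUnit n := by
      refine isUnit_iff_ne_zero.mpr ?_
      rintro rfl
      rw [← hn, map_zero, map_zero, mul_zero] at ht
      exact ht rfl
    obtain ⟨hdW', hsim⟩ := isUnitarySim_adjugate_mul h hα hYW' hcm hn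
    have hYu' : IsUnit (Matrix.det ((segment Y).map (evalAt A t))) :=
      IsQuadInvol.isUnit_of_norm hn hnu
    constructor
    · obtain ⟨μ, hμ, -, hq⟩ := hsim.isQuatSim (δ := δ) h hα hnu
        (c := algebraMap K A (f.eval t) * Matrix.det ((segment Y).map (evalAt A t)))
        (((isUnit_iff_ne_zero.mpr hft).map _).mul hYu') (by
          rw [det_mul, det_adjugate, Fintype.card_fin, hdW', map_pow, hn, map_mul, hσK]
          ring)
      exact ⟨μ, hμ, hq⟩
    · intro hME
      obtain ⟨hY, hW⟩ := hE _ (hME.smul_left (algebraMap K A s))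
      have hWE : Commute ((segment W).map (evalAt A t)) (splitMat A) := by
        rw [segment_map]
        exact commute_smul_one_add hW _ _
      have hYE : Commute ((segment Y).map (evalAt A t)) (splitMat A) := by
        rw [segment_map]
        exact commute_smul_one_add hY _ _
      exact (Commute.compound ((commute_adjugate (by rw [hdW']; exact hYu'.map σ) hWE).mul_left
        hYE)).smul_left _

end Curves

/-! ### Coordinates after extension of scalars -/

section QuadraticExtension

variable {F : Type u} [Field F] {E : Type v} [Field E] [Algebra F E]
  [Algebra.IsQuadraticExtension F E] {ρ : E ≃ₐ[F] E} {i : E}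

/-- `1` and `i` lie in different eigenspaces of `ρ`, since `2 ≠ 0`; they are thus independent and
span by dimension. -/
theorem exists_eq_add_mul_gen (h2 : (2 : F) ≠ 0) (hi : i ≠ 0) (hi' : ρ i = -i) (e : E) :
    ∃ r s : F, e = algebraMap F E r + algebraMap F E s * i := by
  have h2' : (2 : E) ≠ 0 := by
    have := (map_ne_zero (algebraMap F E)).mpr h2
    rwa [map_ofNat] at this
  have hlin : LinearIndependent F ![(1 : E), i] := by
    rw [LinearIndependent.pair_iff]
    intro s t hst
    have h3 := congrArg ρ hst
    simp only [map_add, map_smul, map_one, hi', map_zero, smul_neg] at h3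
    have h4 : (2 : E) * (t • i) = 0 := by linear_combination hst - h3
    have ht : t = 0 := by simpa [h2', hi] using h4
    subst ht
    simpa using hst
  have htop := hlin.span_eq_top_of_card_eq_finrank' (by
    rw [Algebra.IsQuadraticExtension.finrank_eq_two F E, Fintype.card_fin])
  have he : e ∈ Submodule.span F (Set.range ![(1 : E), i]) := htop ▸ Submodule.mem_top
  rw [Matrix.range_cons_cons_empty, Submodule.mem_span_pair] at he
  obtain ⟨r, s, rfl⟩ := he
  exact ⟨r, s, by simp [Algebra.smul_def]⟩

theorem isQuadInvol_conjR (h2 : (2 : F) ≠ 0) (hi : i ≠ 0) (hi' : ρ i = -i) (R : Type u)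
    [CommRing R] [Algebra F R] :
    IsQuadInvol (conjR ρ R) ((1 : R) ⊗ₜ[F] i) where
  two := by
    have h3 := (isUnit_iff_ne_zero.mpr h2).map (algebraMap F R)
    rwa [map_ofNat] at h3
  map_gen := by
    change (1 : R) ⊗ₜ[F] ρ i = _
    rw [hi', TensorProduct.tmul_neg]
  isUnit_gen := (isUnit_iff_ne_zero.mpr hi).map
    (Algebra.TensorProduct.includeRight : E →ₐ[F] R ⊗[F] E)
  decomp a := by
    induction a with
    | zero => exact ⟨0, 0, by simp⟩
    | add a b ha hb =>
      obtain ⟨r, s, rfl⟩ := ha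
      obtain ⟨r', s', rfl⟩ := hb
      exact ⟨r + r', s + s', by simp only [map_add]; ring⟩
    | tmul r e =>
      obtain ⟨x, y, rfl⟩ := exists_eq_add_mul_gen h2 hi hi' e
      refine ⟨x • r, y • r, ?_⟩
      rw [TensorProduct.tmul_add, Algebra.TensorProduct.algebraMap_apply,
        Algebra.TensorProduct.algebraMap_apply, Algebra.TensorProduct.tmul_mul_tmul, one_mul,
        mul_one, Algebra.algebraMap_self_apply, Algebra.algebraMap_self_apply,
        TensorProduct.smul_tmul, TensorProduct.smul_tmul, Algebra.smul_def, Algebra.smul_def,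
        mul_one]
  inj := by
    have h1 : Function.Injective (Algebra.TensorProduct.includeLeft : R →ₐ[R] R ⊗[F] E) :=
      Algebra.TensorProduct.includeLeft_injective (algebraMap F E).injective
    exact h1

end QuadraticExtension

/-! ### Matrices of automorphisms of `R ⊗ W` -/

section Coordinates

variable {F : Type u} [Field F] {E : Type v} [Field E] [Algebra F E]
  {W : Type w} [AddCommGroup W] [Module E W] [Module F W] [IsScalarTower F E W]
  {ι : Type*} [Fintype ι] [DecidableEq ι]

/-- The coordinates of `R ⊗ W` with respect to an `E`-basis of `W`. -/
noncomputable def coordR (b : Module.Basis ι E W) (R : Type u) [CommRing R] [Algebra F R] :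
    R ⊗[F] W ≃ₗ[R] (ι → R ⊗[F] E) :=
  (TensorProduct.AlgebraTensorModule.congr (LinearEquiv.refl R R)
    (b.equivFun.restrictScalars F)) ≪≫ₗ TensorProduct.piRight F R R fun _ => E

variable (b : Module.Basis ι E W) {R : Type u} [CommRing R] [Algebra F R]

theorem coordR_tmul (r : R) (x : W) (k : ι) :
    coordR b R (r ⊗ₜ[F] x) k = r ⊗ₜ[F] b.repr x k := by
  rfl

theorem coordR_scal (a : R ⊗[F] E) (x : R ⊗[F] W) :
    coordR b R (scal R a x) = a • coordR b R x := by
  induction a with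
  | zero => simp
  | add a c ha hc => rw [map_add, LinearMap.add_apply, map_add, ha, hc, add_smul]
  | tmul r e =>
    induction x with
    | zero => simp
    | add x y hx hy => rw [map_add, map_add, hx, hy, map_add, smul_add]
    | tmul s x =>
      ext k
      rw [scal_tmul, LinearMap.baseChange_tmul, TensorProduct.smul_tmul', coordR_tmul,
        Pi.smul_apply, coordR_tmul, smul_eq_mul, smul_eq_mul, Algebra.TensorProduct.tmul_mul_tmul]
      simp [actE]

theorem coordR_basis (k : ι) : coordR b R ((1 : R) ⊗ₜ[F] b k) = Pi.single k 1 := by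
  ext l
  rw [coordR_tmul, b.repr_self]
  by_cases h : l = k
  · subst h
    simp [Algebra.TensorProduct.one_def]
  · rw [Pi.single_eq_of_ne h, Finsupp.single_eq_of_ne h, TensorProduct.tmul_zero]

theorem eq_sum_scal (x : R ⊗[F] W) :
    x = ∑ k, scal R (coordR b R x k) ((1 : R) ⊗ₜ[F] b k) := by
  refine (coordR b R).injective ?_
  ext l
  rw [map_sum, Finset.sum_apply, Finset.sum_eq_single l]
  · rw [coordR_scal, coordR_basis, Pi.smul_apply, Pi.single_eq_same, smul_eq_mul, mul_one]
  · intro k _ hk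
    rw [coordR_scal, coordR_basis, Pi.smul_apply, Pi.single_eq_of_ne hk.symm, smul_zero]
  · simp

/-- `M` is the matrix of `g`. -/
def HasMat (g : GLp F R W) (M : Matrix ι ι (R ⊗[F] E)) : Prop :=
  ∀ x, coordR b R (g x) = M.mulVec (coordR b R x)

/-- The matrix of `g`. -/
noncomputable def toMat (g : GLp F R W) : Matrix ι ι (R ⊗[F] E) :=
  Matrix.of fun k l => coordR b R (g ((1 : R) ⊗ₜ[F] b l)) k

theorem hasMat_toMat (g : GLp F R W)
    (hg : ∀ (e : E) x, g ((actE e).baseChange R x) = (actE e).baseChange R (g x)) :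
    HasMat b g (toMat b g) := by
  intro x
  conv_lhs => rw [eq_sum_scal b x]
  ext k
  rw [map_sum, map_sum, Finset.sum_apply]
  refine Finset.sum_congr rfl fun l _ => ?_
  rw [scal_comm g hg, coordR_scal, Pi.smul_apply, smul_eq_mul, mul_comm]
  rfl

variable {b} {g g' : GLp F R W} {M M' : Matrix ι ι (R ⊗[F] E)}

theorem HasMat.scal_comm (h : HasMat b g M) (a : R ⊗[F] E) (x : R ⊗[F] W) :
    g (scal R a x) = scal R a (g x) := by
  refine (coordR b R).injective ?_
  rw [h, coordR_scal, coordR_scal, h, Matrix.mulVec_smul]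

theorem HasMat.actE_comm (h : HasMat b g M) (e : E) (x : R ⊗[F] W) :
    g ((actE e).baseChange R x) = (actE e).baseChange R (g x) := by
  have h1 := h.scal_comm ((1 : R) ⊗ₜ e) x
  rwa [scal_tmul, scal_tmul, one_smul, one_smul] at h1

theorem HasMat.mulVec_surjective (h : HasMat b g M) (y : ι → R ⊗[F] E) :
    coordR b R (g ((coordR b R).symm y)) = M.mulVec y := by
  rw [h, LinearEquiv.apply_symm_apply]

theorem HasMat.eq_mat (h : HasMat b g M) (h' : HasMat b g M') : M = M' := by
  refine Matrix.ext_of_mulVec_single fun k => ?_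
  rw [← h.mulVec_surjective, ← h'.mulVec_surjective]

theorem HasMat.eq_gl (h : HasMat b g M) (h' : HasMat b g' M) : g = g' := by
  refine LinearEquiv.ext fun x => (coordR b R).injective ?_
  rw [h, h']

theorem HasMat.mul (h : HasMat b g M) (h' : HasMat b g' M') : HasMat b (g * g') (M * M') := by
  intro x
  rw [LinearEquiv.mul_apply, h, h', Matrix.mulVec_mulVec]

theorem hasMat_one : HasMat b (1 : GLp F R W) 1 := by
  intro x
  rw [Matrix.one_mulVec]
  rfl

theorem HasMat.exists_inv (h : HasMat b g M) : ∃ N, HasMat b g⁻¹ N ∧ M * N = 1 ∧ N * M = 1 := by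
  have h1 : HasMat b g⁻¹ (toMat b g⁻¹) := by
    refine hasMat_toMat b _ fun e x => g.injective ?_
    have hg : ∀ x, g (g⁻¹ x) = x := fun x => g.apply_symm_apply x
    rw [h.actE_comm, hg, hg]
  refine ⟨_, h1, (h.mul h1).eq_mat ?_, (h1.mul h).eq_mat ?_⟩
  · rw [mul_inv_cancel]
    exact hasMat_one
  · rw [inv_mul_cancel]
    exact hasMat_one

theorem exists_hasMat (b : Module.Basis ι E W) {M : Matrix ι ι (R ⊗[F] E)} (hM : IsUnit M.det) :
    ∃ g : GLp F R W, HasMat b g M := by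
  refine ⟨coordR b R ≪≫ₗ ((Matrix.toLinearEquiv (Pi.basisFun _ ι) M hM).restrictScalars R) ≪≫ₗ
    (coordR b R).symm, fun x => ?_⟩
  rw [LinearEquiv.trans_apply, LinearEquiv.trans_apply, LinearEquiv.apply_symm_apply]
  change Matrix.toLin (Pi.basisFun _ ι) (Pi.basisFun _ ι) M _ = _
  rw [Matrix.toLin_eq_toLin', Matrix.toLin'_apply]

theorem HasMat.detE_eq (h : HasMat b g M)
    (hg : ∀ (e : E) x, g ((actE e).baseChange R x) = (actE e).baseChange R (g x)) :
    detE g hg = M.det := by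
  let _ : Module (R ⊗[F] E) (R ⊗[F] W) := Module.compHom _ (scal (E := E) (V := W) R).toRingHom
  -- The coordinates are linear over `R ⊗ E` for the module structure introduced inside `detE`.
  let B : (R ⊗[F] W) ≃ₗ[R ⊗[F] E] (ι → R ⊗[F] E) :=
    { toFun := coordR b R
      invFun := (coordR b R).symm
      left_inv := (coordR b R).left_inv
      right_inv := (coordR b R).right_inv
      map_add' := (coordR b R).map_add
      map_smul' := fun a x => coordR_scal b a x }
  let G : (R ⊗[F] W) →ₗ[R ⊗[F] E] (R ⊗[F] W) :=
    { toFun := g, map_add' := g.map_add, map_smul' := fun a x => ExcIso.scal_comm g hg a x }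
  change LinearMap.det G = _
  rw [← LinearMap.det_conj G B, ← LinearMap.det_toLin' M]
  congr 1
  refine LinearMap.ext fun y => ?_
  rw [Matrix.toLin'_apply]
  exact h.mulVec_surjective y

/-- The map `R ⊗ E → S ⊗ E` induced by `R → S`. -/
noncomputable def mapE (E : Type v) [Field E] [Algebra F E] {S : Type u} [CommRing S]
    [Algebra F S] (f : R →ₐ[F] S) :
    R ⊗[F] E →ₐ[F] S ⊗[F] E := Algebra.TensorProduct.map f (AlgHom.id F E)

variable {S : Type u} [CommRing S] [Algebra F S]

theorem coordR_rTensor (f : R →ₐ[F] S) (x : R ⊗[F] W) :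
    coordR b S (f.toLinearMap.rTensor W x) = fun k => mapE E f (coordR b R x k) := by
  induction x with
  | zero => ext; simp
  | add x y hx hy => rw [map_add, map_add, hx, hy, map_add]; ext; simp
  | tmul r x =>
    ext k
    rw [LinearMap.rTensor_tmul, coordR_tmul, coordR_tmul]
    rfl

theorem glMap_comm (f : R →ₐ[F] S) (hg : ∀ (e : E) x, g ((actE e).baseChange R x) =
    (actE e).baseChange R (g x)) (e : E) (x : S ⊗[F] W) :
    glMap f g ((actE e).baseChange S x) = (actE e).baseChange S (glMap f g x) := by
  have key : ∀ y : R ⊗[F] W, (actE e).baseChange S (f.toLinearMap.rTensor W y) =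
      f.toLinearMap.rTensor W ((actE e).baseChange R y) := by
    intro y
    induction y with
    | zero => simp
    | add y z hy hz => rw [map_add, map_add, hy, hz, map_add, map_add]
    | tmul r y => simp
  induction x with
  | zero => simp
  | add x y hx hy => simp only [map_add, hx, hy]
  | tmul s x =>
    have h1 : s ⊗ₜ[F] x = s • f.toLinearMap.rTensor W ((1 : R) ⊗ₜ[F] x) := by
      simp [TensorProduct.smul_tmul']
    rw [h1, map_smul, map_smul, map_smul, map_smul, key, glMap_rTensor, glMap_rTensor, hg, ← key]

theorem HasMat.glMap (h : HasMat b g M) (f : R →ₐ[F] S) :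
    HasMat b (glMap f g) (M.map (mapE E f)) := by
  have h1 := hasMat_toMat b (ExcIso.glMap f g) (glMap_comm f h.actE_comm)
  convert h1
  ext k l
  have h2 : (1 : S) ⊗ₜ[F] b l = f.toLinearMap.rTensor W ((1 : R) ⊗ₜ[F] b l) := by simp
  rw [toMat, Matrix.of_apply, h2, glMap_rTensor, coordR_rTensor, h, coordR_basis,
    Matrix.mulVec_single_one]
  rfl

theorem hasMat_smul_one_iff (b : Module.Basis ι E W) (c : R ⊗[F] E) :
    HasMat b g (c • (1 : Matrix ι ι (R ⊗[F] E))) ↔ ∀ x, g x = scal R c x := by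
  refine forall_congr' fun x => ?_
  rw [Matrix.smul_mulVec, Matrix.one_mulVec, ← coordR_scal, (coordR b R).injective.eq_iff]

theorem mem_scalars_iff (b : Module.Basis ι E W) :
    g ∈ scalars E W R ↔ ∃ c : R ⊗[F] E, IsUnit c ∧ HasMat b g (c • (1 : Matrix ι ι (R ⊗[F] E))) := by
  constructor
  · rintro ⟨c, rfl⟩
    exact ⟨c, c.isUnit, (hasMat_smul_one_iff b _).mpr fun x => rfl⟩
  · rintro ⟨_, ⟨c, rfl⟩, hc⟩
    exact ⟨c, LinearEquiv.ext fun x => ((hasMat_smul_one_iff b c).mp hc x).symm⟩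

theorem mem_homotheties_iff (b : Module.Basis ι E W) :
    g ∈ homotheties W R ↔ ∃ r : R, IsUnit r ∧
      HasMat b g (algebraMap R (R ⊗[F] E) r • (1 : Matrix ι ι (R ⊗[F] E))) := by
  have key : ∀ r : R, HasMat b g (algebraMap R (R ⊗[F] E) r • (1 : Matrix ι ι (R ⊗[F] E))) ↔
      ∀ x, g x = r • x := by
    intro r
    rw [hasMat_smul_one_iff]
    refine forall_congr' fun x => ?_
    rw [AlgHom.commutes]
    rfl
  constructor
  · rintro ⟨c, rfl⟩
    exact ⟨c, c.isUnit, (key _).mpr fun x => rfl⟩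
  · rintro ⟨_, ⟨c, rfl⟩, hc⟩
    exact ⟨c, LinearEquiv.ext fun x => ((key _).mp hc x).symm⟩

end Coordinates

/-! ### Orthogonal bases -/

section OrthogonalBasis

variable {F : Type u} [Field F] {E : Type v} [Field E] [Algebra F E]
  [Algebra.IsQuadraticExtension F E] {ρ : E ≃ₐ[F] E} {i : E}

theorem exists_algebraMap_of_fixed (h2 : (2 : F) ≠ 0) (hi : i ≠ 0) (hi' : ρ i = -i) {e : E}
    (he : ρ e = e) : ∃ r : F, algebraMap F E r = e := by
  obtain ⟨r, s, rfl⟩ := exists_eq_add_mul_gen h2 hi hi' e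
  refine ⟨r, ?_⟩
  have h2' : (2 : E) ≠ 0 := by
    have := (map_ne_zero (algebraMap F E)).mpr h2
    rwa [map_ofNat] at this
  simp only [map_add, map_mul, AlgEquiv.commutes, hi'] at he
  have h3 : (2 : E) * (algebraMap F E s * i) = 0 := by linear_combination -he
  rw [(mul_eq_zero.mp h3).resolve_left h2', add_zero]

theorem linearIndependent_of_orthogonal {V : Type*} [AddCommGroup V] [Module E V] {σ : E →+* E}
    (B : V →ₛₗ[σ] V →ₗ[E] E) {ι : Type*} [Fintype ι] (v : ι → V)
    (h1 : ∀ k l, k ≠ l → B (v k) (v l) = 0) (h2 : ∀ k, B (v k) (v k) ≠ 0) :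
    LinearIndependent E v := by
  rw [Fintype.linearIndependent_iff]
  intro c hc k
  have h3 := congrArg (B (v k)) hc
  rw [map_sum, map_zero, Finset.sum_eq_single k, map_smul, smul_eq_mul] at h3
  · exact (mul_eq_zero.mp h3).resolve_right (h2 k)
  · intro l _ hl
    rw [map_smul, h1 k l hl.symm, smul_zero]
  · simp

/-- Diagonalization of hermitian forms by induction on the dimension: an anisotropic vector is split
off. The space is quantified because the induction passes to the orthogonal complement. -/
theorem exists_orthogonal (h2 : (2 : F) ≠ 0) (hi : i ≠ 0) (hi' : ρ i = -i) (n : ℕ) :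
    ∀ (V : Type w) [AddCommGroup V] [Module E V] (H : V →ₛₗ[(ρ : E →+* E)] V →ₗ[E] E)
      (_ : ∀ x y, H x y = ρ (H y x)) (_ : ∀ x, (∀ y, H x y = 0) → x = 0)
      (_ : Module.finrank E V = n), ∃ (v : Fin n → V) (α : Fin n → F), (∀ k, α k ≠ 0) ∧
        ∀ k l, H (v k) (v l) = if k = l then algebraMap F E (α k) else 0 := by
  have h2' : (2 : E) ≠ 0 := by
    have := (map_ne_zero (algebraMap F E)).mpr h2
    rwa [map_ofNat] at this
  induction n with
  | zero => exact fun V _ _ H _ _ _ => ⟨Fin.elim0, Fin.elim0, fun k => k.elim0, fun k => k.elim0⟩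
  | succ n ih =>
    intro V _ _ H hH hH' hV
    have : FiniteDimensional E V := Module.finite_of_finrank_eq_succ hV
    have hx : ∃ x, H x x ≠ 0 := by
      -- Polarization: if all `H z z` vanish, the vectors `x + y` and `x + i y` give `H x y + H y x
      -- = 0` and `H x y - H y x = 0`, so the form is zero.
      by_contra! hc
      have h3 : ∀ x y, H x y = 0 := by
        intro x y
        have e1 := hc (x + y)
        have e2 := hc (x + i • y)
        simp only [map_add, LinearMap.add_apply, hc, LinearMap.map_smulₛₗ, LinearMap.smul_apply,
          map_smul, smul_eq_mul, RingHom.coe_coe, hi'] at e1 e2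
        have e3 : (2 * i) * H x y = 0 := by linear_combination e2 + i * e1
        exact (mul_eq_zero.mp e3).resolve_left (mul_ne_zero h2' hi)
      have h4 : ∀ x : V, x = 0 := fun x => hH' x (h3 x)
      have : Subsingleton V := ⟨fun x y => (h4 x).trans (h4 y).symm⟩
      rw [Module.finrank_zero_of_subsingleton] at hV
      exact absurd hV (Nat.succ_ne_zero n).symm
    obtain ⟨x, hx⟩ := hx
    obtain ⟨a, ha⟩ := exists_algebraMap_of_fixed h2 hi hi' (hH x x).symm
    have ha0 : a ≠ 0 := by
      rintro rfl
      exact hx (by rw [← ha, map_zero])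
    let U : Submodule E V := LinearMap.ker (H x)
    have hU : Module.finrank E U = n := by
      have h3 : H x ≠ 0 := fun h => hx (by rw [h, LinearMap.zero_apply])
      have := Module.Dual.finrank_ker_add_one_of_ne_zero (f := H x) h3
      rw [hV] at this
      exact Nat.succ_injective this
    obtain ⟨v, α, hα, hv⟩ := ih U (H.domRestrict₁₂ U U) (fun y z => hH y z) (by
      intro y hy
      refine Subtype.ext (hH' y fun z => ?_)
      -- Nondegeneracy on the complement is tested against the orthogonal projection of an arbitrary
      -- `z`.
      have h3 : z - (H x z / H x x) • x ∈ U := by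
        rw [LinearMap.mem_ker, map_sub, map_smul, smul_eq_mul, div_mul_cancel₀ _ hx, sub_self]
      have h4 : H y (z - (H x z / H x x) • x) = 0 := hy ⟨_, h3⟩
      have h5 : H y x = 0 := by
        rw [hH, LinearMap.mem_ker.mp y.2, map_zero]
      rwa [map_sub, map_smul, h5, smul_zero, sub_zero] at h4) hU
    refine ⟨Fin.cons x fun k => (v k : V), Fin.cons a α, ?_, ?_⟩
    · intro k
      refine Fin.cases ?_ (fun k => ?_) k
      · exact ha0
      · exact hα k
    · intro k l
      have h3 : ∀ k, H x (v k) = 0 := fun k => (v k).2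
      refine Fin.cases ?_ (fun k => ?_) k <;> refine Fin.cases ?_ (fun l => ?_) l
      · simp [ha]
      · simp [h3, (Fin.succ_ne_zero _).symm]
      · simp only [Fin.cons_succ, Fin.cons_zero]
        rw [hH, h3, map_zero, if_neg (Fin.succ_ne_zero k)]
      · simp only [Fin.cons_succ, Fin.succ_inj]
        exact hv k l

end OrthogonalBasis

/-! ### An orthogonal basis of `V` and the forms on `⋀² V` in the induced basis -/

section OrthoBasis

variable {F : Type u} [Field F] {E : Type v} [Field E] [Algebra F E] {ρ : E ≃ₐ[F] E}

/-- An orthogonal basis of a `4`-dimensional hermitian space. -/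
structure OrthoBasis {V : Type w} [AddCommGroup V] [Module E V]
    (H : V →ₛₗ[(ρ : E →+* E)] V →ₗ[E] E) where
  basis : Module.Basis (Fin 4) E V
  coeff : Fin 4 → F
  coeff_ne_zero : ∀ k, coeff k ≠ 0
  gram : ∀ k l, H (basis k) (basis l) = if k = l then algebraMap F E (coeff k) else 0

variable {V : Type w} [AddCommGroup V] [Module E V] {H : V →ₛₗ[(ρ : E →+* E)] V →ₗ[E] E}

/-- An orthogonal basis from a family of orthogonal vectors. -/
noncomputable def OrthoBasis.mk' (hV : Module.finrank E V = 4) (v : Fin 4 → V) (α : Fin 4 → F)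
    (hα : ∀ k, α k ≠ 0)
    (hv : ∀ k l, H (v k) (v l) = if k = l then algebraMap F E (α k) else 0) : OrthoBasis H where
  basis := basisOfLinearIndependentOfCardEqFinrank (b := v)
    (linearIndependent_of_orthogonal H v (fun k l hkl => by rw [hv, if_neg hkl])
      (fun k => by rw [hv, if_pos rfl]; exact (map_ne_zero _).mpr (hα k)))
    (by rw [hV, Fintype.card_fin])
  coeff := α
  coeff_ne_zero := hα
  gram := by
    rw [coe_basisOfLinearIndependentOfCardEqFinrank]
    exact hv

theorem OrthoBasis.mk'_basis (hV : Module.finrank E V = 4) (v : Fin 4 → V) (α : Fin 4 → F)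
    (hα : ∀ k, α k ≠ 0)
    (hv : ∀ k l, H (v k) (v l) = if k = l then algebraMap F E (α k) else 0) :
    ⇑(OrthoBasis.mk' hV v α hα hv).basis = v :=
  coe_basisOfLinearIndependentOfCardEqFinrank _ (by rw [hV, Fintype.card_fin])

namespace OrthoBasis

variable (b : OrthoBasis H)

theorem apply_basis (k : Fin 4) (x : V) :
    H (b.basis k) x = algebraMap F E (b.coeff k) * b.basis.repr x k := by
  conv_lhs => rw [← b.basis.sum_repr x]
  rw [map_sum, Finset.sum_eq_single k, map_smul, b.gram, if_pos rfl, smul_eq_mul, mul_comm]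
  · intro l _ hl
    rw [map_smul, b.gram, if_neg hl.symm, smul_zero]
  · simp

include b in
theorem finrank_eq : Module.finrank E V = 4 := by
  rw [Module.finrank_eq_card_basis b.basis, Fintype.card_fin]

theorem hermPow_basis (I : Fin 6) (x y : V) :
    hermPow 2 H (exteriorPower.ιMulti E 2 ![b.basis (pairFst I), b.basis (pairSnd I)])
      (exteriorPower.ιMulti E 2 ![x, y]) =
    algebraMap F E (b.coeff (pairFst I) * b.coeff (pairSnd I)) *
      plucker (b.basis.repr x) (b.basis.repr y) I := by
  rw [hermPow_ιMulti, Matrix.det_fin_two]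
  simp only [Matrix.of_apply, Matrix.cons_val_zero, Matrix.cons_val_one,
    b.apply_basis, plucker, map_mul]
  ring

theorem plucker_repr (I J : Fin 6) :
    plucker (b.basis.repr (b.basis (pairFst J))) (b.basis.repr (b.basis (pairSnd J))) I =
      if I = J then 1 else 0 := by
  simp only [plucker, b.basis.repr_self, Finsupp.single_apply]
  revert I J
  have h1 : ∀ I J : Fin 6, I ≠ J → ((pairFst J = pairFst I ∧ pairSnd J = pairSnd I) → False) ∧
      ((pairFst J = pairSnd I ∧ pairSnd J = pairFst I) → False) := by decide
  have h2 : ∀ I : Fin 6, pairSnd I ≠ pairFst I := by decide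
  intro I J
  by_cases hIJ : I = J
  · subst hIJ
    simp [h2 I]
  · rw [if_neg hIJ]
    obtain ⟨h3, h4⟩ := h1 I J hIJ
    have h5 : (if pairFst J = pairFst I then (1 : E) else 0) *
        (if pairSnd J = pairSnd I then 1 else 0) = 0 := by
      by_cases e : pairFst J = pairFst I
      · rw [if_neg fun e' => h3 ⟨e, e'⟩, mul_zero]
      · rw [if_neg e, zero_mul]
    have h6 : (if pairFst J = pairSnd I then (1 : E) else 0) *
        (if pairSnd J = pairFst I then 1 else 0) = 0 := by
      by_cases e : pairFst J = pairSnd I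
      · rw [if_neg fun e' => h4 ⟨e, e'⟩, mul_zero]
      · rw [if_neg e, zero_mul]
    rw [h5, h6, sub_zero]

/-- The induced basis of `⋀² V`. -/
noncomputable def basis₂ : Module.Basis (Fin 6) E (⋀[E]^2 V) :=
  basisOfLinearIndependentOfCardEqFinrank
    (b := fun I => exteriorPower.ιMulti E 2 ![b.basis (pairFst I), b.basis (pairSnd I)])
    (linearIndependent_of_orthogonal (hermPow 2 H) _
      (fun I J hIJ => by rw [hermPow_basis, plucker_repr, if_neg hIJ, mul_zero])
      (fun I => by
        rw [hermPow_basis, plucker_repr, if_pos rfl, mul_one]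
        exact (map_ne_zero _).mpr (mul_ne_zero (b.coeff_ne_zero _) (b.coeff_ne_zero _))))
    (by
      have : Module.Finite E V := Module.Finite.of_basis b.basis
      rw [exteriorPower.finrank_eq, b.finrank_eq, Fintype.card_fin]
      rfl)

theorem basis₂_apply (I : Fin 6) : b.basis₂ I =
    exteriorPower.ιMulti E 2 ![b.basis (pairFst I), b.basis (pairSnd I)] := by
  rw [basis₂, coe_basisOfLinearIndependentOfCardEqFinrank]

/-- The coefficients of the form on `⋀² V`. -/
def coeff₂ (I : Fin 6) : F := b.coeff (pairFst I) * b.coeff (pairSnd I)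

theorem coeff₂_ne_zero (I : Fin 6) : algebraMap F E (b.coeff₂ I) ≠ 0 :=
  (map_ne_zero _).mpr (mul_ne_zero (b.coeff_ne_zero _) (b.coeff_ne_zero _))

theorem hermPow_basis₂ (I : Fin 6) (x : ⋀[E]^2 V) :
    hermPow 2 H (b.basis₂ I) x = algebraMap F E (b.coeff₂ I) * b.basis₂.repr x I := by
  conv_lhs => rw [← b.basis₂.sum_repr x]
  rw [map_sum, Finset.sum_eq_single I, map_smul, smul_eq_mul, mul_comm]
  · rw [b.basis₂_apply, hermPow_basis, plucker_repr, if_pos rfl, mul_one]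
    rfl
  · intro J _ hJ
    rw [map_smul, b.basis₂_apply, b.basis₂_apply, hermPow_basis, plucker_repr, if_neg hJ.symm,
      mul_zero, smul_zero]
  · simp

theorem repr_ιMulti (x y : V) (I : Fin 6) :
    b.basis₂.repr (exteriorPower.ιMulti E 2 ![x, y]) I =
      plucker (b.basis.repr x) (b.basis.repr y) I := by
  have h1 := b.hermPow_basis₂ I (exteriorPower.ιMulti E 2 ![x, y])
  rw [b.basis₂_apply, hermPow_basis] at h1
  exact (mul_left_cancel₀ (b.coeff₂_ne_zero I) h1).symm

theorem hermPow_eq_sum (x y : ⋀[E]^2 V) : hermPow 2 H x y =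
    ∑ I, algebraMap F E (b.coeff₂ I) * ρ (b.basis₂.repr x I) * b.basis₂.repr y I := by
  conv_lhs => rw [← b.basis₂.sum_repr x]
  rw [map_sum, LinearMap.sum_apply]
  refine Finset.sum_congr rfl fun I _ => ?_
  rw [LinearMap.map_smulₛₗ, LinearMap.smul_apply, hermPow_basis₂, smul_eq_mul, RingHom.coe_coe]
  ring

variable (d : (⋀[E]^4 V) ≃ₗ[E] E)

/-- The value of `d` on `e₀ ∧ e₁ ∧ e₂ ∧ e₃`. -/
noncomputable def disc : E := d (exteriorPower.ιMulti E 4 b.basis)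

theorem hermPow_four : hermPow 4 H (exteriorPower.ιMulti E 4 b.basis)
    (exteriorPower.ιMulti E 4 b.basis) = algebraMap F E (∏ k, b.coeff k) := by
  rw [hermPow_ιMulti, map_prod, ← Matrix.det_diagonal]
  congr 1
  ext k l
  rw [Matrix.of_apply, b.gram, Matrix.diagonal_apply]

theorem disc_ne_zero : b.disc d ≠ 0 := by
  intro h
  have h1 : exteriorPower.ιMulti E 4 b.basis = 0 := d.map_eq_zero_iff.mp h
  have h2 := b.hermPow_four
  rw [h1, map_zero] at h2
  exact (map_ne_zero (algebraMap F E)).mpr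
    (Finset.prod_ne_zero_iff.mpr fun k _ => b.coeff_ne_zero k) h2.symm

/-- Alternating `4`-forms on `V` are multiples of the determinant in the basis, the multiple being
`disc`. On decomposable vectors the formula is therefore `wedgeGram_plucker`, and bilinearity
extends it. -/
theorem psi_apply (x y : ⋀[E]^2 V) : psi d x y =
    b.disc d * (b.basis₂.repr x ⬝ᵥ (wedgeGram E).mulVec (b.basis₂.repr y)) := by
  have key : ∀ x y z t : V, psi d (exteriorPower.ιMulti E 2 ![x, y])
      (exteriorPower.ιMulti E 2 ![z, t]) = b.disc d *
      (plucker (b.basis.repr x) (b.basis.repr y) ⬝ᵥ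
        (wedgeGram E).mulVec (plucker (b.basis.repr z) (b.basis.repr t))) := by
    intro x y z t
    have h1 : wedgeProd (exteriorPower.ιMulti E 2 ![x, y]) (exteriorPower.ιMulti E 2 ![z, t]) =
        exteriorPower.ιMulti E 4 ![x, y, z, t] := by
      apply Subtype.ext
      change ((exteriorPower.ιMulti E 2 ![x, y] : ⋀[E]^2 V) : ExteriorAlgebra E V) *
        (exteriorPower.ιMulti E 2 ![z, t] : ⋀[E]^2 V) = _
      simp [ExteriorAlgebra.ιMulti_apply, mul_assoc]
    have h2 := AlternatingMap.eq_smul_basis_det (e := b.basis)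
      (d.toLinearMap.compAlternatingMap (exteriorPower.ιMulti E 4))
    have h3 := congrArg (fun f : V [⋀^Fin 4]→ₗ[E] E => f ![x, y, z, t]) h2
    change d (wedgeProd _ _) = _
    rw [h1, wedgeGram_plucker]
    refine h3.trans ?_
    rw [AlternatingMap.smul_apply, Module.Basis.det_apply, smul_eq_mul, ← Matrix.det_transpose]
    congr 2
    ext k l
    fin_cases k <;> rfl
  suffices h : psi d = b.disc d • LinearMap.mk₂ E (fun x y : ⋀[E]^2 V =>
      (b.basis₂.repr x ⬝ᵥ (wedgeGram E).mulVec (b.basis₂.repr y)))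
      (fun x x' y => by simp [add_dotProduct]) (fun c x y => by simp [smul_dotProduct])
      (fun x y y' => by simp [Matrix.mulVec_add, dotProduct_add])
      (fun c x y => by simp [Matrix.mulVec_smul]) by
    rw [h]
    rfl
  refine b.basis₂.ext fun I => b.basis₂.ext fun J => ?_
  rw [b.basis₂_apply, b.basis₂_apply, key, LinearMap.smul_apply, LinearMap.smul_apply,
    LinearMap.mk₂_apply, smul_eq_mul]
  congr 2
  · exact funext fun K => (b.repr_ιMulti _ _ K).symm
  · exact congrArg _ (funext fun K => (b.repr_ιMulti _ _ K).symm)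

end OrthoBasis

end OrthoBasis

/-! ### Existence of orthogonal and adapted bases -/

section OrthoBasisExistence

variable {F : Type u} [Field F] {E : Type v} [Field E] [Algebra F E]
  [Algebra.IsQuadraticExtension F E] {ρ : E ≃ₐ[F] E} {i : E}
  {V : Type w} [AddCommGroup V] [Module E V] {H : V →ₛₗ[(ρ : E →+* E)] V →ₗ[E] E}

theorem nonempty_orthoBasis (h2 : (2 : F) ≠ 0) (hi : i ≠ 0) (hi' : ρ i = -i)
    (hV : Module.finrank E V = 4) (hH : ∀ x y, H x y = ρ (H y x))
    (hH' : ∀ x, (∀ y, H x y = 0) → x = 0) : Nonempty (OrthoBasis H) := by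
  obtain ⟨v, α, hα, hv⟩ := exists_orthogonal h2 hi hi' 4 V H hH hH' hV
  exact ⟨OrthoBasis.mk' hV v α hα hv⟩

/-- An orthogonal basis adapted to an orthogonal decomposition. -/
theorem exists_orthoBasis_of_isCompl (h2 : (2 : F) ≠ 0) (hi : i ≠ 0) (hi' : ρ i = -i)
    (hV : Module.finrank E V = 4) (hH : ∀ x y, H x y = ρ (H y x))
    (hH' : ∀ x, (∀ y, H x y = 0) → x = 0) {V₁ V₂ : Submodule E V}
    (h₁ : Module.finrank E V₁ = 2) (h₂ : Module.finrank E V₂ = 2) (hc : IsCompl V₁ V₂)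
    (ho : ∀ x ∈ V₁, ∀ y ∈ V₂, H x y = 0) :
    ∃ b : OrthoBasis H, (∀ x, x ∈ V₁ ↔ b.basis.repr x 2 = 0 ∧ b.basis.repr x 3 = 0) ∧
      ∀ x, x ∈ V₂ ↔ b.basis.repr x 0 = 0 ∧ b.basis.repr x 1 = 0 := by
  have ho' : ∀ x ∈ V₂, ∀ y ∈ V₁, H x y = 0 := fun x hx y hy => by
    rw [hH, ho y hy x hx, map_zero]
  have hdec : ∀ x, ∃ y ∈ V₁, ∃ z ∈ V₂, y + z = x := fun x =>
    Submodule.mem_sup.mp (hc.sup_eq_top ▸ Submodule.mem_top)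
  obtain ⟨v, α, hα, hv⟩ := exists_orthogonal h2 hi hi' 2 V₁ (H.domRestrict₁₂ V₁ V₁)
    (fun y z => hH y z) (by
      intro y hy
      refine Subtype.ext (hH' y fun z => ?_)
      obtain ⟨z₁, hz₁, z₂, hz₂, rfl⟩ := hdec z
      have h3 : H y z₁ = 0 := hy ⟨z₁, hz₁⟩
      rw [map_add, h3, ho y y.2 z₂ hz₂, add_zero]) h₁
  obtain ⟨v', α', hα', hv'⟩ := exists_orthogonal h2 hi hi' 2 V₂ (H.domRestrict₁₂ V₂ V₂)
    (fun y z => hH y z) (by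
      intro y hy
      refine Subtype.ext (hH' y fun z => ?_)
      obtain ⟨z₁, hz₁, z₂, hz₂, rfl⟩ := hdec z
      have h3 : H y z₂ = 0 := hy ⟨z₂, hz₂⟩
      rw [map_add, h3, ho' y y.2 z₁ hz₁, zero_add]) h₂
  have e1 : ∀ k l, H (v k : V) (v l) = if k = l then algebraMap F E (α k) else 0 := hv
  have e2 : ∀ k l, H (v' k : V) (v' l) = if k = l then algebraMap F E (α' k) else 0 := hv'
  have e3 : ∀ k l, H (v k : V) (v' l) = 0 := fun k l => ho _ (v k).2 _ (v' l).2
  have e4 : ∀ k l, H (v' k : V) (v l) = 0 := fun k l => ho' _ (v' k).2 _ (v l).2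
  let b : OrthoBasis H := OrthoBasis.mk' hV ![v 0, v 1, v' 0, v' 1] ![α 0, α 1, α' 0, α' 1]
    (by intro k; fin_cases k <;> simp [hα, hα'])
    (by intro k l; fin_cases k <;> fin_cases l <;> simp [e1, e2, e3, e4])
  have hb : ⇑b.basis = ![(v 0 : V), v 1, v' 0, v' 1] :=
    OrthoBasis.mk'_basis hV _ _ _ _
  have hz : ∀ x k, b.basis.repr x k = 0 ↔ H (b.basis k) x = 0 := by
    intro x k
    rw [b.apply_basis, mul_eq_zero, or_iff_right ((map_ne_zero _).mpr (b.coeff_ne_zero k))]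
  refine ⟨b, fun x => ⟨fun hx => ?_, fun hx => ?_⟩, fun x => ⟨fun hx => ?_, fun hx => ?_⟩⟩
  · rw [hz, hz, hb]
    exact ⟨ho' _ (v' 0).2 x hx, ho' _ (v' 1).2 x hx⟩
  · rw [← b.basis.sum_repr x, Fin.sum_univ_four, hx.1, hx.2, hb]
    simpa using V₁.add_mem (V₁.smul_mem _ (v 0).2) (V₁.smul_mem _ (v 1).2)
  · rw [hz, hz, hb]
    exact ⟨ho _ (v 0).2 x hx, ho _ (v 1).2 x hx⟩
  · rw [← b.basis.sum_repr x, Fin.sum_univ_four, hx.1, hx.2, hb]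
    simpa using V₂.add_mem (V₂.smul_mem _ (v' 0).2) (V₂.smul_mem _ (v' 1).2)

end OrthoBasisExistence

/-! ### The operator `L` and the `B`-space `⋀² V` -/

section OperatorL

variable {F : Type u} [Field F] {E : Type v} [Field E] [Algebra F E] {ρ : E ≃ₐ[F] E}
  {V : Type w} [AddCommGroup V] [Module E V] {H : V →ₛₗ[(ρ : E →+* E)] V →ₗ[E] E}

namespace OrthoBasis

variable (b : OrthoBasis H) (d : (⋀[E]^4 V) ≃ₗ[E] E)

include b in
-- The Gram matrix of the wedge product is its own inverse.
theorem psi_bijective : Function.Bijective (psi d) := by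
  have hfin : Module.Finite E (⋀[E]^2 V) := Module.Finite.of_basis b.basis₂
  have hinj : Function.Injective (psi d) := by
    rw [← LinearMap.ker_eq_bot, LinearMap.ker_eq_bot']
    intro x hx
    have h1 : ∀ J, b.basis₂.repr x ⬝ᵥ (wedgeGram E).mulVec (b.basis₂.repr (b.basis₂ J)) = 0 := by
      intro J
      have h2 := congrArg (fun f : Module.Dual E (⋀[E]^2 V) => f (b.basis₂ J)) hx
      simp only [b.psi_apply, LinearMap.zero_apply] at h2
      exact (mul_eq_zero.mp h2).resolve_left (b.disc_ne_zero d)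
    have h3 : Matrix.vecMul (b.basis₂.repr x) (wedgeGram E) = 0 := by
      ext J
      have h4 := h1 J
      rw [Matrix.dotProduct_mulVec, b.basis₂.repr_self, Finsupp.single_eq_pi_single,
        dotProduct_single, mul_one] at h4
      exact h4
    have h5 := congrArg (fun y => Matrix.vecMul y (wedgeGram E)) h3
    simp only [Matrix.vecMul_vecMul, wedgeGram_mul_self, Matrix.vecMul_one,
      Matrix.zero_vecMul] at h5
    exact (LinearEquiv.map_eq_zero_iff _).mp (DFunLike.coe_injective h5)
  exact ⟨hinj, (LinearMap.injective_iff_surjective_of_finrank_eq_finrank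
    Subspace.dual_finrank_eq.symm).mp hinj⟩

variable (hψ : Function.Bijective (psi d))

omit [Algebra F E] in
-- This adjunction characterizes `L`; later arguments use it in place of the definition through
-- `ψ⁻¹`.
theorem _root_.ExcIso.psi_opL {ρ : E →+* E} {H : V →ₛₗ[ρ] V →ₗ[E] E}
    (d : (⋀[E]^4 V) ≃ₗ[E] E) (hψ : Function.Bijective (psi d)) (x y : ⋀[E]^2 V) :
    psi d (opL H d hψ x) y = hermPow 2 H x y := by
  have h1 : LinearEquiv.ofBijective (psi d) hψ (opL H d hψ x) = hermPow 2 H x :=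
    LinearEquiv.apply_symm_apply _ _
  exact congrArg (fun f : Module.Dual E (⋀[E]^2 V) => f y) h1

theorem hermPow_eq_dotProduct (x y : ⋀[E]^2 V) : hermPow 2 H x y =
    (fun I => ρ (b.basis₂.repr x I)) ⬝ᵥ
      (compound (diagR E b.coeff)).mulVec (b.basis₂.repr y) := by
  rw [b.hermPow_eq_sum, compound_diagR, dotProduct]
  refine Finset.sum_congr rfl fun I _ => ?_
  rw [diagR, Matrix.mulVec_diagonal]
  change algebraMap F E (b.coeff (pairFst I) * b.coeff (pairSnd I)) * _ * _ = _
  ring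

/-- In `psi_opL` both forms are known in coordinates; comparing coefficients and inverting the
self-inverse `wedgeGram` gives the matrix of `L`. -/
theorem repr_opL (x : ⋀[E]^2 V) : ⇑(b.basis₂.repr (opL H d hψ x)) =
    (opMat b.coeff (b.disc d)⁻¹).mulVec fun I => ρ (b.basis₂.repr x I) := by
  have h1 : ∀ y, b.disc d * (b.basis₂.repr (opL H d hψ x) ⬝ᵥ
      (wedgeGram E).mulVec (b.basis₂.repr y)) =
      (fun I => ρ (b.basis₂.repr x I)) ⬝ᵥ
      (compound (diagR E b.coeff)).mulVec (b.basis₂.repr y) := by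
    intro y
    rw [← b.psi_apply, psi_opL, b.hermPow_eq_dotProduct]
  have h2 : b.disc d • Matrix.vecMul (b.basis₂.repr (opL H d hψ x)) (wedgeGram E) =
      Matrix.vecMul (fun I => ρ (b.basis₂.repr x I)) (compound (diagR E b.coeff)) := by
    ext J
    have h3 := h1 (b.basis₂ J)
    rw [Matrix.dotProduct_mulVec, Matrix.dotProduct_mulVec, b.basis₂.repr_self,
      Finsupp.single_eq_pi_single, dotProduct_single, dotProduct_single, mul_one, mul_one] at h3
    exact h3
  have h4 := congrArg (fun y => (b.disc d)⁻¹ • Matrix.vecMul y (wedgeGram E)) h2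
  simp only [Matrix.smul_vecMul, smul_smul, inv_mul_cancel₀ (b.disc_ne_zero d), one_smul,
    Matrix.vecMul_vecMul, wedgeGram_mul_self, Matrix.vecMul_one] at h4
  rw [h4, opMat, Matrix.smul_mulVec, ← Matrix.vecMul_transpose, Matrix.transpose_mul,
    wedgeGram_transpose, compound_diagR_transpose]

/-- The scalar `J`. -/
theorem vol_eq : vol H d =
    (b.disc d)⁻¹ * ρ (b.disc d)⁻¹ * algebraMap F E (∏ k, b.coeff k) := by
  have h1 : d.symm 1 = (b.disc d)⁻¹ • exteriorPower.ιMulti E 4 b.basis := by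
    refine d.injective ?_
    rw [LinearEquiv.apply_symm_apply, map_smul, smul_eq_mul]
    exact (inv_mul_cancel₀ (b.disc_ne_zero d)).symm
  rw [vol, h1, map_smul, LinearMap.map_smulₛₗ, LinearMap.smul_apply, b.hermPow_four, smul_eq_mul,
    smul_eq_mul, RingHom.coe_coe]
  ring

end OrthoBasis

/-- `compound_gram` applied to the symmetric matrix `D` gives `⋀²D G ⋀²D = det D • G`, so `G ⋀²D`
squares to the scalar `det D`. -/
theorem opMat_mul_map {R A : Type*} [CommRing R] [CommRing A] [Algebra R A] (σ : A ≃ₐ[R] A)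
    (α : Fin 4 → R) (δ : A) : opMat α δ * (opMat α δ).map σ =
      (δ * σ δ * algebraMap R A (∏ k, α k)) • (1 : Matrix (Fin 6) (Fin 6) A) := by
  have h1 : (opMat α δ).map σ = σ δ • (wedgeGram A * compound (diagR A α)) := by
    have h2 : (wedgeGram A * compound (diagR A α)).map σ = wedgeGram A * compound (diagR A α) := by
      rw [Matrix.map_mul]
      have h3 := compound_map (σ : A →+* A) (diagR A α)
      have h4 := wedgeGram_map (σ : A →+* A)
      have h5 : (diagR A α).map (σ : A →+* A) = diagR A α := diagR_map σ α
      rw [h5] at h3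
      exact congrArg₂ _ h4 h3.symm
    ext I J
    have h3 := congrFun (congrFun h2 I) J
    rw [Matrix.map_apply] at h3
    rw [opMat, Matrix.map_apply, Matrix.smul_apply, smul_eq_mul, map_mul, h3]
    rfl
  have h6 := compound_gram (diagR A α)
  rw [compound_diagR_transpose] at h6
  have h7 : Matrix.det (diagR A α) = algebraMap R A (∏ k, α k) := by
    rw [diagR, Matrix.det_diagonal, map_prod]
  rw [h1, opMat, Matrix.mul_smul, Matrix.smul_mul, smul_smul, Matrix.mul_assoc,
    ← Matrix.mul_assoc (compound _), h6, Matrix.mul_smul, wedgeGram_mul_self, smul_smul, h7]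
  congr 1
  ring

theorem OrthoBasis.opL_opL (b : OrthoBasis H) (hρ : ∀ e, ρ (ρ e) = e)
    (d : (⋀[E]^4 V) ≃ₗ[E] E) (hψ : Function.Bijective (psi d)) (x : ⋀[E]^2 V) :
    opL H d hψ (opL H d hψ x) = vol H d • x := by
  refine b.basis₂.repr.injective (DFunLike.coe_injective ?_)
  rw [b.repr_opL, b.repr_opL]
  have h1 : (fun I => ρ ((opMat b.coeff (b.disc d)⁻¹).mulVec
      (fun I => ρ (b.basis₂.repr x I)) I)) =
      ((opMat b.coeff (b.disc d)⁻¹).map ρ).mulVec (b.basis₂.repr x) := by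
    ext I
    simp [Matrix.mulVec, dotProduct, hρ]
  rw [h1, Matrix.mulVec_mulVec, opMat_mul_map ρ, Matrix.smul_mulVec, Matrix.one_mulVec,
    ← b.vol_eq, map_smul, Finsupp.coe_smul]

end OperatorL

/-! ### `B` is a quaternion algebra -/

section QuaternionSpace

variable {F : Type u} [Field F] {E : Type v} [Field E] [Algebra F E]
  [Algebra.IsQuadraticExtension F E] {ρ : E ≃ₐ[F] E} {i : E} {J : F}

namespace QuatAlg

theorem isUnit_of_fst_eq_zero (hJ : J ≠ 0) {x : QuatAlg ρ J} (h : x.fst = 0) (hx : x.snd ≠ 0) :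
    IsUnit x := by
  have hJ' : algebraMap F E J ≠ 0 := (map_ne_zero _).mpr hJ
  have hr : ρ x.snd ≠ 0 := (map_ne_zero ρ).mpr hx
  have h1 : x * ⟨0, (algebraMap F E J * ρ x.snd)⁻¹⟩ = 1 := by
    ext
    · simp [h]
      field_simp
    · simp [h]
  have h2 : (⟨0, (algebraMap F E J * ρ x.snd)⁻¹⟩ : QuatAlg ρ J) * x = 1 := by
    ext
    · simp [h, invol]
      field_simp
    · simp [h]
  exact ⟨⟨x, _, h1, h2⟩, rfl⟩

theorem isUnit_of_snd_eq_zero {x : QuatAlg ρ J} (h : x.snd = 0) (hx : x.fst ≠ 0) :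
    IsUnit x := by
  have h1 : x * ⟨x.fst⁻¹, 0⟩ = 1 := by ext <;> simp [h, hx]
  have h2 : (⟨x.fst⁻¹, 0⟩ : QuatAlg ρ J) * x = 1 := by ext <;> simp [h, hx]
  exact ⟨⟨x, _, h1, h2⟩, rfl⟩

/-- The commutator with `i` removes the `E`-part of an element and multiplies its `𝐣`-part by `-2
i`. Hence every nonzero ideal contains an element with a single nonzero coordinate, and such
elements are units. -/
theorem isSimpleRing (h2 : (2 : F) ≠ 0) (hJ : J ≠ 0) (hi : i ≠ 0) (hi' : ρ i = -i) :
    IsSimpleRing (QuatAlg ρ J) := by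
  have h2' : (2 : E) ≠ 0 := by
    have := (map_ne_zero (algebraMap F E)).mpr h2
    rwa [map_ofNat] at this
  have : Nontrivial (QuatAlg ρ J) := ⟨0, 1, fun h => zero_ne_one (congrArg QuatAlg.fst h)⟩
  refine ⟨⟨fun I => ?_⟩⟩
  rw [or_iff_not_imp_left]
  intro hI
  rw [← TwoSidedIdeal.one_mem_iff]
  have hu : ∃ x ∈ I, IsUnit x := by
    obtain ⟨x, hx, hx0⟩ : ∃ x ∈ I, x ≠ 0 := by
      by_contra! hc
      exact hI (le_antisymm (fun x hx => by simpa using hc x hx) bot_le)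
    by_cases hb : x.snd = 0
    · refine ⟨x, hx, isUnit_of_snd_eq_zero hb fun ha => hx0 (QuatAlg.ext ha hb)⟩
    · refine ⟨⟨i, 0⟩ * x - x * ⟨i, 0⟩, I.sub_mem (I.mul_mem_left _ _ hx) (I.mul_mem_right _ _ hx),
        isUnit_of_fst_eq_zero hJ ?_ ?_⟩
      · simp [mul_comm]
      · have h3 : (⟨i, 0⟩ * x - x * ⟨i, 0⟩ : QuatAlg ρ J).snd = -(2 * i * x.snd) := by
          simp [hi']
          ring
        rw [h3]
        exact neg_ne_zero.mpr (mul_ne_zero (mul_ne_zero h2' hi) hb)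
  obtain ⟨x, hx, u, rfl⟩ := hu
  have h4 := I.mul_mem_left (↑u⁻¹ : QuatAlg ρ J) _ hx
  rwa [Units.inv_mul] at h4

/-- Commuting with `i` kills the `𝐣`-part; commuting with `𝐣` puts the `E`-part in the fixed field
of `ρ`. -/
theorem isCentral (h2 : (2 : F) ≠ 0) (hi : i ≠ 0) (hi' : ρ i = -i) :
    Algebra.IsCentral F (QuatAlg ρ J) := by
  have h2' : (2 : E) ≠ 0 := by
    have := (map_ne_zero (algebraMap F E)).mpr h2
    rwa [map_ofNat] at this
  constructor
  intro x hx
  rw [Subalgebra.mem_center_iff] at hx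
  have h3 := congrArg QuatAlg.snd (hx ⟨i, 0⟩)
  have h4 := congrArg QuatAlg.snd (hx ⟨0, 1⟩)
  simp [hi'] at h3 h4
  have h5 : x.snd = 0 := by
    have h6 : 2 * (i * x.snd) = 0 := by linear_combination -h3
    simpa [h2', hi] using h6
  obtain ⟨r, hr⟩ := exists_algebraMap_of_fixed h2 hi hi' h4.symm
  refine Algebra.mem_bot.mpr ⟨r, ?_⟩
  ext
  · simp [hr]
  · simp [h5]

theorem finrank_eq : Module.finrank F (QuatAlg ρ J) = 4 := by
  have : FiniteDimensional F E := Module.finite_of_finrank_pos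
    (by rw [Algebra.IsQuadraticExtension.finrank_eq_two F E]; exact two_pos)
  let e : QuatAlg ρ J ≃ₗ[F] E × E :=
    { toFun := toProd
      invFun := fun p => ⟨p.1, p.2⟩
      left_inv := fun _ => rfl
      right_inv := fun _ => rfl
      map_add' := fun _ _ => rfl
      map_smul' := fun _ _ => rfl }
  rw [e.finrank_eq, Module.finrank_prod, Algebra.IsQuadraticExtension.finrank_eq_two F E]

end QuatAlg

end QuaternionSpace

/-! ### The skew-hermitian form and the `B`-module structure -/

section QuaternionForm

variable {F : Type u} [Field F] {E : Type v} [Field E] [Algebra F E]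
  [Algebra.IsQuadraticExtension F E] {V : Type w} [AddCommGroup V] [Module E V] [Module F V]
  [IsScalarTower F E V] {ρ : E ≃ₐ[F] E} {H : V →ₛₗ[(ρ : E →+* E)] V →ₗ[E] E}
  {d : (⋀[E]^4 V) ≃ₗ[E] E} {hψ : Function.Bijective (psi d)} {J : F} {i : E}

omit [Module F V] [IsScalarTower F E V] in
theorem OrthoBasis.hermPow_symm (b : OrthoBasis H) (x y : ⋀[E]^2 V) :
    hermPow 2 H x y = ρ (hermPow 2 H y x) := by
  rw [b.hermPow_eq_sum, b.hermPow_eq_sum, map_sum]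
  refine Finset.sum_congr rfl fun I _ => ?_
  rw [map_mul, map_mul, AlgEquiv.commutes, QuatAlg.invol]
  ring

omit [Algebra.IsQuadraticExtension F E] [Module F V] [IsScalarTower F E V] in
theorem OrthoBasis.psi_symm (b : OrthoBasis H) (d : (⋀[E]^4 V) ≃ₗ[E] E) (x y : ⋀[E]^2 V) :
    psi d x y = psi d y x := by
  rw [b.psi_apply, b.psi_apply, Matrix.dotProduct_mulVec, dotProduct_comm, ← Matrix.mulVec_transpose,
    wedgeGram_transpose]

section

variable (hL : ∀ x, opL H d hψ (opL H d hψ x) = J • x)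

omit [Algebra.IsQuadraticExtension F E] in
include hL in
theorem hermPow_opL_left (x y : ⋀[E]^2 V) :
    hermPow 2 H (opL H d hψ x) y = algebraMap F E J * psi d x y := by
  rw [← psi_opL d hψ, hL, ← algebraMap_smul E J x, map_smul, LinearMap.smul_apply, smul_eq_mul]

include hL in
theorem hermPow_opL_right (b : OrthoBasis H) (x y : ⋀[E]^2 V) :
    hermPow 2 H x (opL H d hψ y) = algebraMap F E J * ρ (psi d x y) := by
  rw [b.hermPow_symm, hermPow_opL_left hL, map_mul, AlgEquiv.commutes, b.psi_symm]

include hL in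
-- The second coordinate of the form is the wedge pairing up to the factor `-i`. This replaces the
-- mixed expression with `L` by the two forms related by `psi_opL`.
theorem bForm_apply (hJ : J ≠ 0) (x y : ⋀[E]^2 V) :
    bForm H d hψ i J x y = ⟨i * hermPow 2 H x y, -(i * psi d x y)⟩ := by
  ext
  · rfl
  · change -(algebraMap F E J⁻¹ * (i * hermPow 2 H (opL H d hψ x) y)) = _
    rw [hermPow_opL_left hL, map_inv₀]
    have : algebraMap F E J ≠ 0 := (map_ne_zero _).mpr hJ
    field_simp

omit [Algebra.IsQuadraticExtension F E] in
theorem bAct_apply (c : QuatAlg ρ J) (x : ⋀[E]^2 V) :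
    bAct H d hψ J c x = c.fst • x + c.snd • opL H d hψ x := rfl

include hL in
-- Applying `L` to the arguments interchanges the hermitian and the wedge form up to `J` and
-- conjugation; the coordinates of both sides then agree term by term.
theorem bForm_bAct (hJ : J ≠ 0) (hi' : ρ i = -i) (b : OrthoBasis H) (x y : ⋀[E]^2 V)
    (c e : QuatAlg ρ J) :
    bForm H d hψ i J (bAct H d hψ J c x) (bAct H d hψ J e y) =
      c.conj * bForm H d hψ i J x y * e := by
  have h1 : psi d (opL H d hψ x) (opL H d hψ y) = algebraMap F E J * ρ (psi d x y) := by
    rw [psi_opL, hermPow_opL_right hL b]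
  have h2 : psi d x (opL H d hψ y) = ρ (hermPow 2 H x y) := by
    rw [b.psi_symm, psi_opL, b.hermPow_symm]
  rw [bForm_apply hL hJ, bForm_apply hL hJ, bAct_apply, bAct_apply]
  ext
  · simp only [map_add, LinearMap.add_apply, LinearMap.map_smulₛₗ, LinearMap.smul_apply,
      smul_eq_mul, map_smul, hermPow_opL_right hL b, hermPow_opL_left hL, psi_opL,
      QuatAlg.fst_mul, QuatAlg.snd_mul, QuatAlg.conj, map_mul, map_add, map_neg, hi', QuatAlg.invol, RingHom.coe_coe]
    ring
  · simp only [map_add, LinearMap.add_apply, LinearMap.smul_apply,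
      smul_eq_mul, map_smul, h1, h2, psi_opL, QuatAlg.fst_mul, QuatAlg.snd_mul, QuatAlg.conj, map_mul, map_add, map_neg, hi', AlgEquiv.commutes,
      QuatAlg.invol]
    ring

include hL in
theorem conj_bForm (hJ : J ≠ 0) (hi' : ρ i = -i) (b : OrthoBasis H) (x y : ⋀[E]^2 V) :
    (bForm H d hψ i J y x).conj = -bForm H d hψ i J x y := by
  rw [bForm_apply hL hJ, bForm_apply hL hJ]
  ext
  · simp only [QuatAlg.conj, QuatAlg.fst_neg, map_mul, hi', ← b.hermPow_symm]
    ring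
  · simp only [QuatAlg.conj, QuatAlg.snd_neg, b.psi_symm d y x]

include hL in
theorem bForm_nondegenerate (hJ : J ≠ 0) (hi : i ≠ 0) (x : ⋀[E]^2 V)
    (hx : ∀ y, bForm H d hψ i J x y = 0) : x = 0 := by
  refine hψ.1 (LinearMap.ext fun y => ?_)
  have h1 := congrArg QuatAlg.snd (hx y)
  rw [bForm_apply hL hJ] at h1
  rw [map_zero, LinearMap.zero_apply]
  simpa [hi] using h1

include hL in
/-- The module structure on `⋀² V` over the opposite of the quaternion algebra. -/
theorem exists_module (b : OrthoBasis H) :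
    ∃ _ : Module (QuatAlg ρ J)ᵐᵒᵖ (⋀[E]^2 V),
      (∀ (c : QuatAlg ρ J) (x : ⋀[E]^2 V), MulOpposite.op c • x = bAct H d hψ J c x) ∧
      Nonempty (Module.Basis (Fin 3) (QuatAlg ρ J)ᵐᵒᵖ (⋀[E]^2 V)) := by
  let M : Module (QuatAlg ρ J)ᵐᵒᵖ (⋀[E]^2 V) :=
    { smul := fun c x => bAct H d hψ J c.unop x
      one_smul := fun x => by
        change bAct H d hψ J 1 x = x
        rw [bAct_apply]
        simp
      mul_smul := fun c e x => by
        change bAct H d hψ J (e.unop * c.unop) x =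
          bAct H d hψ J c.unop (bAct H d hψ J e.unop x)
        simp only [bAct_apply, QuatAlg.fst_mul, QuatAlg.snd_mul, map_add, LinearMap.map_smulₛₗ,
          hL, RingHom.coe_coe, smul_smul, add_smul]
        module
      smul_zero := fun c => map_zero _
      smul_add := fun c x y => map_add _ x y
      add_smul := fun c e x => by
        change bAct H d hψ J (c.unop + e.unop) x = bAct H d hψ J c.unop x + bAct H d hψ J e.unop x
        simp only [bAct_apply, QuatAlg.fst_add, QuatAlg.snd_add]
        module
      zero_smul := fun x => by
        change bAct H d hψ J 0 x = 0
        rw [bAct_apply]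
        simp }
  refine ⟨M, fun c x => rfl, ?_⟩
  -- `L` carries the line of each basis vector to that of the complementary pair (`0 ↔ 5`, `1 ↔ 4`,
  -- `2 ↔ 3`). One vector from each pair gives a `B`-basis: the coordinate at `lo k` reads off the
  -- `E`-part of the coefficient, the one at `hi k` a nonzero multiple of its `𝐣`-part.
  let lo : Fin 3 → Fin 6 := ![0, 1, 2]
  let hi : Fin 3 → Fin 6 := ![5, 4, 3]
  let Λ := opMat b.coeff (b.disc d)⁻¹
  have hΛ : ∀ I k, Λ I (lo k) ≠ 0 ↔ I = hi k := by
    intro I k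
    have h0 : ∀ k, algebraMap F E (b.coeff k) ≠ 0 := fun k =>
      (map_ne_zero _).mpr (b.coeff_ne_zero k)
    have h1 := b.disc_ne_zero d
    fin_cases k <;> fin_cases I <;>
      simp [Λ, opMat_apply, lo, hi, wedgeGram, h0, h1]
  have hLb : ∀ I k, b.basis₂.repr (opL H d hψ (b.basis₂ (lo k))) I = Λ I (lo k) := by
    intro I k
    rw [b.repr_opL]
    have h1 : (fun I => ρ (b.basis₂.repr (b.basis₂ (lo k)) I)) = Pi.single (lo k) 1 := by
      ext I
      rw [b.basis₂.repr_self, Finsupp.single_eq_pi_single, Pi.single_apply]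
      split_ifs <;> simp
    rw [h1, Matrix.mulVec_single_one]
    rfl
  have hrepr : ∀ (c : Fin 3 → (QuatAlg ρ J)ᵐᵒᵖ) (I : Fin 6),
      b.basis₂.repr (∑ k, c k • b.basis₂ (lo k)) I =
      ∑ k, ((c k).unop.fst * (if lo k = I then 1 else 0) + (c k).unop.snd * Λ I (lo k)) := by
    intro c I
    rw [map_sum, Finsupp.finsetSum_apply]
    refine Finset.sum_congr rfl fun k _ => ?_
    change b.basis₂.repr (bAct H d hψ J (c k).unop (b.basis₂ (lo k))) I = _
    rw [bAct_apply, map_add, map_smul, map_smul, Finsupp.add_apply, Finsupp.smul_apply,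
      Finsupp.smul_apply, hLb, b.basis₂.repr_self, Finsupp.single_apply, smul_eq_mul, smul_eq_mul]
  have hlohi : ∀ k l, lo k ≠ hi l := by decide
  have hloinj : ∀ k l, lo k = lo l ↔ k = l := by decide
  have hhiinj : ∀ k l, hi k = hi l ↔ k = l := by decide
  have hcover : ∀ I, (∃ k, I = lo k) ∨ ∃ k, I = hi k := by decide
  have hΛ0 : ∀ I k, I ≠ hi k → Λ I (lo k) = 0 := fun I k h => by
    by_contra h'
    exact h ((hΛ I k).mp h')
  have hrlo : ∀ (c : Fin 3 → (QuatAlg ρ J)ᵐᵒᵖ) (k : Fin 3),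
      b.basis₂.repr (∑ k, c k • b.basis₂ (lo k)) (lo k) = (c k).unop.fst := by
    intro c k
    rw [hrepr, Finset.sum_eq_single k]
    · rw [if_pos rfl, hΛ0 _ _ (hlohi k k)]
      ring
    · intro l _ hl
      rw [if_neg (fun h => hl ((hloinj _ _).mp h)), hΛ0 _ _ (hlohi k l)]
      ring
    · simp
  have hrhi : ∀ (c : Fin 3 → (QuatAlg ρ J)ᵐᵒᵖ) (k : Fin 3),
      b.basis₂.repr (∑ k, c k • b.basis₂ (lo k)) (hi k) = (c k).unop.snd * Λ (hi k) (lo k) := by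
    intro c k
    rw [hrepr, Finset.sum_eq_single k]
    · rw [if_neg (hlohi k k)]
      ring
    · intro l _ hl
      rw [if_neg (hlohi l k), hΛ0 _ _ (fun h => hl ((hhiinj _ _).mp h).symm)]
      ring
    · simp
  refine ⟨Module.Basis.mk (v := fun k => b.basis₂ (lo k)) ?_ ?_⟩
  · rw [Fintype.linearIndependent_iff]
    intro c hc k
    have h1 := hrlo c k
    have h2 := hrhi c k
    rw [hc] at h1 h2
    refine MulOpposite.unop_injective (QuatAlg.ext ?_ ?_)
    · simpa using h1.symm
    · have h3 := h2.symm
      simp only [map_zero, Finsupp.coe_zero, Pi.zero_apply, mul_eq_zero] at h3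
      exact h3.resolve_right ((hΛ _ _).mpr rfl)
  · rintro x -
    let c : Fin 3 → (QuatAlg ρ J)ᵐᵒᵖ := fun k => MulOpposite.op
      ⟨b.basis₂.repr x (lo k), b.basis₂.repr x (hi k) * (Λ (hi k) (lo k))⁻¹⟩
    have h1 : x = ∑ k, c k • b.basis₂ (lo k) := by
      refine b.basis₂.repr.injective (Finsupp.ext fun I => ?_)
      rcases hcover I with ⟨k, rfl⟩ | ⟨k, rfl⟩
      · rw [hrlo]
        rfl
      · rw [hrhi]
        exact (inv_mul_cancel_right₀ ((hΛ _ _).mpr rfl) _).symm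
    rw [h1]
    exact Submodule.sum_mem _ fun k _ =>
      Submodule.smul_mem _ _ (Submodule.subset_span ⟨k, rfl⟩)

end

end QuaternionForm

/-! ### Extension of scalars in coordinates -/

section BaseChange

variable {F : Type u} [Field F] {E : Type v} [Field E] [Algebra F E] (ρ : E ≃ₐ[F] E)
  {W : Type w} [AddCommGroup W] [Module E W] [Module F W] [IsScalarTower F E W]
  {ι : Type*} [Fintype ι] [DecidableEq ι] (b : Module.Basis ι E W)
  {R : Type u} [CommRing R] [Algebra F R]

theorem conjR_tmul (r : R) (e : E) : conjR ρ R (r ⊗ₜ[F] e) = r ⊗ₜ[F] ρ e := rfl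

theorem conjR_refl : conjR (AlgEquiv.refl : E ≃ₐ[F] E) R = AlgEquiv.refl := by
  refine AlgEquiv.ext fun x => ?_
  induction x with
  | zero => simp
  | add x y hx hy => rw [map_add, hx, hy, map_add]
  | tmul r e => rfl

/-- The base change of a matrix. -/
def matR (R : Type u) [CommRing R] [Algebra F R] (N : Matrix ι ι E) : Matrix ι ι (R ⊗[F] E) :=
  N.map fun e => (1 : R) ⊗ₜ[F] e

theorem dotProduct_matR_tmul (N : Matrix ι ι E) (r s : R) (x y : W) :
    (fun k => conjR ρ R (coordR b R (r ⊗ₜ[F] x) k)) ⬝ᵥ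
      (matR R N).mulVec (coordR b R (s ⊗ₜ[F] y)) =
    (r * s) ⊗ₜ[F] ((fun k => ρ (b.repr x k)) ⬝ᵥ N.mulVec (b.repr y)) := by
  simp only [dotProduct, Matrix.mulVec, coordR_tmul, conjR_tmul, matR, Matrix.map_apply,
    Algebra.TensorProduct.tmul_mul_tmul, one_mul, ← TensorProduct.tmul_sum]

variable {D : Type*} [AddCommGroup D] [Module F D] {B : W →ₗ[F] W →ₗ[F] D} {f : D →ₗ[F] E}
  {ρ b} {N : Matrix ι ι E}

theorem baseChange_eq_dotProduct
    (hN : ∀ x y, f (B x y) = (fun k => ρ (b.repr x k)) ⬝ᵥ N.mulVec (b.repr y))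
    (x y : R ⊗[F] W) : f.baseChange R (LinearMap.BilinMap.baseChange R B x y) =
      (fun k => conjR ρ R (coordR b R x k)) ⬝ᵥ (matR R N).mulVec (coordR b R y) := by
  induction x with
  | zero => simp
  | add x x' hx hx' =>
    rw [map_add, LinearMap.add_apply, map_add, hx, hx', map_add, ← add_dotProduct]
    congr 1
    ext k
    simp
  | tmul r x =>
    induction y with
    | zero => simp
    | add y y' hy hy' =>
      rw [map_add, map_add, hy, hy', map_add, Matrix.mulVec_add, dotProduct_add]
    | tmul s y =>
      rw [dotProduct_matR_tmul, ← hN, LinearMap.BilinMap.baseChange_tmul,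
        LinearMap.baseChange_tmul]

theorem coordR_baseChange {T : Module.End F W}
    (hN : ∀ x, ⇑(b.repr (T x)) = N.mulVec fun k => ρ (b.repr x k)) (x : R ⊗[F] W) :
    coordR b R (T.baseChange R x) = (matR R N).mulVec fun k => conjR ρ R (coordR b R x k) := by
  induction x with
  | zero => ext; simp [Matrix.mulVec, dotProduct]
  | add x x' hx hx' =>
    rw [map_add, map_add, hx, hx', ← Matrix.mulVec_add]
    congr 1
    ext k
    simp
  | tmul r x =>
    ext k
    rw [LinearMap.baseChange_tmul, coordR_tmul, hN]
    simp only [dotProduct, Matrix.mulVec, coordR_tmul, conjR_tmul, matR, Matrix.map_apply,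
      Algebra.TensorProduct.tmul_mul_tmul, one_mul, TensorProduct.tmul_sum]

theorem dotProduct_mulVec_mulVec {A n : Type*} [CommRing A] [Algebra R A] [Fintype n]
    (σ : A ≃ₐ[R] A) (M N : Matrix n n A) (x y : n → A) :
    (fun k => σ (M.mulVec x k)) ⬝ᵥ N.mulVec (M.mulVec y) =
      (fun k => σ (x k)) ⬝ᵥ (conjT σ M * N * M).mulVec y := by
  have h1 : (fun k => σ (M.mulVec x k)) = (M.map σ).mulVec fun k => σ (x k) :=
    funext fun k => (σ : A →+* A).map_mulVec M x k
  rw [h1, ← Matrix.mulVec_mulVec, ← Matrix.mulVec_mulVec, conjT,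
    Matrix.dotProduct_mulVec _ (Matrix.transpose (M.map σ)), Matrix.vecMul_transpose]

theorem sim_iff {A : Type*} [CommRing A] [Algebra R A]
    (σ : A ≃ₐ[R] A) (N N' : Matrix ι ι A) :
    (∀ x y : ι → A, (fun k => σ (x k)) ⬝ᵥ N.mulVec y = (fun k => σ (x k)) ⬝ᵥ N'.mulVec y) ↔
      N = N' := by
  refine ⟨fun h => ?_, fun h => by simp [h]⟩
  ext k l
  have h1 := h (Pi.single k 1) (Pi.single l 1)
  have h2 : (fun j => σ ((Pi.single k 1 : ι → A) j)) = Pi.single k 1 := by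
    ext j
    by_cases hj : j = k
    · subst hj; simp
    · simp [hj]
  simpa [h2] using h1

/-- The map `f` extracts an `E`-valued coordinate of a `D`-valued form. Thus one statement covers
the hermitian form and both coordinates of the `B`-valued form; trivial `ρ` gives the bilinear case.
-/
theorem HasMat.sim_iff {g : GLp F R W} {M : Matrix ι ι (R ⊗[F] E)} (hg : HasMat b g M)
    (hN : ∀ x y, f (B x y) = (fun k => ρ (b.repr x k)) ⬝ᵥ N.mulVec (b.repr y)) (ν : R) :
    (∀ x y, f.baseChange R (LinearMap.BilinMap.baseChange R B (g x) (g y)) =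
      f.baseChange R (ν • LinearMap.BilinMap.baseChange R B x y)) ↔
    conjT (conjR ρ R) M * matR R N * M = ν • matR R N := by
  rw [← ExcIso.sim_iff (conjR ρ R)]
  constructor
  · intro h x y
    have h1 := h ((coordR b R).symm x) ((coordR b R).symm y)
    rw [map_smul, baseChange_eq_dotProduct hN, baseChange_eq_dotProduct hN, hg, hg,
      dotProduct_mulVec_mulVec] at h1
    simp only [LinearEquiv.apply_symm_apply] at h1
    rw [h1, Matrix.smul_mulVec, dotProduct_smul]
  · intro h x y
    rw [map_smul, baseChange_eq_dotProduct hN, baseChange_eq_dotProduct hN, hg, hg,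
      dotProduct_mulVec_mulVec, h, Matrix.smul_mulVec, dotProduct_smul]

end BaseChange


/-! ### Base change of the structural matrices -/

section MatR

variable {F : Type u} [Field F] {E : Type v} [Field E] [Algebra F E] {ι : Type*} [Fintype ι]
  [DecidableEq ι] (R : Type u) [CommRing R] [Algebra F R]

theorem tmul_algebraMap (a : F) :
    (1 : R) ⊗ₜ[F] algebraMap F E a = algebraMap R (R ⊗[F] E) (algebraMap F R a) := by
  rw [Algebra.TensorProduct.algebraMap_apply, Algebra.algebraMap_self_apply,
    Algebra.algebraMap_eq_smul_one, Algebra.algebraMap_eq_smul_one, TensorProduct.smul_tmul]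

omit [Fintype ι] in
theorem matR_diagR (α : ι → F) :
    matR R (diagR E α) = diagR (R ⊗[F] E) fun k => algebraMap F R (α k) := by
  rw [matR, diagR, Matrix.diagonal_map (TensorProduct.tmul_zero _ _)]
  simp only [tmul_algebraMap, diagR]

omit [Fintype ι] [DecidableEq ι] in
theorem matR_smul (c : E) (N : Matrix ι ι E) :
    matR (F := F) R (c • N) = ((1 : R) ⊗ₜ[F] c) • matR (F := F) R N := by
  ext k l
  simp [matR]

theorem matR_wedgeGram : matR (F := F) R (wedgeGram E) = wedgeGram (R ⊗[F] E) :=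
  wedgeGram_map ((Algebra.TensorProduct.includeRight : E →ₐ[F] R ⊗[F] E) : E →+* R ⊗[F] E)

theorem matR_compound (N : Matrix (Fin 4) (Fin 4) E) :
    matR (F := F) R (compound N) = compound (matR (F := F) R N) :=
  (compound_map ((Algebra.TensorProduct.includeRight : E →ₐ[F] R ⊗[F] E) : E →+* R ⊗[F] E) N).symm

theorem matR_opMat (α : Fin 4 → F) (δ : E) : matR (F := F) R (opMat α δ) =
    opMat (fun k => algebraMap F R (α k)) ((1 : R) ⊗ₜ[F] δ) := by
  rw [opMat, matR_smul, opMat, ← matR_diagR, ← matR_compound, ← matR_wedgeGram]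
  congr 1
  exact Matrix.map_mul
    (f := ((Algebra.TensorProduct.includeRight : E →ₐ[F] R ⊗[F] E) : E →+* R ⊗[F] E))

theorem isUnit_one_tmul {e : E} (he : e ≠ 0) : IsUnit ((1 : R) ⊗ₜ[F] e) :=
  (isUnit_iff_ne_zero.mpr he).map (Algebra.TensorProduct.includeRight : E →ₐ[F] R ⊗[F] E)

end MatR

namespace QuatAlg

variable {F : Type u} [Field F] {E : Type v} [Field E] [Algebra F E] (ρ : E ≃ₐ[F] E) (J : F)

/-- The first coordinate, as a linear map. -/
def fstₗ : QuatAlg ρ J →ₗ[F] E where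
  toFun := fst
  map_add' _ _ := rfl
  map_smul' _ _ := rfl

/-- The second coordinate, as a linear map. -/
def sndₗ : QuatAlg ρ J →ₗ[F] E where
  toFun := snd
  map_add' _ _ := rfl
  map_smul' _ _ := rfl

variable {ρ J}

theorem baseChange_ext {R : Type u} [CommRing R] [Algebra F R] {z z' : R ⊗[F] QuatAlg ρ J}
    (h1 : (fstₗ ρ J).baseChange R z = (fstₗ ρ J).baseChange R z')
    (h2 : (sndₗ ρ J).baseChange R z = (sndₗ ρ J).baseChange R z') : z = z' := by
  let f : E →ₗ[F] QuatAlg ρ J :=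
    { toFun := fun e => ⟨e, 0⟩
      map_add' := fun _ _ => QuatAlg.ext rfl (add_zero 0).symm
      map_smul' := fun c _ => QuatAlg.ext rfl (smul_zero c).symm }
  let s : E →ₗ[F] QuatAlg ρ J :=
    { toFun := fun e => ⟨0, e⟩
      map_add' := fun _ _ => QuatAlg.ext (add_zero 0).symm rfl
      map_smul' := fun c _ => QuatAlg.ext (smul_zero c).symm rfl }
  have hid : f ∘ₗ fstₗ ρ J + s ∘ₗ sndₗ ρ J = LinearMap.id :=
    LinearMap.ext fun x => QuatAlg.ext (add_zero _) (zero_add _)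
  have key : ∀ z : R ⊗[F] QuatAlg ρ J, z = f.baseChange R ((fstₗ ρ J).baseChange R z) +
      s.baseChange R ((sndₗ ρ J).baseChange R z) := by
    intro z
    have h3 := congrArg (fun T : QuatAlg ρ J →ₗ[F] QuatAlg ρ J => T.baseChange R z) hid
    simp only [LinearMap.baseChange_add, LinearMap.baseChange_comp, LinearMap.baseChange_id] at h3
    exact h3.symm
  rw [key z, key z', h1, h2]

end QuatAlg

/-! ### The similitude groups as groups of matrices -/

section GroupsInCoordinates

variable {F : Type u} [Field F] {E : Type v} [Field E] [Algebra F E]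
  [Algebra.IsQuadraticExtension F E] {V : Type w} [AddCommGroup V] [Module E V] [Module F V]
  [IsScalarTower F E V] {ρ : E ≃ₐ[F] E} {H : V →ₛₗ[(ρ : E →+* E)] V →ₗ[E] E}

namespace OrthoBasis

/-- The coefficients of the form, in `R`. -/
def coeffR (b : OrthoBasis H) (R : Type u) [CommRing R] [Algebra F R] (k : Fin 4) : R :=
  algebraMap F R (b.coeff k)

/-- The inverse of the value of `d` on `e₀ ∧ e₁ ∧ e₂ ∧ e₃`, in `R ⊗ E`. -/
noncomputable def discR (b : OrthoBasis H) (d : (⋀[E]^4 V) ≃ₗ[E] E) (R : Type u) [CommRing R]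
    [Algebra F R] : R ⊗[F] E :=
  (1 : R) ⊗ₜ[F] (b.disc d)⁻¹

variable (b : OrthoBasis H) {d : (⋀[E]^4 V) ≃ₗ[E] E} {R : Type u} [CommRing R] [Algebra F R]

omit [Algebra.IsQuadraticExtension F E] [Module F V] [IsScalarTower F E V] in
theorem isUnit_coeffR (k : Fin 4) : IsUnit (b.coeffR R k) :=
  (isUnit_iff_ne_zero.mpr (b.coeff_ne_zero k)).map _

omit [Algebra.IsQuadraticExtension F E] [Module F V] [IsScalarTower F E V] in
variable (d) in
theorem isUnit_discR : IsUnit (b.discR d R) :=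
  isUnit_one_tmul R (inv_ne_zero (b.disc_ne_zero d))

omit [Algebra.IsQuadraticExtension F E] [Module F V] [IsScalarTower F E V] in
theorem apply_eq_dotProduct (x y : V) : H x y =
    (fun k => ρ (b.basis.repr x k)) ⬝ᵥ (diagR E b.coeff).mulVec (b.basis.repr y) := by
  conv_lhs => rw [← b.basis.sum_repr x]
  rw [map_sum, LinearMap.sum_apply]
  refine Finset.sum_congr rfl fun k _ => ?_
  rw [LinearMap.map_smulₛₗ, LinearMap.smul_apply, b.apply_basis, smul_eq_mul, diagR,
    Matrix.mulVec_diagonal]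
  rfl

theorem isSim_hermF_iff {g : GLp F R V} {M : Matrix (Fin 4) (Fin 4) (R ⊗[F] E)}
    (hg : HasMat b.basis g M) (ν : Rˣ) :
    IsSim (hermF H) g ν ↔ IsUnitarySim (conjR ρ R) (b.coeffR R) M ν := by
  have h1 := hg.sim_iff (B := hermF H) (f := LinearMap.id) (ρ := ρ) b.apply_eq_dotProduct (ν : R)
  rw [matR_diagR] at h1
  simp only [LinearMap.baseChange_id, LinearMap.id_apply] at h1
  exact h1

theorem mem_GUE_iff {g : GLp F R V} : g ∈ GUE H R ↔ ∃ M, HasMat b.basis g M ∧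
    ∃ ν : R, IsUnit ν ∧ IsUnitarySim (conjR ρ R) (b.coeffR R) M ν := by
  constructor
  · rintro ⟨h1, ν, hν⟩
    have hM := hasMat_toMat b.basis g h1
    exact ⟨_, hM, ν, ν.isUnit, (b.isSim_hermF_iff hM ν).mp hν⟩
  · rintro ⟨M, hM, _, ⟨ν, rfl⟩, h⟩
    exact ⟨hM.actE_comm, ν, (b.isSim_hermF_iff hM ν).mpr h⟩

theorem mem_GSUE_iff {g : GLp F R V} : g ∈ GSUE H R ↔ ∃ M, HasMat b.basis g M ∧
    ∃ ν : R, IsUnit ν ∧ IsUnitarySim (conjR ρ R) (b.coeffR R) M ν ∧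
      M.det = algebraMap R (R ⊗[F] E) (ν ^ 2) := by
  constructor
  · rintro ⟨h1, ν, hν, hd⟩
    have hM := hasMat_toMat b.basis g h1.1
    exact ⟨_, hM, ν, ν.isUnit, (b.isSim_hermF_iff hM ν).mp hν, (hM.detE_eq h1.1).symm.trans hd⟩
  · rintro ⟨M, hM, _, ⟨ν, rfl⟩, h, hd⟩
    exact ⟨⟨hM.actE_comm, ν, (b.isSim_hermF_iff hM ν).mpr h⟩, ν, (b.isSim_hermF_iff hM ν).mpr h,
      (hM.detE_eq _).trans hd⟩

omit [Algebra.IsQuadraticExtension F E] in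
theorem coordR_wedgeR (x y : R ⊗[F] V) : coordR b.basis₂ R (wedgeR E R x y) =
    plucker (coordR b.basis R x) (coordR b.basis R y) := by
  rw [wedgeR]
  induction x with
  | zero => ext; simp [plucker]
  | add x x' hx hx' =>
    rw [map_add, LinearMap.add_apply, map_add, hx, hx', map_add]
    ext
    simp only [plucker, Pi.add_apply]
    ring
  | tmul r x =>
    induction y with
    | zero => ext; simp [plucker]
    | add y y' hy hy' =>
      rw [map_add, map_add, hy, hy', map_add]
      ext
      simp only [plucker, Pi.add_apply]
      ring
    | tmul s y =>
      ext I
      rw [LinearMap.BilinMap.baseChange_tmul, coordR_tmul]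
      change (r * s) ⊗ₜ[F] b.basis₂.repr (exteriorPower.ιMulti E 2 ![x, y]) I = _
      rw [repr_ιMulti]
      simp only [plucker, coordR_tmul, Algebra.TensorProduct.tmul_mul_tmul,
        TensorProduct.tmul_sub]

variable {hψ : Function.Bijective (psi d)} {J : F} {i : E}

omit [Algebra.IsQuadraticExtension F E] in
theorem coordR_bAct_j (x : R ⊗[F] (⋀[E]^2 V)) :
    coordR b.basis₂ R ((bAct H d hψ J ⟨0, 1⟩).baseChange R x) =
      (opMat (b.coeffR R) (b.discR d R)).mulVec fun k => conjR ρ R (coordR b.basis₂ R x k) := by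
  have h1 := coordR_baseChange (b := b.basis₂) (R := R) (ρ := ρ) (T := bAct H d hψ J ⟨0, 1⟩)
    (N := opMat b.coeff (b.disc d)⁻¹) (fun x => by
      rw [bAct_apply, zero_smul, one_smul, zero_add, b.repr_opL]) x
  rwa [matR_opMat] at h1

omit [Algebra.IsQuadraticExtension F E] in
theorem bAct_eq (c : QuatAlg ρ J) : bAct H d hψ J c =
    actE c.fst + actE c.snd ∘ₗ bAct H d hψ J ⟨0, 1⟩ := by
  refine LinearMap.ext fun x => ?_
  change c.fst • x + _ = c.fst • x + c.snd • ((0 : E) • x + (1 : E) • opL H d hψ x)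
  rw [zero_smul, zero_add, one_smul]

omit [Algebra.IsQuadraticExtension F E] in
-- Commuting with `E` means having a matrix over `R ⊗ E`; commuting with `𝐣`, which acts as `L`, is
-- the twisted matrix identity. These generate the action of `B`.
theorem bAct_comm_iff {g : GLp F R (⋀[E]^2 V)} :
    (∀ (c : QuatAlg ρ J) x, g ((bAct H d hψ J c).baseChange R x) =
      (bAct H d hψ J c).baseChange R (g x)) ↔
    ∃ X, HasMat b.basis₂ g X ∧ X * opMat (b.coeffR R) (b.discR d R) =
      opMat (b.coeffR R) (b.discR d R) * X.map (conjR ρ R) := by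
  have hmap : ∀ (X : Matrix (Fin 6) (Fin 6) (R ⊗[F] E)) x, (fun k => conjR ρ R (X.mulVec x k)) =
      (X.map (conjR ρ R)).mulVec fun k => conjR ρ R (x k) := fun X x =>
    funext fun k => (conjR ρ R : R ⊗[F] E →+* R ⊗[F] E).map_mulVec X x k
  constructor
  · intro h
    have hX : HasMat b.basis₂ g (toMat b.basis₂ g) := hasMat_toMat b.basis₂ g fun e x => by
      have h1 := h ⟨e, 0⟩ x
      have h2 : bAct H d hψ J (⟨e, 0⟩ : QuatAlg ρ J) = actE e := by
        refine LinearMap.ext fun x => ?_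
        change e • x + (0 : E) • opL H d hψ x = e • x
        rw [zero_smul, add_zero]
      rwa [h2] at h1
    refine ⟨_, hX, ?_⟩
    refine Matrix.ext_of_mulVec_single fun k => ?_
    have h1 := congrArg (coordR b.basis₂ R) (h ⟨0, 1⟩ ((1 : R) ⊗ₜ[F] b.basis₂ k))
    rw [hX, b.coordR_bAct_j, b.coordR_bAct_j, hX, hmap, Matrix.mulVec_mulVec,
      Matrix.mulVec_mulVec, coordR_basis] at h1
    have h2 : (fun j => conjR ρ R ((Pi.single k 1 : Fin 6 → R ⊗[F] E) j)) = Pi.single k 1 := by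
      ext j
      by_cases hj : j = k
      · subst hj; simp
      · simp [hj]
    rwa [h2] at h1
  · rintro ⟨X, hX, h⟩ c x
    have hj : ∀ x, g ((bAct H d hψ J ⟨0, 1⟩).baseChange R x) =
        (bAct H d hψ J ⟨0, 1⟩).baseChange R (g x) := fun x => by
      refine (coordR b.basis₂ R).injective ?_
      rw [hX, b.coordR_bAct_j, b.coordR_bAct_j, hX, hmap, Matrix.mulVec_mulVec,
        Matrix.mulVec_mulVec, h]
    rw [bAct_eq, LinearMap.baseChange_add, LinearMap.baseChange_comp, LinearMap.add_apply,
      LinearMap.add_apply, LinearMap.comp_apply, LinearMap.comp_apply, map_add, hX.actE_comm,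
      hX.actE_comm, hj]

/-- The second coordinate of the form gives the wedge condition. The first gives the hermitian
condition, which `IsQuatSim.conjT_mul` deduces from the wedge condition and commutation with `L`. -/
theorem isSim_bForm_iff (hL : ∀ x, opL H d hψ (opL H d hψ x) = J • x) (hJ : J ≠ 0) (hi : i ≠ 0)
    {g : GLp F R (⋀[E]^2 V)} {X : Matrix (Fin 6) (Fin 6) (R ⊗[F] E)} (hX : HasMat b.basis₂ g X)
    (hc : X * opMat (b.coeffR R) (b.discR d R) =
      opMat (b.coeffR R) (b.discR d R) * X.map (conjR ρ R)) (ν : Rˣ) :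
    IsSim (bForm H d hψ i J) g ν ↔ IsQuatSim (conjR ρ R) (b.coeffR R) (b.discR d R) X ν := by
  have h1 := hX.sim_iff (B := bForm H d hψ i J) (f := QuatAlg.fstₗ ρ J) (ρ := ρ)
    (N := i • compound (diagR E b.coeff)) (fun x y => by
      rw [bForm_apply hL hJ, Matrix.smul_mulVec, dotProduct_smul, ← b.hermPow_eq_dotProduct]
      rfl) (ν : R)
  have h2 := hX.sim_iff (B := bForm H d hψ i J) (f := QuatAlg.sndₗ ρ J) (ρ := AlgEquiv.refl)
    (N := (-(i * b.disc d)) • wedgeGram E) (fun x y => by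
      rw [bForm_apply hL hJ, Matrix.smul_mulVec, dotProduct_smul, b.psi_apply, smul_eq_mul,
        neg_mul, mul_assoc]
      rfl) (ν : R)
  have hcancel : ∀ (u : R ⊗[F] E) (P Q : Matrix (Fin 6) (Fin 6) (R ⊗[F] E)), IsUnit u →
      (P * (u • Q) * X = (ν : R) • (u • Q) ↔ P * Q * X = (ν : R) • Q) := by
    rintro _ P Q ⟨u, rfl⟩
    rw [Matrix.mul_smul, Matrix.smul_mul, smul_comm (ν : R)]
    exact (u.isUnit.smul_left_cancel)
  rw [matR_smul, matR_compound, matR_diagR, hcancel _ _ _ (isUnit_one_tmul R hi)] at h1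
  rw [matR_smul, matR_wedgeGram, conjR_refl, hcancel _ _ _ (isUnit_one_tmul R
    (neg_ne_zero.mpr (mul_ne_zero hi (b.disc_ne_zero d))))] at h2
  constructor
  · intro h
    exact ⟨hc, h2.mp fun x y => congrArg _ (h x y)⟩
  · intro h x y
    exact QuatAlg.baseChange_ext (h1.mpr (h.conjT_mul (b.isUnit_discR d)) x y) (h2.mpr h.2 x y)

theorem mem_GUB_iff (hL : ∀ x, opL H d hψ (opL H d hψ x) = J • x) (hJ : J ≠ 0) (hi : i ≠ 0)
    {g : GLp F R (⋀[E]^2 V)} : g ∈ GUB H d hψ i J R ↔ ∃ X, HasMat b.basis₂ g X ∧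
      ∃ ν : R, IsUnit ν ∧ IsQuatSim (conjR ρ R) (b.coeffR R) (b.discR d R) X ν := by
  constructor
  · rintro ⟨h1, ν, hν⟩
    obtain ⟨X, hX, hc⟩ := b.bAct_comm_iff.mp h1
    exact ⟨X, hX, ν, ν.isUnit, (b.isSim_bForm_iff hL hJ hi hX hc ν).mp hν⟩
  · rintro ⟨X, hX, _, ⟨ν, rfl⟩, h⟩
    exact ⟨b.bAct_comm_iff.mpr ⟨X, hX, h.1⟩, ν, (b.isSim_bForm_iff hL hJ hi hX h.1 ν).mpr h⟩

end OrthoBasis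

end GroupsInCoordinates

/-! ### Decompositions compatible with a basis -/

section BlockStabilizer

variable {F : Type u} [Field F] {E : Type v} [Field E] [Algebra F E]
  {W : Type w} [AddCommGroup W] [Module E W] [Module F W] [IsScalarTower F E W]
  {ι : Type*} [Fintype ι] [DecidableEq ι] {b : Module.Basis ι E W}
  {R : Type u} [CommRing R] [Algebra F R] {W₁ W₂ : Submodule E W}

omit [Algebra F E] [Module F W] [IsScalarTower F E W] [Fintype ι] in
theorem repr_self_eq_zero (b : Module.Basis ι E W) (s : ι → Prop) {k l : ι} (hl : s l)
    (hk : ¬ s k) : b.repr (b k) l = 0 := by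
  rw [b.repr_self, Finsupp.single_apply, if_neg]
  rintro rfl
  exact hk hl

/-- A subspace spanned by part of an `E`-basis is cut out by the same coordinates after base change.
-/
theorem mem_baseChange_iff {s : ι → Prop} (hW : ∀ x, x ∈ W₁ ↔ ∀ k, s k → b.repr x k = 0)
    (x : R ⊗[F] W) :
    x ∈ (W₁.restrictScalars F).baseChange R ↔ ∀ k, s k → coordR b R x k = 0 := by
  constructor
  · intro hx k hk
    rw [Submodule.baseChange_eq_span] at hx
    induction hx using Submodule.span_induction with
    | mem x hx =>
      obtain ⟨y, hy, rfl⟩ := hx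
      change coordR b R ((1 : R) ⊗ₜ[F] y) k = 0
      rw [coordR_tmul, (hW y).mp hy k hk, TensorProduct.tmul_zero]
    | zero => simp
    | add x y _ _ hx hy => rw [map_add, Pi.add_apply, hx, hy, add_zero]
    | smul r x _ hx => rw [map_smul, Pi.smul_apply, hx, smul_zero]
  · intro hx
    rw [eq_sum_scal b x]
    refine Submodule.sum_mem _ fun k _ => ?_
    by_cases hk : s k
    · rw [hx k hk, map_zero]
      exact Submodule.zero_mem _
    · generalize coordR b R x k = c
      induction c with
      | zero => simp
      | add c c' hc hc' =>
        rw [map_add, LinearMap.add_apply]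
        exact Submodule.add_mem _ hc hc'
      | tmul r e =>
        rw [scal_tmul, LinearMap.baseChange_tmul]
        refine Submodule.smul_mem _ _ (Submodule.tmul_mem_baseChange_of_mem _ ?_)
        refine (hW _).mpr fun l hl => ?_
        change b.repr (e • b k) l = 0
        rw [map_smul, Finsupp.smul_apply, repr_self_eq_zero b s hl hk, smul_zero]

variable {t : ι → Prop} [DecidablePred t]

/-- The diagonal matrix with entries `1` at the indices satisfying `t` and `-1` elsewhere. -/
def signMat (A : Type*) [CommRing A] (t : ι → Prop) [DecidablePred t] : Matrix ι ι A :=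
  Matrix.diagonal fun k => if t k then 1 else -1

theorem commute_signMat_iff {A : Type*} [CommRing A] (h2 : IsUnit (2 : A)) (M : Matrix ι ι A) :
    Commute M (signMat A t) ↔ ∀ k l, ¬ (t k ↔ t l) → M k l = 0 := by
  rw [signMat, commute_diagonal_iff]
  refine forall_congr' fun k => forall_congr' fun l => ?_
  by_cases hk : t k <;> by_cases hl : t l <;> simp only [hk, hl, if_true, if_false] <;> try simp
  all_goals
    constructor
    · intro h
      exact h2.mul_left_cancel (by first | linear_combination h | linear_combination -h)
    · intro h
      simp [h]

variable (hW₁ : ∀ x, x ∈ W₁ ↔ ∀ k, ¬ t k → b.repr x k = 0)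
  (hW₂ : ∀ x, x ∈ W₂ ↔ ∀ k, t k → b.repr x k = 0)

include hW₁ hW₂

/-- Preserving both summands means having no mixed entries, which is commutation with the sign
involution since `2` is invertible. The stabilizer demands equality of submodules, so the inverse
matrix, which also commutes, is used as well. -/
theorem mem_stab_inf_iff (h2 : IsUnit (2 : R ⊗[F] E)) {g : GLp F R W}
    {M : Matrix ι ι (R ⊗[F] E)} (hM : HasMat b g M) :
    g ∈ stab (W₁.restrictScalars F) R ⊓ stab (W₂.restrictScalars F) R ↔
      Commute M (signMat (R ⊗[F] E) t) := by
  constructor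
  · rintro ⟨h₁, h₂⟩
    have key : ∀ {W₀ : Submodule E W} {s : ι → Prop} (hW : ∀ x, x ∈ W₀ ↔ ∀ k, s k → b.repr x k = 0)
        (h : g ∈ stab (W₀.restrictScalars F) R) (k l : ι) (hk : s k) (hl : ¬ s l), M k l = 0 := by
      intro W₀ s hW h k l hk hl
      have h3 : (1 : R) ⊗ₜ[F] b l ∈ (W₀.restrictScalars F).baseChange R := by
        refine Submodule.tmul_mem_baseChange_of_mem _ ((hW _).mpr fun m hm => ?_)
        exact repr_self_eq_zero b s hm hl
      have h4 := Submodule.mem_map_of_mem (f := (g : R ⊗[F] W →ₗ[R] R ⊗[F] W)) h3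
      rw [show Submodule.map _ _ = _ from h, mem_baseChange_iff hW] at h4
      have h5 := h4 k hk
      change coordR b R (g _) k = 0 at h5
      rwa [hM, coordR_basis, Matrix.mulVec_single_one] at h5
    rw [commute_signMat_iff h2]
    intro k l hkl
    by_cases hk : t k
    · exact key hW₂ h₂ k l hk fun hl => hkl (iff_of_true hk hl)
    · exact key hW₁ h₁ k l hk fun hl => hkl (iff_of_false hk hl)
  · intro h
    have key : ∀ (g' : GLp F R W) (M' : Matrix ι ι (R ⊗[F] E)), HasMat b g' M' →
        Commute M' (signMat (R ⊗[F] E) t) →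
        (∀ x ∈ (W₁.restrictScalars F).baseChange R, g' x ∈ (W₁.restrictScalars F).baseChange R) ∧
        ∀ x ∈ (W₂.restrictScalars F).baseChange R, g' x ∈ (W₂.restrictScalars F).baseChange R := by
      intro g' M' hM' hc
      rw [commute_signMat_iff h2] at hc
      constructor
      · intro x hx
        rw [mem_baseChange_iff hW₁] at hx ⊢
        intro k hk
        rw [hM']
        refine Finset.sum_eq_zero fun l _ => ?_
        change M' k l * coordR b R x l = 0
        by_cases hl : t l
        · rw [hc k l fun e => hk (e.mpr hl), zero_mul]
        · rw [hx l hl, mul_zero]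
      · intro x hx
        rw [mem_baseChange_iff hW₂] at hx ⊢
        intro k hk
        rw [hM']
        refine Finset.sum_eq_zero fun l _ => ?_
        change M' k l * coordR b R x l = 0
        by_cases hl : t l
        · rw [hx l hl, mul_zero]
        · rw [hc k l fun e => hl (e.mp hk), zero_mul]
    obtain ⟨N, hN, hMN, hNM⟩ := hM.exists_inv
    have hNc : Commute N (signMat (R ⊗[F] E) t) := by
      calc N * signMat (R ⊗[F] E) t = N * signMat (R ⊗[F] E) t * (M * N) := by
            rw [hMN, Matrix.mul_one]
        _ = N * (signMat (R ⊗[F] E) t * M) * N := by simp only [Matrix.mul_assoc]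
        _ = (N * M) * signMat (R ⊗[F] E) t * N := by rw [← h.eq]; simp only [Matrix.mul_assoc]
        _ = signMat (R ⊗[F] E) t * N := by rw [hNM, Matrix.one_mul]
    have hgg : ∀ x, g (g⁻¹ x) = x := fun x => g.apply_symm_apply x
    refine ⟨le_antisymm ?_ ?_, le_antisymm ?_ ?_⟩
    · rintro _ ⟨x, hx, rfl⟩
      exact (key g M hM h).1 x hx
    · intro x hx
      exact ⟨g⁻¹ x, (key g⁻¹ N hN hNc).1 x hx, hgg x⟩
    · rintro _ ⟨x, hx, rfl⟩
      exact (key g M hM h).2 x hx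
    · intro x hx
      exact ⟨g⁻¹ x, (key g⁻¹ N hN hNc).2 x hx, hgg x⟩

omit [Module F W] [IsScalarTower F E W] [Algebra F E] [Fintype ι] in
theorem isCompl_of_repr : IsCompl W₁ W₂ := by
  rw [isCompl_iff, Submodule.disjoint_def, codisjoint_iff]
  constructor
  · intro x h₁ h₂
    refine b.repr.injective (Finsupp.ext fun k => ?_)
    rw [map_zero, Finsupp.zero_apply]
    by_cases hk : t k
    · exact (hW₂ x).mp h₂ k hk
    · exact (hW₁ x).mp h₁ k hk
  · rw [eq_top_iff, ← b.span_eq, Submodule.span_le]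
    rintro _ ⟨k, rfl⟩
    by_cases hk : t k
    · refine Submodule.mem_sup_left ((hW₁ _).mpr fun l hl => ?_)
      exact repr_self_eq_zero b (fun k => ¬ t k) hl (not_not.mpr hk)
    · refine Submodule.mem_sup_right ((hW₂ _).mpr fun l hl => ?_)
      exact repr_self_eq_zero b t hl hk

end BlockStabilizer

/-! ### The decomposition `V♯ ⊕ V₀♯` in an adapted basis -/

section Sharp

variable {F : Type u} [Field F] {E : Type v} [Field E] [Algebra F E]
  [Algebra.IsQuadraticExtension F E] {V : Type w} [AddCommGroup V] [Module E V] [Module F V]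
  [IsScalarTower F E V] {ρ : E ≃ₐ[F] E} {H : V →ₛₗ[(ρ : E →+* E)] V →ₗ[E] E}
  {V₁ V₂ : Submodule E V} {d : (⋀[E]^4 V) ≃ₗ[E] E} {hψ : Function.Bijective (psi d)} {J : F} {i : E}

/-- The basis is the union of bases of `V₁` and `V₂`. -/
structure OrthoBasis.IsAdapted (b : OrthoBasis H) (V₁ V₂ : Submodule E V) : Prop where
  mem_fst : ∀ x, x ∈ V₁ ↔ ∀ k : Fin 4, ¬ (k = 0 ∨ k = 1) → b.basis.repr x k = 0
  mem_snd : ∀ x, x ∈ V₂ ↔ ∀ k : Fin 4, (k = 0 ∨ k = 1) → b.basis.repr x k = 0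

namespace OrthoBasis.IsAdapted

variable {b : OrthoBasis H} (hb : b.IsAdapted V₁ V₂)

include hb

omit [Algebra.IsQuadraticExtension F E] [Module F V] [IsScalarTower F E V] in
theorem basis_mem (k : Fin 4) : ((k = 0 ∨ k = 1) ∧ b.basis k ∈ V₁) ∨
    (¬ (k = 0 ∨ k = 1) ∧ b.basis k ∈ V₂) := by
  by_cases hk : k = 0 ∨ k = 1
  · refine Or.inl ⟨hk, (hb.mem_fst _).mpr fun l hl => ?_⟩
    exact repr_self_eq_zero b.basis (fun k => ¬ (k = 0 ∨ k = 1)) hl (not_not.mpr hk)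
  · refine Or.inr ⟨hk, (hb.mem_snd _).mpr fun l hl => ?_⟩
    exact repr_self_eq_zero b.basis (fun k => k = 0 ∨ k = 1) hl hk

omit [Algebra.IsQuadraticExtension F E] [Module F V] [IsScalarTower F E V] in
theorem mem_sharp (x : ⋀[E]^2 V) :
    x ∈ sharp V₁ V₂ ↔ ∀ k : Fin 6, (k = 0 ∨ k = 5) → b.basis₂.repr x k = 0 := by
  constructor
  · intro hx k hk
    induction hx using Submodule.span_induction with
    | mem x hx =>
      obtain ⟨y, hy, z, hz, rfl⟩ := hx
      rw [hb.mem_fst] at hy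
      rw [hb.mem_snd] at hz
      rw [repr_ιMulti, plucker]
      rcases hk with rfl | rfl
      · simp [pairFst, pairSnd, hz 0, hz 1]
      · simp [pairFst, pairSnd, hy 2, hy 3]
    | zero => simp
    | add x y _ _ hx hy => rw [map_add, Finsupp.add_apply, hx, hy, add_zero]
    | smul c x _ hx => rw [map_smul, Finsupp.smul_apply, hx, smul_zero]
  · intro hx
    rw [← b.basis₂.sum_repr x]
    refine Submodule.sum_mem _ fun k _ => ?_
    by_cases hk : k = 0 ∨ k = 5
    · rw [hx k hk, zero_smul]
      exact Submodule.zero_mem _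
    · refine Submodule.smul_mem _ _ (Submodule.subset_span ?_)
      have h1 : ∀ k : Fin 6, ¬ (k = 0 ∨ k = 5) → (pairFst k = 0 ∨ pairFst k = 1) ∧
        ¬ (pairSnd k = 0 ∨ pairSnd k = 1) := by decide
      obtain ⟨h2, h3⟩ := h1 k hk
      refine ⟨_, ((hb.basis_mem (pairFst k)).resolve_right fun h => h.1 h2).2, _,
        ((hb.basis_mem (pairSnd k)).resolve_left fun h => h3 h.1).2, b.basis₂_apply k⟩

omit [Algebra.IsQuadraticExtension F E] [Module F V] [IsScalarTower F E V] in
theorem mem_sharp₀ (x : ⋀[E]^2 V) :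
    x ∈ sharp₀ V₁ V₂ ↔ ∀ k : Fin 6, ¬ (k = 0 ∨ k = 5) → b.basis₂.repr x k = 0 := by
  constructor
  · intro hx k hk
    have key : ∀ W : Submodule E V, (∀ y z : W, b.basis₂.repr
        (exteriorPower.ιMulti E 2 ![(y : V), (z : V)]) k = 0) →
        ∀ x ∈ LinearMap.range (exteriorPower.map 2 W.subtype), b.basis₂.repr x k = 0 := by
      rintro W hW _ ⟨x, rfl⟩
      have h1 : x ∈ Submodule.span E (Set.range (exteriorPower.ιMulti E 2 (M := W))) := by
        rw [exteriorPower.ιMulti_span]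
        exact Submodule.mem_top
      induction h1 using Submodule.span_induction with
      | mem x hx =>
        obtain ⟨y, rfl⟩ := hx
        rw [exteriorPower.map_apply_ιMulti]
        convert hW (y 0) (y 1) using 3
        congr 1
        ext l
        fin_cases l <;> rfl
      | zero => simp
      | add x y _ _ hx hy => rw [map_add, map_add, Finsupp.add_apply, hx, hy, add_zero]
      | smul c x _ hx => rw [map_smul, map_smul, Finsupp.smul_apply, hx, smul_zero]
    have h1 : ∀ k : Fin 6, ¬ (k = 0 ∨ k = 5) → (pairFst k = 0 ∨ pairFst k = 1) ∧
      ¬ (pairSnd k = 0 ∨ pairSnd k = 1) := by decide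
    obtain ⟨h2, h3⟩ := h1 k hk
    obtain ⟨y, hy, z, hz, rfl⟩ := Submodule.mem_sup.mp hx
    rw [map_add, Finsupp.add_apply, key V₁ _ y hy, key V₂ _ z hz, add_zero]
    · intro y z
      rw [repr_ιMulti, plucker, (hb.mem_snd _).mp y.2 _ h2, (hb.mem_snd _).mp z.2 _ h2]
      ring
    · intro y z
      rw [repr_ιMulti, plucker, (hb.mem_fst _).mp y.2 _ h3, (hb.mem_fst _).mp z.2 _ h3]
      ring
  · intro hx
    rw [← b.basis₂.sum_repr x]
    refine Submodule.sum_mem _ fun k _ => ?_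
    by_cases hk : k = 0 ∨ k = 5
    · refine Submodule.smul_mem _ _ ?_
      rw [b.basis₂_apply]
      have key : ∀ (W : Submodule E V) (y z : V), y ∈ W → z ∈ W →
          exteriorPower.ιMulti E 2 ![y, z] ∈
            LinearMap.range (exteriorPower.map 2 W.subtype) := by
        intro W y z hy hz
        refine ⟨exteriorPower.ιMulti E 2 ![⟨y, hy⟩, ⟨z, hz⟩], ?_⟩
        rw [exteriorPower.map_apply_ιMulti]
        congr 1
        ext l
        fin_cases l <;> rfl
      rcases hk with rfl | rfl
      · exact Submodule.mem_sup_left (key _ _ _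
          (((hb.basis_mem 0).resolve_right fun h => h.1 (by decide)).2)
          (((hb.basis_mem 1).resolve_right fun h => h.1 (by decide)).2))
      · exact Submodule.mem_sup_right (key _ _ _
          (((hb.basis_mem 2).resolve_left fun h => absurd h.1 (by decide)).2)
          (((hb.basis_mem 3).resolve_left fun h => absurd h.1 (by decide)).2))
    · rw [hx k hk, zero_smul]
      exact Submodule.zero_mem _

omit [Algebra.IsQuadraticExtension F E] [Module F V] [IsScalarTower F E V] in
theorem isCompl_sharp : IsCompl (sharp V₁ V₂) (sharp₀ V₁ V₂) :=
  (isCompl_of_repr hb.mem_sharp₀ hb.mem_sharp).symm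

omit hb in
theorem _root_.ExcIso.wedgeGram_eq_zero {A : Type*} [CommRing A] (k l : Fin 6)
    (hkl : ¬ ((k = 0 ∨ k = 5) ↔ (l = 0 ∨ l = 5))) : wedgeGram A k l = 0 := by
  fin_cases k <;> fin_cases l <;> first | rfl | exact absurd hkl (by decide)

omit hb [Algebra.IsQuadraticExtension F E] in
-- `L` maps the index `I` to its complement `5 - I`, so it respects the partition of the indices
-- into `{0, 5}` and the rest.
theorem repr_bAct_eq_zero {s : Fin 6 → Prop}
    (hs : ∀ k l, s k → ¬ s l → ¬ ((k = 0 ∨ k = 5) ↔ (l = 0 ∨ l = 5))) (c : QuatAlg ρ J)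
    {x : ⋀[E]^2 V} (hx : ∀ k, s k → b.basis₂.repr x k = 0) (k : Fin 6) (hk : s k) :
    b.basis₂.repr (bAct H d hψ J c x) k = 0 := by
  rw [bAct_apply, map_add, map_smul, map_smul, Finsupp.add_apply, Finsupp.smul_apply,
    Finsupp.smul_apply, hx k hk, b.repr_opL, smul_zero, zero_add]
  have h1 : (opMat b.coeff (b.disc d)⁻¹).mulVec (fun I => ρ (b.basis₂.repr x I)) k = 0 := by
    change ∑ l, opMat b.coeff (b.disc d)⁻¹ k l * ρ (b.basis₂.repr x l) = 0
    refine Finset.sum_eq_zero fun l _ => ?_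
    by_cases hl : s l
    · rw [hx l hl, map_zero, mul_zero]
    · rw [opMat_apply, wedgeGram_eq_zero k l (hs k l hk hl)]
      ring
  rw [h1, smul_zero]

omit [Algebra.IsQuadraticExtension F E] in
theorem bAct_mem_sharp (c : QuatAlg ρ J) {x : ⋀[E]^2 V} (hx : x ∈ sharp V₁ V₂) :
    bAct H d hψ J c x ∈ sharp V₁ V₂ := by
  rw [hb.mem_sharp] at hx ⊢
  exact repr_bAct_eq_zero (fun k l hk hl h => hl (h.mp hk)) c hx

omit [Algebra.IsQuadraticExtension F E] in
theorem bAct_mem_sharp₀ (c : QuatAlg ρ J) {x : ⋀[E]^2 V} (hx : x ∈ sharp₀ V₁ V₂) :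
    bAct H d hψ J c x ∈ sharp₀ V₁ V₂ := by
  rw [hb.mem_sharp₀] at hx ⊢
  exact repr_bAct_eq_zero (fun k l hk hl h => hl fun hl' => hk (h.mpr hl')) c hx

theorem bForm_eq_zero (hL : ∀ x, opL H d hψ (opL H d hψ x) = J • x) (hJ : J ≠ 0)
    {x y : ⋀[E]^2 V} (hx : x ∈ sharp V₁ V₂) (hy : y ∈ sharp₀ V₁ V₂) :
    bForm H d hψ i J x y = 0 := by
  rw [hb.mem_sharp] at hx
  rw [hb.mem_sharp₀] at hy
  have h1 : hermPow 2 H x y = 0 := by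
    rw [b.hermPow_eq_sum]
    refine Finset.sum_eq_zero fun k _ => ?_
    by_cases hk : k = 0 ∨ k = 5
    · rw [hx k hk, map_zero, mul_zero, zero_mul]
    · rw [hy k hk, mul_zero]
  have h2 : psi d x y = 0 := by
    rw [b.psi_apply]
    have h3 : b.basis₂.repr x ⬝ᵥ (wedgeGram E).mulVec (b.basis₂.repr y) = 0 := by
      refine Finset.sum_eq_zero fun k _ => ?_
      by_cases hk : k = 0 ∨ k = 5
      · rw [hx k hk, zero_mul]
      · have h4 : (wedgeGram E).mulVec (b.basis₂.repr y) k = 0 := by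
          change ∑ l, wedgeGram E k l * b.basis₂.repr y l = 0
          refine Finset.sum_eq_zero fun l _ => ?_
          by_cases hl : l = 0 ∨ l = 5
          · rw [wedgeGram_eq_zero k l fun h => hk (h.mpr hl), zero_mul]
          · rw [hy l hl, mul_zero]
        rw [h4, mul_zero]
    rw [h3, mul_zero]
  rw [bForm_apply hL hJ, h1, h2, mul_zero, neg_zero]
  rfl

omit hb in
theorem _root_.ExcIso.splitMat_eq (A : Type*) [CommRing A] :
    splitMat A = signMat A fun k : Fin 4 => k = 0 ∨ k = 1 := by
  rw [splitMat, signMat]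
  congr 1
  ext k
  fin_cases k <;> rfl

omit hb in
theorem _root_.ExcIso.compound_splitMat_eq (A : Type*) [CommRing A] :
    compound (splitMat A) = signMat A fun k : Fin 6 => k = 0 ∨ k = 5 := by
  rw [compound_splitMat, signMat]
  congr 1
  ext k
  fin_cases k <;> rfl

variable {R : Type u} [CommRing R] [Algebra F R] (h2 : IsUnit (2 : R ⊗[F] E))
include h2

omit [Algebra.IsQuadraticExtension F E] in
theorem mem_stab_iff {g : GLp F R V} {M : Matrix (Fin 4) (Fin 4) (R ⊗[F] E)}
    (hM : HasMat b.basis g M) :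
    g ∈ stab (V₁.restrictScalars F) R ⊓ stab (V₂.restrictScalars F) R ↔
      Commute M (splitMat (R ⊗[F] E)) := by
  rw [splitMat_eq]
  exact mem_stab_inf_iff hb.mem_fst hb.mem_snd h2 hM

omit [Algebra.IsQuadraticExtension F E] in
theorem mem_stab_sharp_iff {g : GLp F R (⋀[E]^2 V)} {X : Matrix (Fin 6) (Fin 6) (R ⊗[F] E)}
    (hX : HasMat b.basis₂ g X) :
    g ∈ stab ((sharp V₁ V₂).restrictScalars F) R ⊓ stab ((sharp₀ V₁ V₂).restrictScalars F) R ↔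
      Commute X (compound (splitMat (R ⊗[F] E))) := by
  rw [compound_splitMat_eq, inf_comm]
  exact mem_stab_inf_iff hb.mem_sharp₀ hb.mem_sharp h2 hX

end OrthoBasis.IsAdapted

end Sharp

/-! ### Functoriality of the matrix conditions -/

section MapSim

open Matrix

variable {R S A B : Type*} [CommRing R] [CommRing S] [CommRing A] [CommRing B] [Algebra R A]
  [Algebra S B] {f : R →+* S} {φ : A →+* B} {σ : A ≃ₐ[R] A} {τ : B ≃ₐ[S] B}

theorem diagR_map_map (hf : ∀ r, φ (algebraMap R A r) = algebraMap S B (f r)) {n : Type*}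
    [DecidableEq n] (α : n → R) : (diagR A α).map φ = diagR B fun k => f (α k) := by
  rw [diagR, diagonal_map (map_zero φ), diagR]
  simp only [hf]

theorem IsUnitarySim.map (hf : ∀ r, φ (algebraMap R A r) = algebraMap S B (f r))
    (hφ : ∀ a, φ (σ a) = τ (φ a)) {α : Fin 4 → R} {M : Matrix (Fin 4) (Fin 4) A} {ν : R}
    (h : IsUnitarySim σ α M ν) : IsUnitarySim τ (fun k => f (α k)) (M.map φ) (f ν) := by
  have h1 := congrArg (fun N : Matrix (Fin 4) (Fin 4) A => N.map φ) h
  have h2 : (conjT σ M).map φ = conjT τ (M.map φ) := by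
    ext k l
    exact hφ _
  simp only [Matrix.map_mul, h2, diagR_map_map hf] at h1
  rw [IsUnitarySim, h1, ← diagR_map_map hf]
  ext k l
  rw [map_apply, Matrix.smul_apply, Matrix.smul_apply, map_apply, Algebra.smul_def,
      Algebra.smul_def, map_mul, hf]

theorem opMat_map_map (hf : ∀ r, φ (algebraMap R A r) = algebraMap S B (f r)) (α : Fin 4 → R)
    (δ : A) : (opMat α δ).map φ = opMat (fun k => f (α k)) (φ δ) := by
  ext k l
  rw [map_apply, opMat_apply, opMat_apply, map_mul, map_mul, map_mul, hf, hf]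
  congr 2
  exact congrFun (congrFun (wedgeGram_map φ) k) l

theorem IsQuatSim.map (hf : ∀ r, φ (algebraMap R A r) = algebraMap S B (f r))
    (hφ : ∀ a, φ (σ a) = τ (φ a)) {α : Fin 4 → R} {δ : A} {X : Matrix (Fin 6) (Fin 6) A} {ν : R}
    (h : IsQuatSim σ α δ X ν) :
    IsQuatSim τ (fun k => f (α k)) (φ δ) (X.map φ) (f ν) := by
  constructor
  · have h1 := congrArg (fun N : Matrix (Fin 6) (Fin 6) A => N.map φ) h.1
    have h2 : (X.map σ).map φ = (X.map φ).map τ := by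
      ext k l
      exact hφ _
    simpa only [Matrix.map_mul, opMat_map_map hf, h2] using h1
  · have h1 := congrArg (fun N : Matrix (Fin 6) (Fin 6) A => N.map φ) h.2
    simp only [Matrix.map_mul, wedgeGram_map, transpose_map] at h1
    rw [h1, ← wedgeGram_map φ]
    ext k l
    rw [map_apply, Matrix.smul_apply, Matrix.smul_apply, map_apply, Algebra.smul_def,
      Algebra.smul_def, map_mul, hf]

end MapSim

/-! ### Base change of matrices along `R → S` -/

section MapE

variable {F : Type u} [Field F] {E : Type v} [Field E] [Algebra F E] {ρ : E ≃ₐ[F] E}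
  {R S : Type u} [CommRing R] [Algebra F R] [CommRing S] [Algebra F S] (f : R →ₐ[F] S)

theorem mapE_algebraMap (r : R) :
    mapE E f (algebraMap R (R ⊗[F] E) r) = algebraMap S (S ⊗[F] E) (f r) := by
  change f r ⊗ₜ[F] (1 : E) = _
  rfl

theorem mapE_conjR (a : R ⊗[F] E) : mapE E f (conjR ρ R a) = conjR ρ S (mapE E f a) := by
  induction a with
  | zero => simp
  | add a c ha hc => rw [map_add, map_add, ha, hc, map_add, map_add]
  | tmul r e => rfl

variable {V : Type w} [AddCommGroup V] [Module E V] {H : V →ₛₗ[(ρ : E →+* E)] V →ₗ[E] E}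
  (b : OrthoBasis H)

theorem OrthoBasis.map_coeffR : (fun k => f (b.coeffR R k)) = b.coeffR S :=
  funext fun _ => f.commutes _

theorem OrthoBasis.mapE_discR (d : (⋀[E]^4 V) ≃ₗ[E] E) :
    mapE E f (b.discR d R) = b.discR d S := by
  change f 1 ⊗ₜ[F] _ = _
  rw [map_one]
  rfl

theorem OrthoBasis.isUnitarySim_map {M : Matrix (Fin 4) (Fin 4) (R ⊗[F] E)} {ν : R}
    (h : IsUnitarySim (conjR ρ R) (b.coeffR R) M ν) :
    IsUnitarySim (conjR ρ S) (b.coeffR S) (M.map (mapE E f)) (f ν) := by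
  have h1 := h.map (f := (f : R →+* S)) (φ := (mapE E f : R ⊗[F] E →+* S ⊗[F] E))
    (τ := conjR ρ S) (mapE_algebraMap f) (mapE_conjR f)
  rw [← b.map_coeffR f]
  exact h1

theorem OrthoBasis.isQuatSim_map {d : (⋀[E]^4 V) ≃ₗ[E] E} {X : Matrix (Fin 6) (Fin 6) (R ⊗[F] E)}
    {ν : R} (h : IsQuatSim (conjR ρ R) (b.coeffR R) (b.discR d R) X ν) :
    IsQuatSim (conjR ρ S) (b.coeffR S) (b.discR d S) (X.map (mapE E f)) (f ν) := by
  have h1 := h.map (f := (f : R →+* S)) (φ := (mapE E f : R ⊗[F] E →+* S ⊗[F] E))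
    (τ := conjR ρ S) (mapE_algebraMap f) (mapE_conjR f)
  rw [← b.map_coeffR f, ← b.mapE_discR f]
  exact h1

end MapE

/-! ### Identity components -/

section Zariski

open Polynomial

/-- Products of functions give intersections of principal open sets. -/
theorem isTopologicalBasis_zariski (K : Type*) [Field K] (M : Type*) [AddCommGroup M]
    [Module K M] : @TopologicalSpace.IsTopologicalBasis M (zariski K M)
      {U | ∃ p ∈ polyFun K M, U = {x | p x ≠ 0}} := by
  let _ := zariski K M
  refine ⟨?_, ?_, rfl⟩
  · rintro _ ⟨p, hp, rfl⟩ _ ⟨q, hq, rfl⟩ x ⟨hx, hx'⟩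
    exact ⟨_, ⟨p * q, mul_mem hp hq, rfl⟩, mul_ne_zero hx hx', fun y hy =>
      ⟨left_ne_zero_of_mul hy, right_ne_zero_of_mul hy⟩⟩
  · exact Set.eq_univ_of_forall fun x => ⟨_, ⟨1, one_mem _, rfl⟩, one_ne_zero⟩

variable {F : Type u} [Field F] {E : Type v} [Field E] [Algebra F E]
  {W : Type w} [AddCommGroup W] [Module E W] [Module F W] [IsScalarTower F E W]
  {ι : Type*} [Fintype ι] [DecidableEq ι] (b : Module.Basis ι E W)
  {K : Type u} [Field K] [Algebra F K]

theorem exists_eval_eq {A : Type*} [CommRing A] [Algebra K A] (l : A →ₗ[K] K) (P : A[X]) :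
    ∃ q : K[X], ∀ t, q.eval t = l (evalAt A t P) := by
  induction P using Polynomial.induction_on' with
  | add P Q hP hQ =>
    obtain ⟨p, hp⟩ := hP
    obtain ⟨q, hq⟩ := hQ
    exact ⟨p + q, fun t => by rw [eval_add, hp, hq, map_add, map_add]⟩
  | monomial n a =>
    refine ⟨monomial n (l a), fun t => ?_⟩
    rw [eval_monomial, evalAt, coe_evalRingHom, eval_monomial, ← map_pow, mul_comm a,
      ← Algebra.smul_def, map_smul, smul_eq_mul, mul_comm]

/-- Along a curve with polynomial matrix, a polynomial function restricts to a polynomial in the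
parameter. -/
theorem exists_eval_eq_of_mem_polyFun {P : Matrix ι ι (K ⊗[F] E)[X]} {γ : K → GLp F K W}
    {s : Set K} (hγ : ∀ t ∈ s, HasMat b (γ t) (P.map (evalAt (K ⊗[F] E) t)))
    {φ : Module.End K (K ⊗[F] W) → K} (hφ : φ ∈ polyFun K (Module.End K (K ⊗[F] W))) :
    ∃ q : K[X], ∀ t ∈ s, q.eval t = φ (γ t : K ⊗[F] W →ₗ[K] K ⊗[F] W) := by
  induction hφ using Algebra.adjoin_induction with
  | mem φ hφ =>
    obtain ⟨l, rfl⟩ := hφ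
    let c := coordR (F := F) b K
    let Φ : Matrix ι ι (K ⊗[F] E) →ₗ[K] Module.End K (K ⊗[F] W) :=
      { toFun := fun M => c.symm.toLinearMap ∘ₗ (M.mulVecLin.restrictScalars K) ∘ₗ c.toLinearMap
        map_add' := fun M N => by
          refine LinearMap.ext fun x => c.injective ?_
          simp
        map_smul' := fun r M => by
          refine LinearMap.ext fun x => c.injective ?_
          simp }
    have hΦ : ∀ t ∈ s, Φ (P.map (evalAt (K ⊗[F] E) t)) =
        (γ t : K ⊗[F] W →ₗ[K] K ⊗[F] W) := by
      intro t ht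
      refine LinearMap.ext fun x => c.injective ?_
      change c (c.symm ((P.map (evalAt (K ⊗[F] E) t)).mulVec (c x))) = c (γ t x)
      rw [LinearEquiv.apply_symm_apply]
      exact (hγ t ht x).symm
    choose q hq using fun k m => exists_eval_eq
      (l ∘ₗ Φ ∘ₗ Matrix.singleLinearMap K k m) (P k m)
    refine ⟨∑ k, ∑ m, q k m, fun t ht => ?_⟩
    rw [← hΦ t ht, Matrix.matrix_eq_sum_single (P.map (evalAt (K ⊗[F] E) t))]
    simp only [eval_finsetSum, hq, map_sum]
    rfl
  | algebraMap r => exact ⟨C r, fun t _ => by rw [eval_C]; rfl⟩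
  | add p q _ _ hp hq =>
    obtain ⟨p', hp⟩ := hp
    obtain ⟨q', hq⟩ := hq
    exact ⟨p' + q', fun t ht => by rw [eval_add, hp t ht, hq t ht]; rfl⟩
  | mul p q _ _ hp hq =>
    obtain ⟨p', hp⟩ := hp
    obtain ⟨q', hq⟩ := hq
    exact ⟨p' * q', fun t ht => by rw [eval_mul, hp t ht, hq t ht]; rfl⟩

/-- An element that is connected to `1` by a rational curve is in the identity component. -/
theorem mem_idCompField_of_curve [Infinite K] {G : Subgroup (GLp F K W)}
    {P : Matrix ι ι (K ⊗[F] E)[X]} {p : K[X]} (h0 : p.eval 0 ≠ 0) (h1 : p.eval 1 ≠ 0)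
    (hP : P.map (evalAt (K ⊗[F] E) (0 : K)) = 1)
    (hG : ∀ t, p.eval t ≠ 0 → ∃ g ∈ G, HasMat b g (P.map (evalAt (K ⊗[F] E) t)))
    {h : GLp F K W} (hh : HasMat b h (P.map (evalAt (K ⊗[F] E) (1 : K)))) :
    h ∈ idCompField K G := by
  have hγ' : ∀ t, ∃ g : GLp F K W, p.eval t ≠ 0 →
      g ∈ G ∧ HasMat b g (P.map (evalAt (K ⊗[F] E) t)) := by
    intro t
    by_cases ht : p.eval t = 0
    · exact ⟨1, fun h => absurd ht h⟩
    · obtain ⟨g, hg⟩ := hG t ht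
      exact ⟨g, fun _ => hg⟩
  choose γ hγ using hγ'
  let s : Set K := {t | p.eval t ≠ 0}
  let _ : TopologicalSpace (Module.End K (K ⊗[F] W)) := zariski K (Module.End K (K ⊗[F] W))
  let _ : TopologicalSpace (GLp F K W) := zariskiGL K
  have hp0 : p ≠ 0 := by
    rintro rfl
    simp at h0
  have hopen : ∀ U : Set (GLp F K W), IsOpen U → (γ '' s ∩ U).Nonempty →
      ∃ q : K[X], q ≠ 0 ∧ ∀ t ∈ s, q.eval t ≠ 0 → γ t ∈ U := by
    rintro _ ⟨U, hU, rfl⟩ ⟨_, ⟨t, ht, rfl⟩, htU⟩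
    obtain ⟨_, ⟨φ, hφ, rfl⟩, h2, h3⟩ :=
      (isTopologicalBasis_zariski K (Module.End K (K ⊗[F] W))).exists_subset_of_mem_open htU hU
    obtain ⟨q, hq⟩ := exists_eval_eq_of_mem_polyFun b (s := s) (fun t ht => (hγ t ht).2) hφ
    refine ⟨q, ?_, fun t' ht' hqt => h3 ?_⟩
    · rintro rfl
      refine h2 ?_
      rw [← hq t ht, eval_zero]
    · change φ _ ≠ 0
      rwa [← hq t' ht']
  -- Nonempty open subsets of the image contain the nonvanishing loci, within `s`, of nonzero
  -- polynomials; over an infinite field finitely many such loci meet.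
  have hirr : IsPreirreducible (γ '' s) := by
    intro U V hU hV hU' hV'
    obtain ⟨q, hq0, hq⟩ := hopen U hU hU'
    obtain ⟨q', hq'0, hq'⟩ := hopen V hV hV'
    obtain ⟨t, ht⟩ : ∃ t, (p * q * q').eval t ≠ 0 := by
      by_contra! hall
      exact mul_ne_zero (mul_ne_zero hp0 hq0) hq'0 (Polynomial.funext fun t => by simp [hall t])
    rw [eval_mul, eval_mul] at ht
    have hts : t ∈ s := left_ne_zero_of_mul (left_ne_zero_of_mul ht)
    exact ⟨γ t, ⟨t, hts, rfl⟩, hq t hts (right_ne_zero_of_mul (left_ne_zero_of_mul ht)),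
      hq' t hts (right_ne_zero_of_mul ht)⟩
  have hγ0 : γ 0 = 1 := by
    have h2 := (hγ 0 h0).2
    rw [hP] at h2
    exact h2.eq_gl hasMat_one
  refine hirr.isPreconnected.subset_connectedComponentIn (F := (G : Set (GLp F K W)))
    ⟨0, h0, hγ0⟩ ?_ ⟨1, h1, (hγ 1 h1).2.eq_gl hh⟩
  rintro _ ⟨t, ht, rfl⟩
  exact (hγ t ht).1

/-- A polynomial function `φ` does not vanish on the identity component of `G` if it does not
vanish at `1` and its vanishing locus in `G` is open. -/
theorem ne_zero_of_mem_idCompField {G : Subgroup (GLp F K W)}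
    {φ θ : Module.End K (K ⊗[F] W) → K} (hφ : φ ∈ polyFun K (Module.End K (K ⊗[F] W)))
    (hθ : θ ∈ polyFun K (Module.End K (K ⊗[F] W)))
    (hmul : ∀ g ∈ G, φ (g : K ⊗[F] W →ₗ[K] K ⊗[F] W) * θ (g : K ⊗[F] W →ₗ[K] K ⊗[F] W) = 0)
    (hor : ∀ g ∈ G, φ (g : K ⊗[F] W →ₗ[K] K ⊗[F] W) ≠ 0 ∨
      θ (g : K ⊗[F] W →ₗ[K] K ⊗[F] W) ≠ 0)
    (h1 : φ ((1 : GLp F K W) : K ⊗[F] W →ₗ[K] K ⊗[F] W) ≠ 0) {g : GLp F K W}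
    (hg : g ∈ idCompField K G) : φ (g : K ⊗[F] W →ₗ[K] K ⊗[F] W) ≠ 0 := by
  let _ : TopologicalSpace (Module.End K (K ⊗[F] W)) := zariski K (Module.End K (K ⊗[F] W))
  let _ : TopologicalSpace (GLp F K W) := zariskiGL K
  have hsub : idCompField K G ⊆ G := connectedComponentIn_subset _ _
  have hc : IsPreconnected (idCompField K G) := isPreconnected_connectedComponentIn
  have hopen : ∀ q ∈ polyFun K (Module.End K (K ⊗[F] W)),
      IsOpen {g : GLp F K W | q (g : K ⊗[F] W →ₗ[K] K ⊗[F] W) ≠ 0} := fun q hq =>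
    ⟨_, TopologicalSpace.isOpen_generateFrom_of_mem ⟨q, hq, rfl⟩, rfl⟩
  intro h0
  -- The loci where `φ`, respectively `θ`, does not vanish are disjoint on `G` and cover it. The
  -- connected identity component meets the first in `1`, so it cannot meet the second.
  obtain ⟨x, hx, hx1, hx2⟩ := hc _ _ (hopen φ hφ) (hopen θ hθ) (fun x hx => hor x (hsub hx))
    ⟨1, one_mem_idCompField K G, h1⟩
    ⟨g, hg, (hor g (hsub hg)).resolve_left fun h => h h0⟩
  exact mul_ne_zero hx1 hx2 (hmul x (hsub hx))

/-- The matrix of an endomorphism, specialized along `χ`. -/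
noncomputable def specMat (χ : K ⊗[F] E →ₐ[K] K) (T : Module.End K (K ⊗[F] W)) : Matrix ι ι K :=
  Matrix.of fun k l => χ (coordR b K (T ((1 : K) ⊗ₜ[F] b l)) k)

theorem HasMat.specMat_eq {b : Module.Basis ι E W} {g : GLp F K W} {M : Matrix ι ι (K ⊗[F] E)}
    (h : HasMat b g M) (χ : K ⊗[F] E →ₐ[K] K) :
    specMat b χ (g : K ⊗[F] W →ₗ[K] K ⊗[F] W) = M.map χ := by
  ext k l
  change χ (coordR b K (g ((1 : K) ⊗ₜ[F] b l)) k) = _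
  rw [h, coordR_basis, Matrix.mulVec_single_one]
  rfl

theorem specMat_mem_polyFun (χ : K ⊗[F] E →ₐ[K] K) (k l : ι) :
    (fun T => specMat b χ T k l) ∈ polyFun K (Module.End K (K ⊗[F] W)) :=
  Algebra.subset_adjoin ⟨χ.toLinearMap ∘ₗ LinearMap.proj k ∘ₗ (coordR b K).toLinearMap ∘ₗ
    LinearMap.applyₗ ((1 : K) ⊗ₜ[F] b l), rfl⟩

theorem det_specMat_mem_polyFun (χ : K ⊗[F] E →ₐ[K] K) :
    (fun T => (specMat b χ T).det) ∈ polyFun K (Module.End K (K ⊗[F] W)) := by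
  have h1 : (fun T => (specMat b χ T).det) = ∑ τ : Equiv.Perm ι,
      (Equiv.Perm.sign τ : ℤ) • ∏ k, fun T => specMat b χ T (τ k) k := by
    ext T
    rw [Matrix.det_apply, Finset.sum_apply]
    refine Finset.sum_congr rfl fun τ _ => ?_
    rw [Pi.smul_apply, Finset.prod_apply]
    rfl
  rw [h1]
  exact sum_mem fun τ _ => zsmul_mem (prod_mem fun k _ => specMat_mem_polyFun b χ _ _) _

/-- A geometric point of `E`. -/
noncomputable def geomPoint (F : Type u) [Field F] (E : Type v) [Field E] [Algebra F E]
    [Algebra.IsAlgebraic F E] (K : Type u) [Field K] [IsAlgClosed K] [Algebra F K] :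
    K ⊗[F] E →ₐ[K] K :=
  Algebra.TensorProduct.lift (Algebra.ofId K K) (IsAlgClosed.lift : E →ₐ[F] K)
    fun _ _ => Commute.all _ _

end Zariski

/-! ### The identity component of the quaternionic similitude group -/

section IdentityComponent

variable {F : Type u} [Field F] {E : Type v} [Field E] [Algebra F E]
  [Algebra.IsQuadraticExtension F E] {V : Type w} [AddCommGroup V] [Module E V] [Module F V]
  [IsScalarTower F E V] {ρ : E ≃ₐ[F] E} {H : V →ₛₗ[(ρ : E →+* E)] V →ₗ[E] E}
  {d : (⋀[E]^4 V) ≃ₗ[E] E} {hψ : Function.Bijective (psi d)} {J : F} {i : E}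

/-- The algebraic closure of the residue field: an element of a local ring with nonzero residue is a
unit. -/
theorem exists_geometric_point (F : Type u) [Field F] (R : Type u) [CommRing R] [Algebra F R]
    [IsLocalRing R] : ∃ (K : Type u) (_ : Field K) (_ : IsAlgClosed K) (_ : Algebra F K)
      (f : R →ₐ[F] K), ∀ r, f r ≠ 0 → IsUnit r := by
  refine ⟨AlgebraicClosure (IsLocalRing.ResidueField R), inferInstance, inferInstance,
    inferInstance, (IsScalarTower.toAlgHom F (IsLocalRing.ResidueField R)
      (AlgebraicClosure (IsLocalRing.ResidueField R))).comp
      (IsScalarTower.toAlgHom F R (IsLocalRing.ResidueField R)), fun r hr => ?_⟩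
  by_contra hu
  refine hr ?_
  have h1 : algebraMap R (IsLocalRing.ResidueField R) r = 0 :=
    Ideal.Quotient.eq_zero_iff_mem.mpr hu
  change algebraMap _ _ (algebraMap R (IsLocalRing.ResidueField R) r) = 0
  rw [h1, map_zero]

theorem IsQuatSim.isUnit_det {R A : Type*} [CommRing R] [CommRing A] [Algebra R A]
    {σ : A ≃ₐ[R] A} {α : Fin 4 → R} {δ : A} {X : Matrix (Fin 6) (Fin 6) A} {μ : R}
    (hμ : IsUnit μ) (h : IsQuatSim σ α δ X μ) : IsUnit X.det := by
  have h1 : X.det ^ 2 = (algebraMap R A μ) ^ 6 := det_sq_of_gram (by rw [h.2, algebraMap_smul])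
  refine (isUnit_pow_iff two_ne_zero).mp ?_
  rw [h1]
  exact (hμ.map _).pow 6

namespace OrthoBasis

variable (b : OrthoBasis H) (h2 : (2 : F) ≠ 0) (hi : i ≠ 0) (hi' : ρ i = -i)

section Multiplier

variable {K : Type u} [Field K] [Algebra F K] (χ : K ⊗[F] E →ₐ[K] K)

/-- The similitude factor, as a polynomial function. -/
noncomputable def multiplier (T : Module.End K (K ⊗[F] (⋀[E]^2 V))) : K :=
  ((specMat b.basis₂ χ T).transpose * wedgeGram K * specMat b.basis₂ χ T) 0 5

omit [Algebra.IsQuadraticExtension F E] in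
theorem multiplier_mem_polyFun :
    b.multiplier χ ∈ polyFun K (Module.End K (K ⊗[F] (⋀[E]^2 V))) := by
  have h1 : b.multiplier χ = ∑ l, (∑ k, (fun T => specMat b.basis₂ χ T k 0) *
      algebraMap K (Module.End K (K ⊗[F] (⋀[E]^2 V)) → K) (wedgeGram K k l)) *
      fun T => specMat b.basis₂ χ T l 5 := by
    ext T
    rw [multiplier, Matrix.mul_apply, Finset.sum_apply]
    refine Finset.sum_congr rfl fun l _ => ?_
    rw [Pi.mul_apply, Matrix.mul_apply, Finset.sum_apply]
    rfl
  rw [h1]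
  exact sum_mem fun l _ => mul_mem (sum_mem fun k _ => mul_mem (specMat_mem_polyFun _ χ _ _)
    (Subalgebra.algebraMap_mem _ _)) (specMat_mem_polyFun _ χ _ _)

omit [Algebra.IsQuadraticExtension F E] in
theorem multiplier_eq {g : GLp F K (⋀[E]^2 V)} {X : Matrix (Fin 6) (Fin 6) (K ⊗[F] E)}
    (hX : HasMat b.basis₂ g X) {ν : K}
    (h : X.transpose * wedgeGram (K ⊗[F] E) * X = ν • wedgeGram (K ⊗[F] E)) :
    b.multiplier χ (g : K ⊗[F] (⋀[E]^2 V) →ₗ[K] K ⊗[F] (⋀[E]^2 V)) = ν := by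
  have h1 := congrArg (fun N : Matrix (Fin 6) (Fin 6) (K ⊗[F] E) =>
    N.map (χ : K ⊗[F] E →+* K)) h
  simp only [Matrix.map_mul, wedgeGram_map, Matrix.transpose_map] at h1
  have h3 := congrFun (congrFun h1 0) 5
  rw [multiplier, hX.specMat_eq]
  refine h3.trans ?_
  change χ (ν • wedgeGram (K ⊗[F] E) 0 5) = ν
  rw [map_smul]
  change ν • χ 1 = ν
  rw [map_one, smul_eq_mul, mul_one]

end Multiplier

include h2 hi hi' in
-- The hypothesis `hG` is phrased so that the same curve serves the full group and the subgroup
-- preserving a decomposition.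
theorem exists_curve_GUB (hL : ∀ x, opL H d hψ (opL H d hψ x) = J • x) (hJ : J ≠ 0)
    {K : Type u} [Field K] [IsAlgClosed K] [Algebra F K]
    {M : Matrix (Fin 4) (Fin 4) (K ⊗[F] E)} {ν : K} (hν : IsUnit ν)
    (hM : IsUnitarySim (conjR ρ K) (b.coeffR K) M ν) {c : K ⊗[F] E} (hc : IsUnit c)
    (hcM : c * M.det = algebraMap K (K ⊗[F] E) (ν ^ 2) * conjR ρ K c)
    {h : GLp F K (⋀[E]^2 V)} (hh : HasMat b.basis₂ h (c • compound M))
    {G : Subgroup (GLp F K (⋀[E]^2 V))}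
    (hG : ∀ g ∈ GUB H d hψ i J K, ∀ X, HasMat b.basis₂ g X → (Commute M (splitMat (K ⊗[F] E)) →
      Commute X (compound (splitMat (K ⊗[F] E)))) → g ∈ G) :
    h ∈ idCompField K G := by
  have hq := isQuadInvol_conjR h2 hi hi' K
  obtain ⟨P, p, h0, h1, hP0, hP1, hP⟩ := hM.exists_curve (δ := b.discR d K) hq (geomPoint F E K)
    b.isUnit_coeffR hν hc hcM
  refine mem_idCompField_of_curve b.basis₂ h0 h1 hP0 (fun t ht => ?_) (hP1 ▸ hh)
  obtain ⟨⟨μ, hμ, hX⟩, hcomm⟩ := hP t ht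
  obtain ⟨g, hg⟩ := exists_hasMat b.basis₂ (hX.isUnit_det hμ)
  exact ⟨g, hG g ((b.mem_GUB_iff hL hJ hi).mpr ⟨_, hg, μ, hμ, hX⟩) _ hg hcomm, hg⟩

variable {R : Type u} [CommRing R] [Algebra F R]

include h2 hi hi' in
-- Membership is tested at geometric points, and the defining equations of `M` and `c` are preserved
-- by specialization.
theorem mem_idComp_of_isUnitarySim (hL : ∀ x, opL H d hψ (opL H d hψ x) = J • x) (hJ : J ≠ 0)
    {M : Matrix (Fin 4) (Fin 4) (R ⊗[F] E)} {ν : R} (hν : IsUnit ν)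
    (hM : IsUnitarySim (conjR ρ R) (b.coeffR R) M ν) {c : R ⊗[F] E} (hc : IsUnit c)
    (hcM : c * M.det = algebraMap R (R ⊗[F] E) (ν ^ 2) * conjR ρ R c)
    {h : GLp F R (⋀[E]^2 V)} (hh : HasMat b.basis₂ h (c • compound M))
    (G : ∀ (S : Type u) [CommRing S] [Algebra F S], Subgroup (GLp F S (⋀[E]^2 V)))
    (hG : ∀ (S : Type u) [CommRing S] [Algebra F S] (f : R →ₐ[F] S), ∀ g ∈ GUB H d hψ i J S,
      ∀ X, HasMat b.basis₂ g X → (Commute (M.map (mapE E f)) (splitMat (S ⊗[F] E)) →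
      Commute X (compound (splitMat (S ⊗[F] E)))) → g ∈ G S) :
    h ∈ idComp G R := by
  refine ⟨?_, fun K _ _ _ f => ?_⟩
  · obtain ⟨μ, hμ, -, hX⟩ := hM.isQuatSim (δ := b.discR d R) (isQuadInvol_conjR h2 hi hi' R)
      b.isUnit_coeffR hν hc hcM
    refine hG R (AlgHom.id F R) h ((b.mem_GUB_iff hL hJ hi).mpr ⟨_, hh, μ, hμ, hX⟩) _ hh ?_
    have h1 : M.map (mapE E (AlgHom.id F R)) = M := by
      ext k l
      change mapE E (AlgHom.id F R) (M k l) = M k l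
      rw [mapE, Algebra.TensorProduct.map_id]
      rfl
    rw [h1]
    intro h3
    exact (Commute.compound h3).smul_left c
  · have h1 : (c • compound M).map (mapE E f) =
        mapE E f c • compound (M.map (mapE E f)) := by
      have h3 := compound_map (mapE E f : R ⊗[F] E →+* K ⊗[F] E) M
      ext k l
      have h4 := congrFun (congrFun h3 k) l
      change mapE E f (c * compound M k l) = mapE E f c * compound (M.map (mapE E f)) k l
      rw [map_mul]
      exact congrArg _ h4.symm
    have h3 := hh.glMap f
    rw [h1] at h3
    refine b.exists_curve_GUB h2 hi hi' hL hJ (hν.map f) (b.isUnitarySim_map f hM)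
      (hc.map (mapE E f)) ?_ h3 (hG K f)
    have h5 := congrArg (mapE E f) hcM
    rw [map_mul, map_mul, mapE_algebraMap, mapE_conjR, map_pow] at h5
    rw [← h5]
    congr 1
    exact ((mapE E f : R ⊗[F] E →+* K ⊗[F] E).map_det M).symm

include h2 hi hi' in
theorem mem_GUB0_of_isUnitarySim (hL : ∀ x, opL H d hψ (opL H d hψ x) = J • x) (hJ : J ≠ 0)
    {M : Matrix (Fin 4) (Fin 4) (R ⊗[F] E)} {ν : R} (hν : IsUnit ν)
    (hM : IsUnitarySim (conjR ρ R) (b.coeffR R) M ν) {c : R ⊗[F] E} (hc : IsUnit c)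
    (hcM : c * M.det = algebraMap R (R ⊗[F] E) (ν ^ 2) * conjR ρ R c)
    {h : GLp F R (⋀[E]^2 V)} (hh : HasMat b.basis₂ h (c • compound M)) :
    h ∈ GUB0 H d hψ i J R :=
  b.mem_idComp_of_isUnitarySim h2 hi hi' hL hJ hν hM hc hcM hh _ fun _ _ _ _ _ hg _ _ _ => hg

include h2 hi hi' in
theorem IsAdapted.mem_GUB₂0_of_isUnitarySim {b : OrthoBasis H} {V₁ V₂ : Submodule E V}
    (hb : b.IsAdapted V₁ V₂) (hL : ∀ x, opL H d hψ (opL H d hψ x) = J • x) (hJ : J ≠ 0)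
    {M : Matrix (Fin 4) (Fin 4) (R ⊗[F] E)} {ν : R} (hν : IsUnit ν)
    (hM : IsUnitarySim (conjR ρ R) (b.coeffR R) M ν) {c : R ⊗[F] E} (hc : IsUnit c)
    (hcM : c * M.det = algebraMap R (R ⊗[F] E) (ν ^ 2) * conjR ρ R c)
    {h : GLp F R (⋀[E]^2 V)} (hh : HasMat b.basis₂ h (c • compound M))
    (hMs : Commute M (splitMat (R ⊗[F] E))) :
    h ∈ GUB₂0 H d hψ i J V₁ V₂ R := by
  refine b.mem_idComp_of_isUnitarySim h2 hi hi' hL hJ hν hM hc hcM hh _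
    fun S _ _ f g hg X hX hcomm => ⟨hg, ?_⟩
  refine (hb.mem_stab_sharp_iff (isQuadInvol_conjR h2 hi hi' S).two' hX).mpr (hcomm ?_)
  rw [splitMat_eq, commute_signMat_iff (isQuadInvol_conjR h2 hi hi' R).two'] at hMs
  rw [splitMat_eq, commute_signMat_iff (isQuadInvol_conjR h2 hi hi' S).two']
  intro k l hkl
  rw [Matrix.map_apply, hMs k l hkl, map_zero]

include h2 hi hi' in
-- On the whole group `det² = μ⁶`, so the loci `det + μ³ ≠ 0` and `det - μ³ ≠ 0` are complementary
-- open sets; the first contains `1`. A geometric point `χ` of `E` turns determinant and factor into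
-- polynomial functions with values in `K`, and loses nothing because `det X` lies in `K`.
theorem det_eq_of_mem_idCompField (hL : ∀ x, opL H d hψ (opL H d hψ x) = J • x) (hJ : J ≠ 0)
    {K : Type u} [Field K] [IsAlgClosed K] [Algebra F K] {h : GLp F K (⋀[E]^2 V)}
    (hh : h ∈ idCompField K (GUB H d hψ i J K)) {X : Matrix (Fin 6) (Fin 6) (K ⊗[F] E)}
    (hX : HasMat b.basis₂ h X) {ν : K}
    (hν : IsQuatSim (conjR ρ K) (b.coeffR K) (b.discR d K) X ν) :
    X.det = algebraMap K (K ⊗[F] E) (ν ^ 3) := by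
  have hq := isQuadInvol_conjR h2 hi hi' K
  let χ := geomPoint F E K
  have hmapdet : ∀ Y : Matrix (Fin 6) (Fin 6) (K ⊗[F] E), (Y.map χ).det = χ Y.det := fun Y =>
    ((χ : K ⊗[F] E →+* K).map_det Y).symm
  have h2K : (2 : K) ≠ 0 := hq.two.ne_zero
  have hdetm := det_specMat_mem_polyFun b.basis₂ χ
  have hmm := (polyFun K (Module.End K (K ⊗[F] (⋀[E]^2 V)))).pow_mem
    (b.multiplier_mem_polyFun χ) 3
  have hmul : ∀ g ∈ GUB H d hψ i J K, ∃ μ : K, μ ≠ 0 ∧ b.multiplier χ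
      (g : K ⊗[F] (⋀[E]^2 V) →ₗ[K] K ⊗[F] (⋀[E]^2 V)) = μ ∧
      (specMat b.basis₂ χ (g : K ⊗[F] (⋀[E]^2 V) →ₗ[K] K ⊗[F] (⋀[E]^2 V))).det ^ 2 = μ ^ 6 := by
    intro g hg
    obtain ⟨Y, hY, μ, hμ, hYμ⟩ := (b.mem_GUB_iff hL hJ hi).mp hg
    refine ⟨μ, hμ.ne_zero, b.multiplier_eq χ hY hYμ.2, ?_⟩
    have h1 : Y.det ^ 2 = (algebraMap K (K ⊗[F] E) μ) ^ 6 :=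
      det_sq_of_gram (by rw [hYμ.2, algebraMap_smul])
    rw [hY.specMat_eq, hmapdet, ← map_pow, h1, ← map_pow, AlgHom.commutes]
    rfl
  have h3 := ne_zero_of_mem_idCompField (add_mem hdetm hmm) (sub_mem hdetm hmm)
    (fun g hg => by
      obtain ⟨μ, -, h3, h4⟩ := hmul g hg
      simp only [Pi.add_apply, Pi.sub_apply, Pi.pow_apply, h3]
      linear_combination h4)
    (fun g hg => by
      obtain ⟨μ, hμ, h3, -⟩ := hmul g hg
      simp only [Pi.add_apply, Pi.sub_apply, Pi.pow_apply, h3]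
      by_contra! hcon
      have h5 : 2 * μ ^ 3 = 0 := by linear_combination hcon.1 - hcon.2
      exact mul_ne_zero h2K (pow_ne_zero 3 hμ) h5)
    (by
      have h4 := b.multiplier_eq χ (hasMat_one (b := b.basis₂)) (ν := 1) (by simp)
      simp only [Pi.add_apply, Pi.pow_apply, h4,
        (hasMat_one (b := b.basis₂) (R := K)).specMat_eq χ, hmapdet, Matrix.det_one, map_one]
      norm_num
      exact h2K) hh
  have h4 : h ∈ GUB H d hψ i J K := by
    let _ : TopologicalSpace (GLp F K (⋀[E]^2 V)) := zariskiGL K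
    exact connectedComponentIn_subset _ _ hh
  obtain ⟨μ, hμ, h5, h6⟩ := hmul h h4
  rw [b.multiplier_eq χ hX hν.2] at h5
  subst h5
  simp only [Pi.add_apply, Pi.pow_apply, b.multiplier_eq χ hX hν.2] at h3
  obtain ⟨r, hr⟩ := hq.exists_of_fixed (hν.det_fixed b.isUnit_coeffR (b.isUnit_discR d))
  rw [hX.specMat_eq, hmapdet, ← hr, AlgHom.commutes] at h3 h6
  rw [← hr]
  congr 1
  have h7 : (r + ν ^ 3) * (r - ν ^ 3) = 0 := by
    have h8 : r ^ 2 = ν ^ 6 := h6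
    linear_combination h8
  exact sub_eq_zero.mp ((mul_eq_zero.mp h7).resolve_left h3)

include h2 hi hi' in
-- On the plane with indices `0, 5` every element is diagonal or antidiagonal after specialization
-- along `χ`. The two cases are the loci where `X 0 0 * X 5 5`, respectively `X 5 0 * X 0 5`, does
-- not vanish, and `1` is in the first.
theorem IsAdapted.entries_ne_zero {b : OrthoBasis H} {V₁ V₂ : Submodule E V}
    (hb : b.IsAdapted V₁ V₂) (hL : ∀ x, opL H d hψ (opL H d hψ x) = J • x) (hJ : J ≠ 0)
    {K : Type u} [Field K] [IsAlgClosed K] [Algebra F K] {h : GLp F K (⋀[E]^2 V)}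
    (hh : h ∈ idCompField K (GUB₂ H d hψ i J V₁ V₂ K)) {X : Matrix (Fin 6) (Fin 6) (K ⊗[F] E)}
    (hX : HasMat b.basis₂ h X) : X 0 0 * X 5 5 ≠ 0 := by
  have hq := isQuadInvol_conjR h2 hi hi' K
  let χ := geomPoint F E K
  have hent := fun k l => specMat_mem_polyFun b.basis₂ χ k l
  have hmul : ∀ g ∈ GUB₂ H d hψ i J V₁ V₂ K, ∃ Y : Matrix (Fin 6) (Fin 6) (K ⊗[F] E),
      specMat b.basis₂ χ (g : K ⊗[F] (⋀[E]^2 V) →ₗ[K] K ⊗[F] (⋀[E]^2 V)) = Y.map χ ∧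
      Y 0 0 * Y 5 0 = 0 ∧ ∃ μ : K, μ ≠ 0 ∧
      Y 0 0 * Y 5 5 + Y 5 0 * Y 0 5 = algebraMap K (K ⊗[F] E) μ := by
    rintro g ⟨hg, hg'⟩
    obtain ⟨Y, hY, μ, hμ, hYμ⟩ := (b.mem_GUB_iff hL hJ hi).mp hg
    obtain ⟨-, -, h3, -, h4, -⟩ := hYμ.entries hq.two' b.isUnit_coeffR (b.isUnit_discR d)
      ((hb.mem_stab_sharp_iff hq.two' hY).mp hg')
    exact ⟨Y, hY.specMat_eq χ, h3, μ, hμ.ne_zero, h4⟩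
  have h3 := ne_zero_of_mem_idCompField (mul_mem (hent 0 0) (hent 5 5))
    (mul_mem (hent 5 0) (hent 0 5))
    (fun g hg => by
      obtain ⟨Y, h3, h4, -⟩ := hmul g hg
      have h5 := congrArg χ h4
      rw [map_mul, map_zero] at h5
      simp only [Pi.mul_apply, h3, Matrix.map_apply]
      linear_combination χ (Y 5 5) * χ (Y 0 5) * h5)
    (fun g hg => by
      obtain ⟨Y, h3, -, μ, hμ, h4⟩ := hmul g hg
      have h5 := congrArg χ h4
      rw [map_add, map_mul, map_mul, AlgHom.commutes] at h5
      simp only [Pi.mul_apply, h3, Matrix.map_apply]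
      by_contra! hcon
      rw [hcon.1, hcon.2, add_zero] at h5
      exact hμ h5.symm)
    (by
      simp only [Pi.mul_apply, (hasMat_one (b := b.basis₂) (R := K)).specMat_eq χ,
        Matrix.map_apply, Matrix.one_apply_eq, map_one, mul_one]
      exact one_ne_zero) hh
  intro h0
  refine h3 ?_
  simp only [Pi.mul_apply, hX.specMat_eq, Matrix.map_apply, ← map_mul, h0, map_zero]

variable [IsLocalRing R]

include h2 hi hi' in
-- The determinant comes from some `r` in `R` with `r² = ν⁶`. The factor `r + ν³` reduces to `2 ν³ ≠
-- 0` at a geometric point of the residue field, so it is a unit and can be cancelled.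
theorem det_eq_of_mem_GUB0 (hL : ∀ x, opL H d hψ (opL H d hψ x) = J • x) (hJ : J ≠ 0)
    {h : GLp F R (⋀[E]^2 V)} (hh : h ∈ GUB0 H d hψ i J R)
    {X : Matrix (Fin 6) (Fin 6) (R ⊗[F] E)} (hX : HasMat b.basis₂ h X) {ν : R} (hνu : IsUnit ν)
    (hν : IsQuatSim (conjR ρ R) (b.coeffR R) (b.discR d R) X ν) :
    X.det = algebraMap R (R ⊗[F] E) (ν ^ 3) := by
  have hq := isQuadInvol_conjR h2 hi hi' R
  obtain ⟨K, _, _, _, f, hf⟩ := exists_geometric_point F R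
  have h1 := b.det_eq_of_mem_idCompField h2 hi hi' hL hJ (hh.2 K f) (hX.glMap f)
    (b.isQuatSim_map f hν)
  obtain ⟨r, hr⟩ := hq.exists_of_fixed (hν.det_fixed b.isUnit_coeffR (b.isUnit_discR d))
  have h3 : (X.map (mapE E f)).det = mapE E f X.det :=
    ((mapE E f : R ⊗[F] E →+* K ⊗[F] E).map_det X).symm
  rw [h3, ← hr, mapE_algebraMap] at h1
  have h4 : f r = f ν ^ 3 := (isQuadInvol_conjR h2 hi hi' K).inj h1
  have h5 : X.det ^ 2 = (algebraMap R (R ⊗[F] E) ν) ^ 6 :=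
    det_sq_of_gram (by rw [hν.2, algebraMap_smul])
  rw [← hr, ← map_pow, ← map_pow] at h5
  have h6 : r ^ 2 = ν ^ 6 := hq.inj h5
  have h7 : IsUnit (r + ν ^ 3) := by
    refine hf _ ?_
    have h8 : f (r + ν ^ 3) = 2 * f ν ^ 3 := by
      rw [map_add, map_pow, h4]
      ring
    rw [h8]
    exact mul_ne_zero (isQuadInvol_conjR h2 hi hi' K).two.ne_zero (pow_ne_zero 3 (hνu.map f).ne_zero)
  rw [← hr]
  congr 1
  refine sub_eq_zero.mp (h7.mul_left_cancel ?_)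
  linear_combination h6

include h2 hi hi' in
theorem exists_of_mem_GUB0 (hL : ∀ x, opL H d hψ (opL H d hψ x) = J • x) (hJ : J ≠ 0)
    {h : GLp F R (⋀[E]^2 V)} (hh : h ∈ GUB0 H d hψ i J R) :
    ∃ (M : Matrix (Fin 4) (Fin 4) (R ⊗[F] E)) (c : R ⊗[F] E) (ν μ : R), IsUnit ν ∧ IsUnit c ∧
      IsUnit μ ∧ IsUnitarySim (conjR ρ R) (b.coeffR R) M ν ∧
      IsQuatSim (conjR ρ R) (b.coeffR R) (b.discR d R) (c • compound M) μ ∧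
      HasMat b.basis₂ h (c • compound M) := by
  obtain ⟨X, hX, μ, hμ, hXμ⟩ := (b.mem_GUB_iff hL hJ hi).mp hh.1
  obtain ⟨M, c, ν, hν, hc, hM, rfl⟩ := hXμ.exists_eq_smul_compound
    (isQuadInvol_conjR h2 hi hi' R) b.isUnit_coeffR (b.isUnit_discR d) hμ
    (b.det_eq_of_mem_GUB0 h2 hi hi' hL hJ hh hX hμ hXμ)
  exact ⟨M, c, ν, μ, hν, hc, hμ, hM, hXμ, hX⟩

include h2 hi hi' in
-- Since `X 0 0 = σ (X 5 5)`, the product of these entries is a norm from `R ⊗ E`. It is nonzero at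
-- a geometric point of the residue field, hence a unit; so the antidiagonal entries vanish and
-- `commute_splitMat` applies.
theorem IsAdapted.commute_of_mem_GUB₂0 {b : OrthoBasis H} {V₁ V₂ : Submodule E V}
    (hb : b.IsAdapted V₁ V₂) (hL : ∀ x, opL H d hψ (opL H d hψ x) = J • x) (hJ : J ≠ 0)
    {h : GLp F R (⋀[E]^2 V)} (hh : h ∈ GUB₂0 H d hψ i J V₁ V₂ R)
    {M : Matrix (Fin 4) (Fin 4) (R ⊗[F] E)} {c : R ⊗[F] E} (hc : IsUnit c) {μ : R}
    (hX : IsQuatSim (conjR ρ R) (b.coeffR R) (b.discR d R) (c • compound M) μ)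
    (hM : HasMat b.basis₂ h (c • compound M)) : Commute M (splitMat (R ⊗[F] E)) := by
  have hq := isQuadInvol_conjR h2 hi hi' R
  obtain ⟨e0, e5, e50, e05, -, eσ⟩ := hX.entries hq.two' b.isUnit_coeffR (b.isUnit_discR d)
    ((hb.mem_stab_sharp_iff hq.two' hM).mp hh.1.2)
  obtain ⟨K, _, _, _, f, hf⟩ := exists_geometric_point F R
  have h1 := hb.entries_ne_zero h2 hi hi' hL hJ (hh.2 K f) (hM.glMap f)
  obtain ⟨n, hn⟩ := hq.exists_norm ((c • compound M) 5 5)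
  have hn' : IsUnit n := by
    refine hf n fun h0 => h1 ?_
    rw [Matrix.map_apply, Matrix.map_apply, ← map_mul, eσ, mul_comm, ← hn, mapE_algebraMap, h0,
      map_zero]
  have u5 : IsUnit ((c • compound M) 5 5) := isUnit_of_mul_isUnit_left (hn ▸ hn'.map _)
  have u0 : IsUnit ((c • compound M) 0 0) := eσ ▸ u5.map (conjR ρ R)
  have z50 : (c • compound M) 5 0 = 0 := u0.mul_left_cancel (by rw [e50, mul_zero])
  have z05 : (c • compound M) 0 5 = 0 := u5.mul_right_cancel (by rw [e05, zero_mul])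
  have hz : ∀ I J, (c • compound M) I J = 0 → compound M I J = 0 := fun I J h =>
    hc.mul_left_cancel (by rw [mul_zero]; exact h)
  refine commute_splitMat (fun I hI => hz I 0 ?_) (fun I hI => hz I 5 ?_)
    (isUnit_of_mul_isUnit_right u0) (isUnit_of_mul_isUnit_right u5)
  · by_cases h5 : I = 5
    · rw [h5, z50]
    · exact e0 I hI h5
  · by_cases h0 : I = 0
    · rw [h0, z05]
    · exact e5 I h0 hI

end OrthoBasis

end IdentityComponent

/-! ### The isogeny and the isomorphism -/

/-- A relation between groups that is a multiplicative correspondence induces an isomorphism of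
quotients. -/
theorem exists_quotient_mulEquiv {G G' : Type*} [Group G] [Group G'] (r : G → G' → Prop)
    (hmul : ∀ {g h g' h'}, r g h → r g' h' → r (g * g') (h * h'))
    (hinv : ∀ {g h}, r g h → r g⁻¹ h⁻¹) (hl : ∀ g, ∃ h, r g h) (hr : ∀ h, ∃ g, r g h)
    (N : Subgroup G) [N.Normal] (N' : Subgroup G') [N'.Normal]
    (hN : ∀ {g h}, r g h → (g ∈ N ↔ h ∈ N')) (hN' : ∀ h ∈ N', r 1 h) :
    ∃ e : G ⧸ N ≃* G' ⧸ N', ∀ (g : G) (h : G'), e (g : G ⧸ N) = (h : G' ⧸ N') ↔ r g h := by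
  choose φ hφ using hl
  have huniq : ∀ {g h h'}, r g h → r g h' → (h : G' ⧸ N') = h' := by
    intro g h h' h1 h2
    refine QuotientGroup.eq.mpr ((hN ?_).mp N.one_mem)
    have h3 := hmul (hinv h1) h2
    rwa [inv_mul_cancel] at h3
  let Φ : G →* G' ⧸ N' :=
    MonoidHom.mk' (fun g => (φ g : G' ⧸ N')) fun g g' =>
      huniq (hφ (g * g')) (hmul (hφ g) (hφ g'))
  have hker : Φ.ker = N := by
    ext g
    rw [MonoidHom.mem_ker, hN (hφ g)]
    exact QuotientGroup.eq_one_iff _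
  have hsurj : Function.Surjective Φ := by
    intro y
    induction y using QuotientGroup.induction_on with
    | H h =>
      obtain ⟨g, hg⟩ := hr h
      exact ⟨g, huniq (hφ g) hg⟩
  refine ⟨(QuotientGroup.quotientMulEquivOfEq hker.symm).trans
    (QuotientGroup.quotientKerEquivOfSurjective Φ hsurj), fun g h => ?_⟩
  change ((φ g : G' ⧸ N') = h) ↔ _
  refine ⟨fun h1 => ?_, fun h1 => huniq (hφ g) h1⟩
  -- The chosen partner `φ g` differs from `h` by an element of `N'`, which by `hN'` is related to
  -- `1`.
  have h2 := hmul (hφ g) (hN' _ (QuotientGroup.eq.mp h1))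
  rwa [mul_one, mul_inv_cancel_left] at h2

/-! ### The correspondence between `g` and `β ⋀² g` -/

section Lift

variable {F : Type u} [Field F] {E : Type v} [Field E] [Algebra F E]
  [Algebra.IsQuadraticExtension F E] {V : Type w} [AddCommGroup V] [Module E V] [Module F V]
  [IsScalarTower F E V] {ρ : E ≃ₐ[F] E} {H : V →ₛₗ[(ρ : E →+* E)] V →ₗ[E] E}
  {R : Type u} [CommRing R] [Algebra F R]

omit [Algebra.IsQuadraticExtension F E] in
/-- An automorphism acts as `c ⋀² g` on wedge products if and only if it has the same matrix as
`c ⋀² g`. -/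
theorem OrthoBasis.hasMat_compound_iff (b : OrthoBasis H) {g : GLp F R V}
    {M : Matrix (Fin 4) (Fin 4) (R ⊗[F] E)} (hM : HasMat b.basis g M) {h : GLp F R (⋀[E]^2 V)}
    {c : R ⊗[F] E} : HasMat b.basis₂ h (c • compound M) ↔
      ∀ x y, h (wedgeR E R x y) = scal R c (wedgeR E R (g x) (g y)) := by
  have h1 : ∀ x y, coordR b.basis₂ R (scal R c (wedgeR E R (g x) (g y))) =
      (c • compound M).mulVec (coordR b.basis₂ R (wedgeR E R x y)) := by
    intro x y
    rw [coordR_scal, b.coordR_wedgeR, b.coordR_wedgeR, hM, hM, Matrix.smul_mulVec,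
      compound_mulVec_plucker]
  constructor
  · intro hh x y
    refine (coordR b.basis₂ R).injective ?_
    rw [hh, h1]
  · intro hh x
    have hw : ∀ x y, coordR b.basis₂ R (h (wedgeR E R x y)) =
        (c • compound M).mulVec (coordR b.basis₂ R (wedgeR E R x y)) := fun x y => by
      rw [hh, h1]
    induction x with
    | zero => simp
    | add x y hx hy => rw [map_add, map_add, hx, hy, map_add, Matrix.mulVec_add]
    | tmul r x =>
      rw [← mul_one r, ← smul_eq_mul, ← TensorProduct.smul_tmul', map_smul, map_smul, map_smul,
        Matrix.mulVec_smul]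
      congr 1
      rw [← b.basis₂.sum_repr x, TensorProduct.tmul_sum, map_sum, map_sum, map_sum,
        Matrix.mulVec_sum]
      refine Finset.sum_congr rfl fun k _ => ?_
      -- An `E`-multiple of a decomposable basis vector is again decomposable, so values on wedge
      -- products determine an `R`-linear map; its `R ⊗ E`-linearity need not be assumed.
      have h3 : (1 : R) ⊗ₜ[F] (b.basis₂.repr x k • b.basis₂ k) =
          wedgeR E R ((1 : R) ⊗ₜ[F] (b.basis₂.repr x k • b.basis (pairFst k)))
            ((1 : R) ⊗ₜ[F] b.basis (pairSnd k)) := by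
        rw [wedgeR, LinearMap.BilinMap.baseChange_tmul, mul_one]
        congr 1
        change _ = exteriorPower.ιMulti E 2 ![b.basis₂.repr x k • b.basis (pairFst k),
          b.basis (pairSnd k)]
        refine b.basis₂.repr.injective (Finsupp.ext fun l => ?_)
        rw [map_smul, Finsupp.smul_apply, b.basis₂_apply, b.repr_ιMulti, b.repr_ιMulti, map_smul]
        simp only [plucker, Finsupp.smul_apply, smul_eq_mul]
        ring
      rw [h3, hw]

variable (H) in
/-- `h = β ⋀² g` for some `β` with `β / β^ρ = ν(g)² / det g`. -/
def IsLift (g : GLp F R V) (h : GLp F R (⋀[E]^2 V)) : Prop :=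
  ∃ (hg : g ∈ GUE H R) (ν : Rˣ) (β : (R ⊗[F] E)ˣ), IsSim (hermF H) g ν ∧
    (β : R ⊗[F] E) * detE (E := E) g hg.1 =
      algebraMap R (R ⊗[F] E) ((ν : R) ^ 2) * conjR ρ R β ∧
    ∀ x y, h (wedgeR E R x y) = scal R (β : R ⊗[F] E) (wedgeR E R (g x) (g y))

theorem OrthoBasis.isLift_iff (b : OrthoBasis H) {g : GLp F R V}
    {M : Matrix (Fin 4) (Fin 4) (R ⊗[F] E)} (hM : HasMat b.basis g M) {h : GLp F R (⋀[E]^2 V)} :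
    IsLift H g h ↔ ∃ (ν : R) (β : R ⊗[F] E), IsUnit ν ∧ IsUnit β ∧
      IsUnitarySim (conjR ρ R) (b.coeffR R) M ν ∧
      β * M.det = algebraMap R (R ⊗[F] E) (ν ^ 2) * conjR ρ R β ∧
      HasMat b.basis₂ h (β • compound M) := by
  constructor
  · rintro ⟨hg, ν, β, h1, h2, h3⟩
    rw [hM.detE_eq] at h2
    exact ⟨ν, β, ν.isUnit, β.isUnit, (b.isSim_hermF_iff hM ν).mp h1, h2,
      (b.hasMat_compound_iff hM).mpr h3⟩
  · rintro ⟨_, _, ⟨ν, rfl⟩, ⟨β, rfl⟩, h1, h2, h3⟩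
    have hs := (b.isSim_hermF_iff hM ν).mpr h1
    refine ⟨⟨hM.actE_comm, ν, hs⟩, ν, β, hs, ?_, (b.hasMat_compound_iff hM).mp h3⟩
    rw [hM.detE_eq]
    exact h2

theorem OrthoBasis.exists_of_isLift (b : OrthoBasis H) {g : GLp F R V} {h : GLp F R (⋀[E]^2 V)}
    (hl : IsLift H g h) : ∃ (M : Matrix (Fin 4) (Fin 4) (R ⊗[F] E)) (ν : R) (β : R ⊗[F] E),
      HasMat b.basis g M ∧ IsUnit ν ∧ IsUnit β ∧
      IsUnitarySim (conjR ρ R) (b.coeffR R) M ν ∧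
      β * M.det = algebraMap R (R ⊗[F] E) (ν ^ 2) * conjR ρ R β ∧
      HasMat b.basis₂ h (β • compound M) := by
  have hM := hasMat_toMat b.basis g hl.1.1
  obtain ⟨ν, β, h1⟩ := (b.isLift_iff hM).mp hl
  exact ⟨_, ν, β, hM, h1⟩

theorem IsLift.mul (b : OrthoBasis H) {g g' : GLp F R V} {h h' : GLp F R (⋀[E]^2 V)}
    (hl : IsLift H g h) (hl' : IsLift H g' h') : IsLift H (g * g') (h * h') := by
  obtain ⟨M, ν, β, hM, hν, hβ, hMν, hβM, hX⟩ := b.exists_of_isLift hl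
  obtain ⟨M', ν', β', hM', hν', hβ', hMν', hβM', hX'⟩ := b.exists_of_isLift hl'
  refine (b.isLift_iff (hM.mul hM')).mpr ⟨ν * ν', β * β', hν.mul hν', hβ.mul hβ', ?_, ?_, ?_⟩
  · have h1 : conjT (conjR ρ R) (M * M') * diagR (R ⊗[F] E) (b.coeffR R) * (M * M') =
        conjT (conjR ρ R) M' * (conjT (conjR ρ R) M * diagR (R ⊗[F] E) (b.coeffR R) * M) * M' := by
      rw [ExcIso.conjT_mul]
      simp only [Matrix.mul_assoc]
    rw [IsUnitarySim, h1, hMν, Matrix.mul_smul, Matrix.smul_mul, hMν', smul_smul]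
  · rw [Matrix.det_mul, mul_pow, map_mul, map_mul]
    linear_combination (β' * M'.det) * hβM +
      (algebraMap R (R ⊗[F] E) (ν ^ 2) * conjR ρ R β) * hβM'
  · have h1 := hX.mul hX'
    rwa [Matrix.smul_mul, Matrix.mul_smul, smul_smul, ← compound_mul] at h1

/-- Homotheties are the ambiguity in the choice of `β`: any unit of `R` is fixed by the involution,
hence admissible for `g = 1`. -/
theorem IsLift.one (b : OrthoBasis H) (r : R) (hr : IsUnit r) {h : GLp F R (⋀[E]^2 V)}
    (hh : HasMat b.basis₂ h (algebraMap R (R ⊗[F] E) r • (1 : Matrix (Fin 6) (Fin 6) _))) :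
    IsLift H (1 : GLp F R V) h := by
  refine (b.isLift_iff hasMat_one).mpr ⟨1, algebraMap R _ r, isUnit_one, hr.map _, ?_, ?_, ?_⟩
  · rw [IsUnitarySim, Matrix.mul_one, one_smul, conjT]
    simp
  · rw [AlgEquiv.commutes, Matrix.det_one, one_pow, map_one, mul_one, one_mul]
  · rwa [compound_one]

theorem IsLift.inv (b : OrthoBasis H) {g : GLp F R V} {h : GLp F R (⋀[E]^2 V)}
    (hl : IsLift H g h) : IsLift H g⁻¹ h⁻¹ := by
  obtain ⟨M, ν, β, hM, ⟨ν, rfl⟩, ⟨β, rfl⟩, hMν, hβM, hX⟩ := b.exists_of_isLift hl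
  obtain ⟨N, hN, hMN, hNM⟩ := hM.exists_inv
  obtain ⟨Y, hY, hXY, hYX⟩ := hX.exists_inv
  refine (b.isLift_iff hN).mpr ⟨(ν⁻¹ : Rˣ), (β⁻¹ : (R ⊗[F] E)ˣ), ν⁻¹.isUnit, β⁻¹.isUnit, ?_, ?_, ?_⟩
  · have hN' : conjT (conjR ρ R) N * conjT (conjR ρ R) M = 1 := by
      rw [← ExcIso.conjT_mul, hMN, conjT]
      simp
    have h1 : conjT (conjR ρ R) N * (conjT (conjR ρ R) M * diagR (R ⊗[F] E) (b.coeffR R) * M) * N =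
        diagR (R ⊗[F] E) (b.coeffR R) := by
      calc _ = (conjT (conjR ρ R) N * conjT (conjR ρ R) M) * diagR (R ⊗[F] E) (b.coeffR R) *
            (M * N) := by simp only [Matrix.mul_assoc]
        _ = _ := by rw [hN', hMN, Matrix.one_mul, Matrix.mul_one]
    rw [hMν, Matrix.mul_smul, Matrix.smul_mul] at h1
    rw [IsUnitarySim]
    conv_rhs => rw [← h1, smul_smul, Units.inv_mul, one_smul]
  · have h1 : M.det * N.det = 1 := by rw [← Matrix.det_mul, hMN, Matrix.det_one]
    have h3 : conjR ρ R β * conjR ρ R ((β⁻¹ : (R ⊗[F] E)ˣ) : R ⊗[F] E) = 1 := by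
      rw [← map_mul, Units.mul_inv, map_one]
    have h4 : algebraMap R (R ⊗[F] E) ((ν : R) ^ 2) *
        algebraMap R (R ⊗[F] E) (((ν⁻¹ : Rˣ) : R) ^ 2) = 1 := by
      rw [← map_mul, ← mul_pow, Units.mul_inv, one_pow, map_one]
    have h5 : (β : R ⊗[F] E) * ((β⁻¹ : (R ⊗[F] E)ˣ) : R ⊗[F] E) = 1 := Units.mul_inv β
    generalize algebraMap R (R ⊗[F] E) ((ν : R) ^ 2) = n at *
    generalize algebraMap R (R ⊗[F] E) (((ν⁻¹ : Rˣ) : R) ^ 2) = n' at *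
    generalize conjR ρ R ((β⁻¹ : (R ⊗[F] E)ˣ) : R ⊗[F] E) = s' at *
    generalize conjR ρ R (β : R ⊗[F] E) = s at *
    generalize ((β⁻¹ : (R ⊗[F] E)ˣ) : R ⊗[F] E) = t' at *
    generalize (β : R ⊗[F] E) = t at *
    have e1 : t' * N.det = t' * N.det * (n * n') * (s * s') := by rw [h4, h3, mul_one, mul_one]
    have e2 : n' * s' = n' * s' * (t * t') * (M.det * N.det) := by rw [h5, h1, mul_one, mul_one]
    rw [e1, e2]
    linear_combination (-(t' * N.det * n' * s')) * hβM
  · have h1 : Y = ((β⁻¹ : (R ⊗[F] E)ˣ) : R ⊗[F] E) • compound N := by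
      have h2 : ((β : R ⊗[F] E) • compound M) *
          (((β⁻¹ : (R ⊗[F] E)ˣ) : R ⊗[F] E) • compound N) = 1 := by
        rw [Matrix.smul_mul, Matrix.mul_smul, smul_smul, Units.mul_inv, one_smul,
          ← compound_mul, hMN, compound_one]
      rw [← Matrix.mul_one Y, ← h2, ← Matrix.mul_assoc, hYX, Matrix.one_mul]
    rwa [← h1]

/-- `g` is a scalar if and only if `β ⋀² g` is a homothety. -/
theorem IsLift.mem_iff (b : OrthoBasis H) (h2 : (2 : F) ≠ 0) {i : E} (hi : i ≠ 0)
    (hi' : ρ i = -i) {g : GLp F R V} {h : GLp F R (⋀[E]^2 V)}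
    (hl : IsLift H g h) : g ∈ scalars E V R ↔ h ∈ homotheties (⋀[E]^2 V) R := by
  have hq := isQuadInvol_conjR h2 hi hi' R
  obtain ⟨M, ν, β, hM, hν, hβ, hMν, hβM, hX⟩ := b.exists_of_isLift hl
  rw [mem_scalars_iff b.basis, mem_homotheties_iff b.basis₂]
  constructor
  · rintro ⟨r, hr, hMr⟩
    obtain rfl := hM.eq_mat hMr
    -- A scalar `r` has factor `r σ(r)` and determinant `r⁴`. The equation for `β` then says that `β
    -- r²`, the ratio of `β ⋀² r`, is fixed.
    have h1 : algebraMap R (R ⊗[F] E) ν = r * conjR ρ R r := by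
      have h3 := hMν
      rw [IsUnitarySim, conjT_smul, Matrix.smul_mul, Matrix.smul_mul, Matrix.mul_smul,
        Matrix.mul_one, smul_smul, conjT, ← algebraMap_smul (R ⊗[F] E) ν] at h3
      simp only [Matrix.map_one, map_zero, map_one, Matrix.transpose_one, Matrix.one_mul] at h3
      rw [← smul_cancel_of_isUnit_det (isUnit_det_diagR b.isUnit_coeffR) h3, mul_comm]
    rw [Matrix.det_smul, Matrix.det_one, Fintype.card_fin, map_pow, h1] at hβM
    obtain ⟨s, hs⟩ := hq.exists_of_fixed (a := β * r ^ 2) (by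
      refine (hr.pow 2).mul_left_cancel ?_
      rw [map_mul, map_pow]
      linear_combination -hβM)
    have hsu : IsUnit s := hq.isUnit_of_algebraMap (hs ▸ hβ.mul (hr.pow 2))
    refine ⟨s, hsu, ?_⟩
    rwa [compound_smul, compound_one, smul_smul, ← hs] at hX
  · rintro ⟨s, hs, hXs⟩
    have h1 := hX.eq_mat hXs
    obtain ⟨β, rfl⟩ := hβ
    have h3 : compound M = (((β⁻¹ : (R ⊗[F] E)ˣ) : R ⊗[F] E) * algebraMap R _ s) •
        (1 : Matrix (Fin 6) (Fin 6) (R ⊗[F] E)) := by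
      rw [← smul_smul, ← h1, smul_smul, Units.inv_mul, one_smul]
    have hu : IsUnit (((β⁻¹ : (R ⊗[F] E)ˣ) : R ⊗[F] E) * algebraMap R _ s) :=
      β⁻¹.isUnit.mul (hs.map _)
    obtain ⟨t, ht, rfl⟩ := eq_scalar_of_compound_eq_scalar hu h3
    exact ⟨t, (isUnit_pow_iff two_ne_zero).mp (ht ▸ hu), hM⟩

theorem IsLift.glMap (b : OrthoBasis H) {S : Type u} [CommRing S] [Algebra F S] (f : R →ₐ[F] S)
    {g : GLp F R V} {h : GLp F R (⋀[E]^2 V)}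
    (hl : IsLift H g h) : IsLift H (ExcIso.glMap f g) (ExcIso.glMap f h) := by
  obtain ⟨M, ν, β, hM, hν, hβ, hMν, hβM, hX⟩ := b.exists_of_isLift hl
  refine (b.isLift_iff (hM.glMap f)).mpr ⟨f ν, mapE E f β, hν.map f, hβ.map _,
    b.isUnitarySim_map f hMν, ?_, ?_⟩
  · have h1 := congrArg (mapE E f) hβM
    rw [map_mul, map_mul, mapE_algebraMap, mapE_conjR, map_pow] at h1
    rw [← h1]
    congr 1
    exact ((mapE E f : R ⊗[F] E →+* S ⊗[F] E).map_det M).symm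
  · convert hX.glMap f
    have h3 := compound_map (mapE E f : R ⊗[F] E →+* S ⊗[F] E) M
    ext k l
    have h4 := congrFun (congrFun h3 k) l
    change mapE E f β * compound (M.map (mapE E f)) k l = mapE E f (β * compound M k l)
    rw [map_mul]
    exact congrArg _ h4

theorem OrthoBasis.glMap_mem_GSUE (b : OrthoBasis H) {S : Type u} [CommRing S] [Algebra F S]
    (f : R →ₐ[F] S) {g : GLp F R V} (hg : g ∈ GSUE H R) : ExcIso.glMap f g ∈ GSUE H S := by
  obtain ⟨M, hM, ν, hν, hMν, hd⟩ := b.mem_GSUE_iff.mp hg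
  refine b.mem_GSUE_iff.mpr ⟨_, hM.glMap f, f ν, hν.map f, b.isUnitarySim_map f hMν, ?_⟩
  rw [← map_pow, ← mapE_algebraMap, ← hd]
  exact ((mapE E f : R ⊗[F] E →+* S ⊗[F] E).map_det M).symm

theorem OrthoBasis.isLift_of_compound (b : OrthoBasis H) {g : GLp F R V} (hg : g ∈ GSUE H R)
    {h : GLp F R (⋀[E]^2 V)} (hh : HasMat b.basis₂ h (compound (toMat b.basis g))) :
    IsLift H g h := by
  obtain ⟨M, hM, ν, hν, hMν, hd⟩ := b.mem_GSUE_iff.mp hg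
  obtain rfl := (hasMat_toMat b.basis _ hM.actE_comm).eq_mat hM
  refine (b.isLift_iff hM).mpr ⟨ν, 1, hν, isUnit_one, hMν, ?_, ?_⟩
  · rw [one_mul, map_one, mul_one, hd]
  · rwa [one_smul]

/-! ### Lifts, identity components and existence of scalars -/

section Components

variable {d : (⋀[E]^4 V) ≃ₗ[E] E} {hψ : Function.Bijective (psi d)} {J : F} {i : E}
  (h2 : (2 : F) ≠ 0) (hi : i ≠ 0) (hi' : ρ i = -i)
  (hL : ∀ x, opL H d hψ (opL H d hψ x) = J • x) (hJ : J ≠ 0)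

include h2 hi hi' hL hJ

theorem IsLift.mem_GUB0 (b : OrthoBasis H) {g : GLp F R V} {h : GLp F R (⋀[E]^2 V)}
    (hl : IsLift H g h) : h ∈ GUB0 H d hψ i J R := by
  obtain ⟨M, ν, β, hM, hν, hβ, hMν, hβM, hX⟩ := b.exists_of_isLift hl
  exact b.mem_GUB0_of_isUnitarySim h2 hi hi' hL hJ hν hMν hβ hβM hX

theorem IsLift.mem_GUB₂0 {b : OrthoBasis H} {V₁ V₂ : Submodule E V} (hb : b.IsAdapted V₁ V₂)
    {g : GLp F R V} {h : GLp F R (⋀[E]^2 V)}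
    (hl : IsLift H g h) (hg : g ∈ GUE₂ H V₁ V₂ R) : h ∈ GUB₂0 H d hψ i J V₁ V₂ R := by
  obtain ⟨M, ν, β, hM, hν, hβ, hMν, hβM, hX⟩ := b.exists_of_isLift hl
  exact hb.mem_GUB₂0_of_isUnitarySim h2 hi hi' hL hJ hν hMν hβ hβM hX
    ((hb.mem_stab_iff (isQuadInvol_conjR h2 hi hi' R).two' hM).mp hg.2)

theorem OrthoBasis.exists_compoundHom (b : OrthoBasis H) :
    ∃ φ : GSUE H R →* GUB0 H d hψ i J R, ∀ g, HasMat b.basis₂ (φ g : GLp F R (⋀[E]^2 V))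
      (compound (toMat b.basis (g : GLp F R V))) := by
  have key : ∀ g : GSUE H R, ∃ h : GUB0 H d hψ i J R, HasMat b.basis₂ (h : GLp F R (⋀[E]^2 V))
      (compound (toMat b.basis (g : GLp F R V))) := by
    intro g
    obtain ⟨M, hM, ν, hν, hMν, hd⟩ := b.mem_GSUE_iff.mp g.2
    obtain rfl := (hasMat_toMat b.basis _ hM.actE_comm).eq_mat hM
    have h3 : IsUnit (compound (toMat b.basis (g : GLp F R V))).det := by
      rw [det_compound]
      exact (hMν.isUnit_det b.isUnit_coeffR hν).pow 3
    obtain ⟨h, hh⟩ := exists_hasMat b.basis₂ h3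
    refine ⟨⟨h, b.mem_GUB0_of_isUnitarySim h2 hi hi' hL hJ hν hMν isUnit_one ?_
      ((one_smul (R ⊗[F] E) (compound (toMat b.basis (g : GLp F R V)))).symm ▸ hh)⟩, hh⟩
    rw [one_mul, map_one, mul_one, hd]
  choose φ hφ using key
  refine ⟨MonoidHom.mk' φ fun g g' => Subtype.ext ?_, hφ⟩
  refine (hφ (g * g')).eq_gl ?_
  have h3 := (hφ g).mul (hφ g')
  rw [← compound_mul] at h3
  have h4 := (hasMat_toMat b.basis (g : GLp F R V) g.2.1.1).mul
    (hasMat_toMat b.basis (g' : GLp F R V) g'.2.1.1)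
  rwa [← (hasMat_toMat b.basis (g * g' : GLp F R V) (g * g').2.1.1).eq_mat h4] at h3

/-- Over an algebraically closed field, the elements of the identity component are of the form
`⋀² M`, with `det M = ν²`. -/
theorem OrthoBasis.exists_compound_of_mem_GUB0 (b : OrthoBasis H) {K : Type u} [Field K]
    [IsAlgClosed K] [Algebra F K] {h : GLp F K (⋀[E]^2 V)} (hh : h ∈ GUB0 H d hψ i J K) :
    ∃ (M : Matrix (Fin 4) (Fin 4) (K ⊗[F] E)) (ν : K), IsUnit ν ∧
      IsUnitarySim (conjR ρ K) (b.coeffR K) M ν ∧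
      M.det = algebraMap K (K ⊗[F] E) (ν ^ 2) ∧ HasMat b.basis₂ h (compound M) := by
  have hq := isQuadInvol_conjR h2 hi hi' K
  obtain ⟨M, c, -, μ, -, hc, hμ, -, hXμ, hX⟩ := b.exists_of_mem_GUB0 h2 hi hi' hL hJ hh
  -- The scalar is absorbed through `⋀²(r M) = r² ⋀²M`. With `c = 1`, the commutation equation
  -- becomes `det = ν²`.
  obtain ⟨r, rfl⟩ := hq.exists_sq_eq hc
  rw [← compound_smul] at hXμ hX
  have hXμ' : IsQuatSim (conjR ρ K) (b.coeffR K) (b.discR d K)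
      ((1 : K ⊗[F] E) • compound (r • M)) μ := by rwa [one_smul]
  obtain ⟨ν, hν, hM⟩ := hXμ'.exists_isUnitarySim hq b.isUnit_coeffR (b.isUnit_discR d) hμ
    isUnit_one
  have h3 := hM.eq_of_isQuatSim b.isUnit_coeffR (b.isUnit_discR d) hXμ'
  rw [one_mul, map_one, mul_one] at h3
  exact ⟨_, ν, hν, hM, h3, hX⟩

variable [IsLocalRing R]

theorem OrthoBasis.exists_isLift_of_mem_GUB0 (b : OrthoBasis H) {h : GLp F R (⋀[E]^2 V)}
    (hh : h ∈ GUB0 H d hψ i J R) : ∃ g, IsLift H g h := by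
  obtain ⟨M, c, ν, μ, hν, hc, hμ, hM, hXμ, hX⟩ := b.exists_of_mem_GUB0 h2 hi hi' hL hJ hh
  obtain ⟨g, hg⟩ := exists_hasMat b.basis (hM.isUnit_det b.isUnit_coeffR hν)
  exact ⟨g, (b.isLift_iff hg).mpr ⟨ν, c, hν, hc, hM,
    hM.eq_of_isQuatSim b.isUnit_coeffR (b.isUnit_discR d) hXμ, hX⟩⟩

theorem IsLift.mem_GUE₂ {b : OrthoBasis H} {V₁ V₂ : Submodule E V} (hb : b.IsAdapted V₁ V₂)
    {g : GLp F R V} {h : GLp F R (⋀[E]^2 V)}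
    (hl : IsLift H g h) (hh : h ∈ GUB₂0 H d hψ i J V₁ V₂ R) : g ∈ GUE₂ H V₁ V₂ R := by
  have hq := isQuadInvol_conjR h2 hi hi' R
  refine ⟨hl.1, ?_⟩
  obtain ⟨M, ν, β, hM, hν, hβ, hMν, hβM, hX⟩ := b.exists_of_isLift hl
  obtain ⟨μ, -, -, hμ⟩ := hMν.isQuatSim (δ := b.discR d R) hq b.isUnit_coeffR hν hβ hβM
  exact (hb.mem_stab_iff hq.two' hM).mpr
    (hb.commute_of_mem_GUB₂0 h2 hi hi' hL hJ hh hβ hμ hX)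

omit hL hJ

/-- Hilbert 90 applies to `det M / ν²`, which has norm one by taking determinants in the unitary
relation. -/
theorem OrthoBasis.exists_scalar (b : OrthoBasis H) {g : GLp F R V} (hg : g ∈ GUE H R) :
    ∃ (ν : Rˣ) (β : (R ⊗[F] E)ˣ), IsSim (hermF H) g ν ∧
      (β : R ⊗[F] E) * detE (E := E) g hg.1 =
        algebraMap R (R ⊗[F] E) ((ν : R) ^ 2) * conjR ρ R β := by
  have hq := isQuadInvol_conjR h2 hi hi' R
  obtain ⟨M, hM, _, ⟨ν, rfl⟩, hMν⟩ := b.mem_GUE_iff.mp hg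
  have h3 := hMν.det b.isUnit_coeffR
  have h4 : algebraMap R (R ⊗[F] E) ((ν : R) ^ 2) *
      algebraMap R (R ⊗[F] E) (((ν⁻¹ : Rˣ) : R) ^ 2) = 1 := by
    rw [← map_mul, ← mul_pow, Units.mul_inv, one_pow, map_one]
  have h5 : algebraMap R (R ⊗[F] E) ((ν : R) ^ 4) = algebraMap R (R ⊗[F] E) ((ν : R) ^ 2) *
      algebraMap R (R ⊗[F] E) ((ν : R) ^ 2) := by
    rw [← map_mul, ← pow_add]
  obtain ⟨β, hβ, hβM⟩ := hq.exists_eq_mul_conj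
    (z := M.det * algebraMap R (R ⊗[F] E) (((ν⁻¹ : Rˣ) : R) ^ 2)) (by
      rw [map_mul, AlgEquiv.commutes]
      rw [h5] at h3
      generalize algebraMap R (R ⊗[F] E) ((ν : R) ^ 2) = n at *
      generalize algebraMap R (R ⊗[F] E) (((ν⁻¹ : Rˣ) : R) ^ 2) = n' at *
      linear_combination (n' * n') * h3 + (n * n' + 1) * h4)
  -- Hilbert 90 solves `b = z σ(b)`; the scalar sought is `σ(b)`.
  obtain ⟨β', hβ'⟩ := hβ.map (conjR ρ R)
  refine ⟨ν, β', (b.isSim_hermF_iff hM ν).mpr hMν, ?_⟩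
  rw [hM.detE_eq, hβ', hq.invol]
  nth_rw 2 [hβM]
  linear_combination (-(M.det * conjR ρ R β)) * h4

omit [IsLocalRing R] in
theorem OrthoBasis.exists_isLift (b : OrthoBasis H) {g : GLp F R V} (hg : g ∈ GUE H R) {ν : Rˣ}
    {β : (R ⊗[F] E)ˣ} (h3 : IsSim (hermF H) g ν) (h4 : (β : R ⊗[F] E) * detE (E := E) g hg.1 =
      algebraMap R (R ⊗[F] E) ((ν : R) ^ 2) * conjR ρ R β) :
    ∃ h : GLp F R (⋀[E]^2 V), (∀ x y, h (wedgeR E R x y) =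
      scal R (β : R ⊗[F] E) (wedgeR E R (g x) (g y))) ∧ IsLift H g h := by
  have hM := hasMat_toMat b.basis g hg.1
  have hMν := (b.isSim_hermF_iff hM ν).mp h3
  have h5 := h4
  rw [hM.detE_eq] at h5
  -- Only the invertibility of the matrix is needed here, so the normalization `δ` of `L` is
  -- irrelevant and set to `1`.
  obtain ⟨μ, hμ, -, hX⟩ := hMν.isQuatSim (δ := 1) (isQuadInvol_conjR h2 hi hi' R)
    b.isUnit_coeffR ν.isUnit β.isUnit h5
  obtain ⟨h, hh⟩ := exists_hasMat b.basis₂ (hX.isUnit_det hμ)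
  have h6 := (b.hasMat_compound_iff hM).mp hh
  exact ⟨h, h6, hg, ν, β, h3, h4, h6⟩

theorem OrthoBasis.exists_isLift_of_mem_GUE (b : OrthoBasis H) {g : GLp F R V}
    (hg : g ∈ GUE H R) : ∃ h, IsLift H g h := by
  obtain ⟨ν, β, h3, h4⟩ := b.exists_scalar h2 hi hi' hg
  obtain ⟨h, -, hl⟩ := b.exists_isLift h2 hi hi' hg h3 h4
  exact ⟨h, hl⟩

end Components

section Equiv

variable {d : (⋀[E]^4 V) ≃ₗ[E] E} {hψ : Function.Bijective (psi d)} {J : F} {i : E}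
  (h2 : (2 : F) ≠ 0) (hi : i ≠ 0) (hi' : ρ i = -i)
  (hL : ∀ x, opL H d hψ (opL H d hψ x) = J • x) (hJ : J ≠ 0) [IsLocalRing R]

include h2 hi hi' hL hJ

theorem OrthoBasis.exists_mulEquiv (b : OrthoBasis H) :
    ∃ e : PGUE H R ≃* PGUB0 H d hψ i J R, ∀ (g : GUE H R) (h : GUB0 H d hψ i J R),
      e (g : PGUE H R) = (h : PGUB0 H d hψ i J R) ↔ IsLift H (g : GLp F R V) h := by
  refine exists_quotient_mulEquiv
    (fun (g : GUE H R) (h : GUB0 H d hψ i J R) => IsLift H (g : GLp F R V) h)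
    (fun h h' => h.mul b h') (fun h => h.inv b) (fun g => ?_) (fun h => ?_) _ _
    (fun h => h.mem_iff b h2 hi hi') (fun h hh => ?_)
  · obtain ⟨h, hl⟩ := b.exists_isLift_of_mem_GUE h2 hi hi' g.2
    exact ⟨⟨h, hl.mem_GUB0 h2 hi hi' hL hJ b⟩, hl⟩
  · obtain ⟨g, hl⟩ := b.exists_isLift_of_mem_GUB0 h2 hi hi' hL hJ h.2
    exact ⟨⟨g, hl.1⟩, hl⟩
  · obtain ⟨r, hr, hX⟩ := (mem_homotheties_iff b.basis₂).mp hh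
    exact IsLift.one b r hr hX

theorem OrthoBasis.IsAdapted.exists_mulEquiv {b : OrthoBasis H} {V₁ V₂ : Submodule E V}
    (hb : b.IsAdapted V₁ V₂) :
    ∃ e : PGUE₂ H V₁ V₂ R ≃* PGUB₂0 H d hψ i J V₁ V₂ R,
      ∀ (g : GUE₂ H V₁ V₂ R) (h : GUB₂0 H d hψ i J V₁ V₂ R),
        e (g : PGUE₂ H V₁ V₂ R) = (h : PGUB₂0 H d hψ i J V₁ V₂ R) ↔
          IsLift H (g : GLp F R V) h := by
  refine exists_quotient_mulEquiv
    (fun (g : GUE₂ H V₁ V₂ R) (h : GUB₂0 H d hψ i J V₁ V₂ R) => IsLift H (g : GLp F R V) h)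
    (fun h h' => h.mul b h') (fun h => h.inv b) (fun g => ?_) (fun h => ?_) _ _
    (fun h => h.mem_iff b h2 hi hi') (fun h hh => ?_)
  · obtain ⟨h, hl⟩ := b.exists_isLift_of_mem_GUE h2 hi hi' g.2.1
    exact ⟨⟨h, hl.mem_GUB₂0 h2 hi hi' hL hJ hb g.2⟩, hl⟩
  · obtain ⟨g, hl⟩ := b.exists_isLift_of_mem_GUB0 h2 hi hi' hL hJ
      (GUB₂0_le H d hψ i J V₁ V₂ R h.2)
    exact ⟨⟨g, hl.mem_GUE₂ h2 hi hi' hL hJ hb h.2⟩, hl⟩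
  · obtain ⟨r, hr, hX⟩ := (mem_homotheties_iff b.basis₂).mp hh
    exact IsLift.one b r hr hX

end Equiv

end Lift

theorem OrthoBasis.IsAdapted.of_mem_iff {F : Type u} [Field F] {E : Type v} [Field E] [Algebra F E]
    {V : Type w} [AddCommGroup V] [Module E V] {ρ : E ≃ₐ[F] E}
    {H : V →ₛₗ[(ρ : E →+* E)] V →ₗ[E] E} {V₁ V₂ : Submodule E V} {b : OrthoBasis H}
    (h₁ : ∀ x, x ∈ V₁ ↔ b.basis.repr x 2 = 0 ∧ b.basis.repr x 3 = 0)
    (h₂ : ∀ x, x ∈ V₂ ↔ b.basis.repr x 0 = 0 ∧ b.basis.repr x 1 = 0) : b.IsAdapted V₁ V₂ where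
  mem_fst x := by
    rw [h₁ x]
    refine ⟨fun h k hk => ?_, fun h => ⟨h 2 (by decide), h 3 (by decide)⟩⟩
    fin_cases k
    exacts [absurd (by decide) hk, absurd (by decide) hk, h.1, h.2]
  mem_snd x := by
    rw [h₂ x]
    refine ⟨fun h k hk => ?_, fun h => ⟨h 0 (by decide), h 1 (by decide)⟩⟩
    rcases hk with rfl | rfl
    exacts [h.1, h.2]

end ExcIso

/-! ### Assembly of the theorem -/

set_option maxHeartbeats 1000000 in
theorem propositionp
    {F : Type u} [Field F] (h2 : (2 : F) ≠ 0)
    {E : Type v} [Field E] [Algebra F E] [Algebra.IsQuadraticExtension F E]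
    (ρ : E ≃ₐ[F] E) (hρ : ρ ≠ 1) (i : E) (hi : i ≠ 0) (hi' : ρ i = -i)
    {V : Type w} [AddCommGroup V] [Module E V] [Module F V] [IsScalarTower F E V]
    (hV : Module.finrank E V = 4)
    (H : V →ₛₗ[(ρ : E →+* E)] V →ₗ[E] E)
    (hH : ∀ x y, H x y = ρ (H y x))
    (hH' : ∀ x, (∀ y, H x y = 0) → x = 0)
    (d : (⋀[E]^4 V) ≃ₗ[E] E) :
    -- the map `ψ` is an isomorphism and `L = ψ⁻¹ ∘ ι ∘ ⋀² φ` satisfies `L² = J = vol(H, d)`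
    ∃ (hψ : Function.Bijective (psi d)) (J : F), J ≠ 0 ∧ algebraMap F E J = vol H d ∧
      (∀ x, opL H d hψ (opL H d hψ x) = J • x) ∧
      -- `B = E + E 𝐣` is a quaternion algebra over `F`
      (Algebra.IsCentral F (QuatAlg ρ J) ∧ IsSimpleRing (QuatAlg ρ J) ∧
        Module.finrank F (QuatAlg ρ J) = 4) ∧
      -- `⋀² V` is a right `B`-module, free of rank `3`, with `𝐣` acting by `L`
      (∃ _ : Module (QuatAlg ρ J)ᵐᵒᵖ (⋀[E]^2 V),
        (∀ (b : QuatAlg ρ J) (x : ⋀[E]^2 V), MulOpposite.op b • x = bAct H d hψ J b x) ∧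
        Nonempty (Module.Basis (Fin 3) (QuatAlg ρ J)ᵐᵒᵖ (⋀[E]^2 V))) ∧
      -- `⟨x, y⟩` is a non-degenerate `B`-skew-hermitian form
      (∀ x y b c, bForm H d hψ i J (bAct H d hψ J b x) (bAct H d hψ J c y) =
        b.conj * bForm H d hψ i J x y * c) ∧
      (∀ x y, (bForm H d hψ i J y x).conj = -bForm H d hψ i J x y) ∧
      (∀ x, (∀ y, bForm H d hψ i J x y = 0) → x = 0) ∧
      -- the isogeny `GSU_E(V) → GU_B(⋀² V)⁰`, `g ↦ ⋀² g`
      ∃ ξt : ∀ (R : Type u) [CommRing R] [Algebra F R], GSUE H R →* GUB0 H d hψ i J R,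
        (∀ (R : Type u) [CommRing R] [Algebra F R] (g : GSUE H R) (x y : R ⊗[F] V),
          (ξt R g : GLp F R (⋀[E]^2 V)) (wedgeR E R x y) =
            wedgeR E R ((g : GLp F R V) x) ((g : GLp F R V) y)) ∧
        (∀ (R S : Type u) [CommRing R] [Algebra F R] [CommRing S] [Algebra F S] (f : R →ₐ[F] S)
          (g : GSUE H R), ∃ g' : GSUE H S, (g' : GLp F S V) = glMap f g ∧
            (ξt S g' : GLp F S (⋀[E]^2 V)) = glMap f (ξt R g : GLp F R (⋀[E]^2 V))) ∧
        (∀ (R : Type u) [CommRing R] [Algebra F R] (g : GSUE H R),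
          ξt R g = 1 ↔ ∃ r : R ⊗[F] E, r ^ 2 = 1 ∧ ∀ x, (g : GLp F R V) x = scal R r x) ∧
        (∀ g : GSUE H F, ξt F g = 1 ↔
          (∀ x, (g : GLp F F V) x = x) ∨ (∀ x, (g : GLp F F V) x = -x)) ∧
        (∀ (K : Type u) [Field K] [IsAlgClosed K] [Algebra F K], Function.Surjective (ξt K)) ∧
      -- the isomorphism `ξ : PGU_E(V) ≅ PGU_B(⋀² V)⁰`, natural in `R`, given by `g ↦ β ⋀² g`
      ∃ ξ : ∀ (R : Type u) [CommRing R] [Algebra F R] [IsLocalRing R],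
          PGUE H R ≃* PGUB0 H d hψ i J R,
        (∀ (R : Type u) [CommRing R] [Algebra F R] [IsLocalRing R] (g : GUE H R),
          ∃ (ν : Rˣ) (β : (R ⊗[F] E)ˣ), IsSim (hermF H) (g : GLp F R V) ν ∧
            (β : R ⊗[F] E) * detE (E := E) (g : GLp F R V) g.2.1 =
              algebraMap R (R ⊗[F] E) ((ν : R) ^ 2) * conjR ρ R β) ∧
        (∀ (R : Type u) [CommRing R] [Algebra F R] [IsLocalRing R] (g : GUE H R)
          (ν : Rˣ) (β : (R ⊗[F] E)ˣ), IsSim (hermF H) (g : GLp F R V) ν →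
            (β : R ⊗[F] E) * detE (E := E) (g : GLp F R V) g.2.1 =
              algebraMap R (R ⊗[F] E) ((ν : R) ^ 2) * conjR ρ R β →
            ∃ h : GUB0 H d hψ i J R,
              (∀ x y, (h : GLp F R (⋀[E]^2 V)) (wedgeR E R x y) =
                scal R (β : R ⊗[F] E)
                  (wedgeR E R ((g : GLp F R V) x) ((g : GLp F R V) y))) ∧
              ξ R (g : PGUE H R) = (h : PGUB0 H d hψ i J R)) ∧
        (∀ (R S : Type u) [CommRing R] [Algebra F R] [IsLocalRing R] [CommRing S] [Algebra F S]
          [IsLocalRing S] (f : R →ₐ[F] S) (g : GUE H R) (h : GUB0 H d hψ i J R),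
          ξ R (g : PGUE H R) = (h : PGUB0 H d hψ i J R) →
          ∃ (g' : GUE H S) (h' : GUB0 H d hψ i J S),
            (g' : GLp F S V) = glMap f g ∧
            (h' : GLp F S (⋀[E]^2 V)) = glMap f (h : GLp F R (⋀[E]^2 V)) ∧
            ξ S (g' : PGUE H S) = (h' : PGUB0 H d hψ i J S)) ∧
      -- the restrictions to the subgroups given by an orthogonal decomposition `V = V₁ ⊕ V₂`
      ∀ V₁ V₂ : Submodule E V, Module.finrank E V₁ = 2 → Module.finrank E V₂ = 2 →
        IsCompl V₁ V₂ → (∀ x ∈ V₁, ∀ y ∈ V₂, H x y = 0) →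
        IsCompl (sharp V₁ V₂) (sharp₀ V₁ V₂) ∧
        (∀ x ∈ sharp V₁ V₂, ∀ b, bAct H d hψ J b x ∈ sharp V₁ V₂) ∧
        (∀ x ∈ sharp₀ V₁ V₂, ∀ b, bAct H d hψ J b x ∈ sharp₀ V₁ V₂) ∧
        (∀ x ∈ sharp V₁ V₂, ∀ y ∈ sharp₀ V₁ V₂, bForm H d hψ i J x y = 0) ∧
        (∀ (R : Type u) [CommRing R] [Algebra F R] (g : GSUE H R),
          (g : GLp F R V) ∈ GUE₂ H V₁ V₂ R →
            (ξt R g : GLp F R (⋀[E]^2 V)) ∈ GUB₂0 H d hψ i J V₁ V₂ R) ∧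
        (∀ (K : Type u) [Field K] [IsAlgClosed K] [Algebra F K] (h : GUB0 H d hψ i J K),
          (h : GLp F K (⋀[E]^2 V)) ∈ GUB₂0 H d hψ i J V₁ V₂ K →
            ∃ g : GSUE H K, (g : GLp F K V) ∈ GUE₂ H V₁ V₂ K ∧ ξt K g = h) ∧
        ∃ η : ∀ (R : Type u) [CommRing R] [Algebra F R] [IsLocalRing R],
            PGUE₂ H V₁ V₂ R ≃* PGUB₂0 H d hψ i J V₁ V₂ R,
          ∀ (R : Type u) [CommRing R] [Algebra F R] [IsLocalRing R] (g : GUE₂ H V₁ V₂ R)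
            (h : GUB₂0 H d hψ i J V₁ V₂ R),
            η R (g : PGUE₂ H V₁ V₂ R) = (h : PGUB₂0 H d hψ i J V₁ V₂ R) →
            ξ R (Subgroup.inclusion (inf_le_left : GUE₂ H V₁ V₂ R ≤ GUE H R) g : PGUE H R) =
              (Subgroup.inclusion (GUB₂0_le H d hψ i J V₁ V₂ R) h : PGUB0 H d hψ i J R) := by
  obtain ⟨b⟩ := nonempty_orthoBasis h2 hi hi' hV hH hH'
  have hρ2 : ∀ e, ρ (ρ e) = e := QuatAlg.invol ρ
  have hψ := b.psi_bijective d
  obtain ⟨J, hJvol⟩ : ∃ J : F, algebraMap F E J = vol H d := by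
    -- The volume is the norm of `disc⁻¹` times an element of `F`, hence fixed by `ρ`.
    refine exists_algebraMap_of_fixed h2 hi hi' ?_
    rw [b.vol_eq, map_mul, map_mul, hρ2, AlgEquiv.commutes]
    ring
  have hJ : J ≠ 0 := by
    rintro rfl
    rw [map_zero, b.vol_eq] at hJvol
    refine mul_ne_zero (mul_ne_zero (inv_ne_zero (b.disc_ne_zero d)) ?_) ?_ hJvol.symm
    · exact (map_ne_zero ρ).mpr (inv_ne_zero (b.disc_ne_zero d))
    · exact (map_ne_zero _).mpr (Finset.prod_ne_zero_iff.mpr fun k _ => b.coeff_ne_zero k)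
  have hL : ∀ x, opL H d hψ (opL H d hψ x) = J • x := fun x => by
    rw [b.opL_opL hρ2, ← hJvol, algebraMap_smul]
  have hξt : ∀ (R : Type u) [CommRing R] [Algebra F R], ∃ φ : GSUE H R →* GUB0 H d hψ i J R,
      ∀ g, HasMat b.basis₂ (φ g : GLp F R (⋀[E]^2 V))
        (compound (toMat b.basis (g : GLp F R V))) := fun R _ _ =>
    b.exists_compoundHom h2 hi hi' hL hJ
  choose ξt hξt using hξt
  have hξ : ∀ (R : Type u) [CommRing R] [Algebra F R] [IsLocalRing R],
      ∃ e : PGUE H R ≃* PGUB0 H d hψ i J R, ∀ (g : GUE H R) (h : GUB0 H d hψ i J R),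
        e (g : PGUE H R) = (h : PGUB0 H d hψ i J R) ↔ IsLift H (g : GLp F R V) h :=
    fun R _ _ _ => b.exists_mulEquiv h2 hi hi' hL hJ
  choose ξ hξ using hξ
  have hmat : ∀ (R : Type u) [CommRing R] [Algebra F R] (g : GSUE H R),
      HasMat b.basis (g : GLp F R V) (toMat b.basis (g : GLp F R V)) := fun R _ _ g =>
    hasMat_toMat b.basis _ g.2.1.1
  have hker : ∀ (R : Type u) [CommRing R] [Algebra F R] (g : GSUE H R),
      ξt R g = 1 ↔ ∃ r : R ⊗[F] E, r ^ 2 = 1 ∧ ∀ x, (g : GLp F R V) x = scal R r x := by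
    intro R _ _ g
    constructor
    · intro hg
      have h3 := hξt R g
      rw [hg] at h3
      obtain ⟨r, hr, hM⟩ := eq_scalar_of_compound_eq_scalar isUnit_one
        ((h3.eq_mat hasMat_one).trans (one_smul _ _).symm)
      exact ⟨r, hr, (hasMat_smul_one_iff b.basis r).mp (hM ▸ hmat R g)⟩
    · rintro ⟨r, hr, hg⟩
      refine Subtype.ext ((hξt R g).eq_gl ?_)
      rw [(hmat R g).eq_mat ((hasMat_smul_one_iff b.basis r).mpr hg), compound_smul, hr,
        compound_one, one_smul]
      exact hasMat_one
  have hsurj : ∀ (K : Type u) [Field K] [IsAlgClosed K] [Algebra F K],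
      Function.Surjective (ξt K) := by
    intro K _ _ _ h
    obtain ⟨M, ν, hν, hM, hd, hX⟩ := b.exists_compound_of_mem_GUB0 h2 hi hi' hL hJ h.2
    obtain ⟨g, hg⟩ := exists_hasMat b.basis (hM.isUnit_det b.isUnit_coeffR hν)
    let g' : GSUE H K := ⟨g, b.mem_GSUE_iff.mpr ⟨M, hg, ν, hν, hM, hd⟩⟩
    refine ⟨g', Subtype.ext ((hξt K g').eq_gl ?_)⟩
    rwa [(hmat K g').eq_mat hg]
  refine ⟨hψ, J, hJ, hJvol, hL, ⟨QuatAlg.isCentral h2 hi hi', QuatAlg.isSimpleRing h2 hJ hi hi',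
    QuatAlg.finrank_eq⟩, exists_module hL b, fun x y c e => bForm_bAct hL hJ hi' b x y c e,
    fun x y => conj_bForm hL hJ hi' b x y, fun x hx => bForm_nondegenerate hL hJ hi x hx,
    ξt, ?_, ?_, ?_, ?_, ?_, ξ, ?_, ?_, ?_, ?_⟩
  · intro R _ _ g x y
    have h3 := (b.hasMat_compound_iff (hmat R g) (c := 1)).mp (by
      rw [one_smul]
      exact hξt R g) x y
    rwa [map_one] at h3
  · intro R S _ _ _ _ f g
    refine ⟨⟨glMap f g, b.glMap_mem_GSUE f g.2⟩, rfl, (hξt S _).eq_gl ?_⟩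
    have h3 := (hmat S ⟨glMap f g, b.glMap_mem_GSUE f g.2⟩).eq_mat ((hmat R g).glMap f)
    rw [h3]
    have h4 := (hξt R g).glMap f
    rwa [← RingHom.coe_coe (mapE E f), ← compound_map] at h4
  · exact fun R _ _ g => hker R g
  · intro g
    rw [hker F g]
    constructor
    · rintro ⟨r, hr, hgr⟩
      -- For `R = F` the ring `F ⊗ E` is the field `E`, in which `r² = 1` leaves only `± 1`.
      let e := Algebra.TensorProduct.lid F E
      have h3 : e r ^ 2 = 1 := by rw [← map_pow, hr, map_one]
      have h4 : (e r - 1) * (e r + 1) = 0 := by linear_combination h3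
      rcases mul_eq_zero.mp h4 with h4 | h4
      · have h5 : r = 1 := e.injective (by rw [map_one, ← sub_eq_zero, h4])
        exact Or.inl fun x => by rw [hgr, h5, map_one]; rfl
      · have h5 : r = -1 := e.injective (by rw [map_neg, map_one, eq_neg_iff_add_eq_zero, h4])
        exact Or.inr fun x => by rw [hgr, h5, map_neg, map_one]; rfl
    · rintro (h3 | h3)
      · exact ⟨1, one_pow 2, fun x => by rw [h3, map_one]; rfl⟩
      · exact ⟨-1, by ring, fun x => by rw [h3, map_neg, map_one]; rfl⟩
  · exact fun K _ _ _ => hsurj K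
  · exact fun R _ _ _ g => b.exists_scalar h2 hi hi' g.2
  · intro R _ _ _ g ν β h3 h4
    have hM := hasMat_toMat b.basis (g : GLp F R V) g.2.1
    obtain ⟨h, hl⟩ := b.exists_isLift h2 hi hi' g.2 h3 h4
    exact ⟨⟨h, hl.2.mem_GUB0 h2 hi hi' hL hJ b⟩, hl.1, (hξ R _ _).mpr hl.2⟩
  · intro R S _ _ _ _ _ _ f g h hgh
    have hl := ((hξ R g h).mp hgh).glMap b f
    exact ⟨⟨glMap f g, hl.1⟩, ⟨glMap f h, hl.mem_GUB0 h2 hi hi' hL hJ b⟩, rfl, rfl,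
      (hξ S _ _).mpr hl⟩
  · intro V₁ V₂ hV₁ hV₂ hc ho
    -- The isogeny and `ξ` were built with `b`, the decomposition needs the adapted basis `b'`. No
    -- comparison is required, since `IsLift` does not refer to a basis.
    obtain ⟨b', hb₁, hb₂⟩ := exists_orthoBasis_of_isCompl h2 hi hi' hV hH hH' hV₁ hV₂ hc ho
    have hb : b'.IsAdapted V₁ V₂ := ExcIso.OrthoBasis.IsAdapted.of_mem_iff hb₁ hb₂
    have hη : ∀ (R : Type u) [CommRing R] [Algebra F R] [IsLocalRing R],
        ∃ e : PGUE₂ H V₁ V₂ R ≃* PGUB₂0 H d hψ i J V₁ V₂ R,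
          ∀ (g : GUE₂ H V₁ V₂ R) (h : GUB₂0 H d hψ i J V₁ V₂ R),
            e (g : PGUE₂ H V₁ V₂ R) = (h : PGUB₂0 H d hψ i J V₁ V₂ R) ↔
              IsLift H (g : GLp F R V) h := fun R _ _ _ => hb.exists_mulEquiv h2 hi hi' hL hJ
    choose η hη using hη
    refine ⟨hb.isCompl_sharp, fun x hx c => hb.bAct_mem_sharp c hx,
      fun x hx c => hb.bAct_mem_sharp₀ c hx, fun x hx y hy => hb.bForm_eq_zero hL hJ hx hy,
      fun R _ _ g hg => ?_, fun K _ _ _ h hh => ?_, η, fun R _ _ _ g h hgh => ?_⟩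
    · exact (b.isLift_of_compound g.2 (hξt R g)).mem_GUB₂0 h2 hi hi' hL hJ hb hg
    · obtain ⟨g, rfl⟩ := hsurj K h
      exact ⟨g, (b.isLift_of_compound g.2 (hξt K g)).mem_GUE₂ h2 hi hi' hL hJ hb hh, rfl⟩
    · exact (hξ R _ _).mpr ((hη R g h).mp hgh)
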